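/- For a bounded domain $\Omega\subset\mathbb C^n$ let $K_\Omega(z,t)$ be its Bergman kernel, i.e. the reproducing kernel of the space of square integrable holomorphic functions on $\Omega$, and let $g=\sum_{\alpha,\beta}\frac{\partial^2\log K_\Omega(z,z)}{\partial z_\alpha\,\partial\bar z_\beta}\,dz_\alpha\otimes d\bar z_\beta$ be its Bergman metric. $\Omega$ is called Bergman complete if it is a complete metric space for the distance induced by $g$ (the infimum of the $g$-lengths of $C^1$ curves in $\Omega$). For $z_0\in\Omega$ put $A_{\Omega,z_0}=\{z\in\Omega: K_\Omega(z,z_0)=0\}$ and $$\Phi_{\Omega,z_0}(z)=\log\frac{K_\Omega(z,z)\,K_\Omega(z_0,z_0)}{|K_\Omega(z,z_0)|^2},\qquad z\in\Omega\setminus A_{\Omega,z_0}.$$ We say that $\Phi_{\Omega,z_0}$ blows up at the boundary if $\Phi_{\Omega,z_0}(z)\to+\infty$ as $z\in\Omega\setminus A_{\Omega,z_0}$ tends to any point of $\partial\Omega$, and that $\Omega$ satisfies Condition (ii) if $\Phi_{\Omega,z_0}$ blows up at the boundary for some $z_0\in\Omega$. **Proposition.** For every $n\ge 1$ there is a bounded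 domain in $\mathbb C^n$ which satisfies Condition (ii) but is not Bergman complete. More precisely, let $0<r<1$ and $C_r=\{z\in\mathbb C: r<|z|<1\}$. Then there is $z_0\in C_r$ with $A_{C_r,z_0}\ne\emptyset$; and for every $z_0\in C_r$ with $A_{C_r,z_0}\neq\emptyset$ the following hold, where $D=C_r\setminus A_{C_r,z_0}$: 1. $D$ is a bounded domain containing $z_0$, the function $K_D(\cdot,z_0)$ has no zeros in $D$, $\Phi_{D,z_0}$ blows up at the boundary of $D$ (so $D$ satisfies Condition (ii)), and $D$ is not Bergman complete. 2. For every $n\ge2$, with $\mathbb B^{n-1}$ the Euclidean unit ball of $\mathbb C^{n-1}$, the product $\mathbb B^{n-1}\times D\subset\mathbb C^n$ is a bounded domain that satisfies Condition (ii) but is not Bergman complete. -/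

import Mathlib

open MeasureTheory Filter Topology
open scoped ComplexConjugate ENNReal

noncomputable section

/-- A bounded domain of `ℂⁿ`: a bounded, open, connected, nonempty set. -/
structure IsBoundedDomain {n : ℕ} (Ω : Set (Fin n → ℂ)) : Prop where
  isOpen : IsOpen Ω
  isConnected : IsConnected Ω
  isBounded : Bornology.IsBounded Ω

/-- `f` belongs to the Bergman space `A²(Ω)` of square integrable holomorphic functions on `Ω`. -/
structure MemBergmanSpace {n : ℕ} (Ω : Set (Fin n → ℂ)) (f : (Fin n → ℂ) → ℂ) : Prop where
  differentiableOn : DifferentiableOn ℂ f Ω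
  memLp : MemLp f 2 (volume.restrict Ω)

/-- `k` is a reproducing kernel of the Bergman space `A²(Ω)`. -/
structure IsBergmanKernel {n : ℕ} (Ω : Set (Fin n → ℂ))
    (k : (Fin n → ℂ) → (Fin n → ℂ) → ℂ) : Prop where
  mem : ∀ t ∈ Ω, MemBergmanSpace Ω (fun z => k z t)
  reproducing : ∀ t ∈ Ω, ∀ f : (Fin n → ℂ) → ℂ, MemBergmanSpace Ω f →
    f t = ∫ z in Ω, f z * conj (k z t)

/-- The reproducing kernel is unique on `Ω × Ω`. -/
theorem IsBergmanKernel.unique {n : ℕ} {Ω : Set (Fin n → ℂ)}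
    {k k' : (Fin n → ℂ) → (Fin n → ℂ) → ℂ}
    (hk : IsBergmanKernel Ω k) (hk' : IsBergmanKernel Ω k')
    {z t : Fin n → ℂ} (hz : z ∈ Ω) (ht : t ∈ Ω) : k z t = k' z t := by
  have key : ∀ {l l' : (Fin n → ℂ) → (Fin n → ℂ) → ℂ}, IsBergmanKernel Ω l →
      IsBergmanKernel Ω l' → l z t = conj (l' t z) := by
    intro l l' hl hl'
    have h1 : l z t = ∫ w in Ω, l w t * conj (l' w z) :=
      hl'.reproducing z hz (fun w => l w t) (hl.mem t ht)
    have h2 : l' t z = ∫ w in Ω, l' w z * conj (l w t) :=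
      hl.reproducing t ht (fun w => l' w z) (hl'.mem z hz)
    rw [h1, h2, ← integral_conj]
    simp [mul_comm]
  rw [key hk hk', key hk' hk']

open Classical in
/-- The Bergman kernel `K(z, t)` of `Ω`, that is, the reproducing kernel of `A²(Ω)`. -/
def bergmanKernel {n : ℕ} (Ω : Set (Fin n → ℂ)) : (Fin n → ℂ) → (Fin n → ℂ) → ℂ :=
  if h : ∃ k, IsBergmanKernel Ω k then h.choose else 0

theorem bergmanKernel_eq {n : ℕ} {Ω : Set (Fin n → ℂ)}
    {k : (Fin n → ℂ) → (Fin n → ℂ) → ℂ} (hk : IsBergmanKernel Ω k)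
    {z t : Fin n → ℂ} (hz : z ∈ Ω) (ht : t ∈ Ω) : bergmanKernel Ω z t = k z t := by
  have h : ∃ k, IsBergmanKernel Ω k := ⟨k, hk⟩
  have e : bergmanKernel Ω = h.choose := dif_pos h
  rw [e]
  exact h.choose_spec.unique hk hz ht

/-- The zero set `A_{z₀} = {z ∈ Ω | K(z, z₀) = 0}`. -/
def bergmanZeroSet {n : ℕ} (Ω : Set (Fin n → ℂ)) (z₀ : Fin n → ℂ) : Set (Fin n → ℂ) :=
  {z ∈ Ω | bergmanKernel Ω z z₀ = 0}

/-- The Bergman-Calabi diastasis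
`Φ_{z₀}(z) = log (K(z, z) K(z₀, z₀) / |K(z, z₀)|²)`, a function on `Ω \ A_{z₀}`. -/
def bergmanDiastasis {n : ℕ} (Ω : Set (Fin n → ℂ)) (z₀ z : Fin n → ℂ) : ℝ :=
  Real.log ((bergmanKernel Ω z z).re * (bergmanKernel Ω z₀ z₀).re /
    ‖bergmanKernel Ω z z₀‖ ^ 2)

/-- `Φ_{z₀}` blows up to infinity at the boundary of `Ω`. -/
def DiastasisBlowsUp {n : ℕ} (Ω : Set (Fin n → ℂ)) (z₀ : Fin n → ℂ) : Prop :=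
  ∀ p ∈ frontier Ω, Tendsto (bergmanDiastasis Ω z₀) (𝓝[Ω \ bergmanZeroSet Ω z₀] p) atTop

/-- For some `z₀ ∈ Ω`, `Φ_{z₀}` blows up to infinity at the boundary of `Ω`. -/
def ConditionII {n : ℕ} (Ω : Set (Fin n → ℂ)) : Prop :=
  ∃ z₀ ∈ Ω, DiastasisBlowsUp Ω z₀

/-- The Wirtinger derivative `∂f/∂z_α`. -/
def wirtingerDz {n : ℕ} (α : Fin n) (f : (Fin n → ℂ) → ℂ) (z : Fin n → ℂ) : ℂ :=
  (fderiv ℝ f z (Pi.single α 1) - Complex.I * fderiv ℝ f z (Pi.single α Complex.I)) / 2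

/-- The Wirtinger derivative `∂f/∂z̄_α`. -/
def wirtingerDzbar {n : ℕ} (α : Fin n) (f : (Fin n → ℂ) → ℂ) (z : Fin n → ℂ) : ℂ :=
  (fderiv ℝ f z (Pi.single α 1) + Complex.I * fderiv ℝ f z (Pi.single α Complex.I)) / 2

/-- The coefficient `g_{αβ̄} = ∂² log K(z, z) / ∂z_α ∂z̄_β` of the Bergman metric. -/
def bergmanMetricCoeff {n : ℕ} (Ω : Set (Fin n → ℂ)) (α β : Fin n) : (Fin n → ℂ) → ℂ :=
  wirtingerDz α (wirtingerDzbar β (fun z => ((Real.log (bergmanKernel Ω z z).re : ℝ) : ℂ)))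

/-- The Bergman length of a tangent vector: the square root of `∑ g_{αβ̄}(z) X_α X̄_β`. -/
def bergmanNorm {n : ℕ} (Ω : Set (Fin n → ℂ)) (z X : Fin n → ℂ) : ℝ :=
  √(∑ α, ∑ β, bergmanMetricCoeff Ω α β z * X α * conj (X β)).re

/-- The Bergman length of a curve parametrized by `[0, 1]`. -/
def bergmanLength {n : ℕ} (Ω : Set (Fin n → ℂ)) (γ : ℝ → (Fin n → ℂ)) : ℝ≥0∞ :=
  ∫⁻ t in Set.Icc (0 : ℝ) 1,
    ENNReal.ofReal (bergmanNorm Ω (γ t) (derivWithin γ (Set.Icc 0 1) t))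

/-- The distance induced by the Bergman metric: the infimum of the Bergman lengths of the
`C¹` curves in `Ω` from `p` to `q`. -/
def bergmanDist {n : ℕ} (Ω : Set (Fin n → ℂ)) (p q : Fin n → ℂ) : ℝ≥0∞ :=
  ⨅ (γ : ℝ → (Fin n → ℂ)) (_ : ContDiffOn ℝ 1 γ (Set.Icc 0 1) ∧
    Set.MapsTo γ (Set.Icc 0 1) Ω ∧ γ 0 = p ∧ γ 1 = q), bergmanLength Ω γ

/-- `Ω` is Bergman complete: each sequence in `Ω` that is Cauchy for the Bergman distance
converges for the Bergman distance to a point of `Ω`. -/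
def BergmanComplete {n : ℕ} (Ω : Set (Fin n → ℂ)) : Prop :=
  ∀ u : ℕ → (Fin n → ℂ), (∀ k, u k ∈ Ω) →
    (∀ ε : ℝ≥0∞, 0 < ε → ∃ N, ∀ j ≥ N, ∀ k ≥ N, bergmanDist Ω (u j) (u k) < ε) →
    ∃ p ∈ Ω, Tendsto (fun k => bergmanDist Ω (u k) p) atTop (𝓝 0)

/-- The annulus `{r < |z| < 1}` in `ℂ = ℂ¹`. -/
def annulus (r : ℝ) : Set (Fin 1 → ℂ) := {z | r < ‖z 0‖ ∧ ‖z 0‖ < 1}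

/-- The annulus minus the zero set of its Bergman kernel `K(·, z₀)`. -/
def puncturedAnnulus (r : ℝ) (z₀ : Fin 1 → ℂ) : Set (Fin 1 → ℂ) :=
  annulus r \ bergmanZeroSet (annulus r) z₀

/-- The Euclidean unit ball of `ℂᵐ` (a point for `m = 0`). -/
def euclideanUnitBall (m : ℕ) : Set (Fin m → ℂ) := {z | ∑ i, ‖z i‖ ^ 2 < 1}

/-- The product `𝔹ᵐ × D ⊂ ℂᵐ⁺¹` of the unit ball of `ℂᵐ` with `D ⊂ ℂ`. -/
def ballProd (m : ℕ) (D : Set (Fin 1 → ℂ)) : Set (Fin (m + 1) → ℂ) :=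
  {z | (fun i : Fin m => z i.castSucc) ∈ euclideanUnitBall m ∧
    (fun _ : Fin 1 => z (Fin.last m)) ∈ D}

end

/-! ### Holomorphic functions of several variables: Cauchy, Taylor, Goursat, Osgood. -/

section SeveralVariables

open Metric

/-! Removing the zeros of `K(·, z₀)` from the annulus creates boundary points at which the diastasis
blows up, although the metric does not see them. The zeros are isolated, because `K(z₀, z₀) > 0` and
the annulus is connected. Square integrable holomorphic functions extend across isolated points
(`MemBergmanSpace.exists_extension`), so the punctured domain `D` has the kernel and the metric of
the annulus, restricted (`bergmanKernel_diff_eq`). At a removed zero the denominator `|K(z, z₀)|²`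
tends to `0` while `K(z, z)` stays positive. At the two boundary circles `K(z, z)` tends to infinity
by peak functions, while `K(·, z₀)` is bounded. So the diastasis of `D` blows up everywhere on the
boundary. But the metric is smooth across a removed zero, so a segment running into it has finite
length. Its points form a Cauchy sequence; since the Bergman distance dominates a multiple of the
Euclidean one, the sequence could only converge to the removed point
(`not_bergmanComplete_of_segment`).

That the annulus kernel has a zero follows from the Laurent expansion `K(z, t) = ∑ (z t̄)ⁿ / Nₙ`,
with `Nₙ` the squared norm of `zⁿ`. At `z t̄ = -x` the sum is a nonzero multiple of `F'(x)` for an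
explicit `F` with `F(r) = F(1) = -1/2`, and Rolle's theorem gives `x` in `(r, 1)`
(`exists_bergmanKernel_annulus_eq_zero`).

For the product with a ball the kernels multiply (`isBergmanKernel_ballProd`), and the ball kernel
is constant when one argument is the centre. Hence the diastasis based at `(0, z₀)` is a sum of two
nonnegative functions, at least one of which blows up at each boundary point; the slice `{0} × D`
carries the metric of `D`, so incompleteness persists.

The preliminaries build the general theory: existence of the kernel by Riesz representation, its
smoothness on the diagonal, the identification of the metric with a Laplacian along complex lines,
and a lower bound for the metric. -/

theorem isLittleO_of_norm_le_sq {E F : Type*} [NormedAddCommGroup E] [NormedAddCommGroup F]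
    {f : E → F} {z : E} {R C : ℝ} (hR : 0 < R)
    (h : ∀ w ∈ ball z R, ‖f w‖ ≤ C * ‖w - z‖ ^ 2) : f =o[𝓝 z] (fun w => w - z) := by
  have hO : f =O[𝓝 z] (fun w => ‖w - z‖ ^ 2) := by
    refine Asymptotics.IsBigO.of_bound C ?_
    filter_upwards [ball_mem_nhds z hR] with w hw
    simpa using h w hw
  refine hO.trans_isLittleO ?_
  have : (fun w : E => w - z) =o[𝓝 z] (fun _ => (1 : ℝ)) := by
    rw [Asymptotics.isLittleO_one_iff]
    have : Tendsto (fun w : E => w - z) (𝓝 z) (𝓝 (z - z)) := tendsto_id.sub_const z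
    simpa using this
  have h2 := this.norm_left.mul_isBigO (Asymptotics.isBigO_refl (fun w : E => ‖w - z‖) (𝓝 z))
  refine (h2.congr (fun w => by ring) (fun w => one_mul _)).trans_isBigO ?_
  exact (Asymptotics.isBigO_refl (fun w : E => w - z) (𝓝 z)).norm_left

variable {E F : Type*} [NormedAddCommGroup E] [NormedSpace ℂ E] [NormedAddCommGroup F]
  [NormedSpace ℂ F]

/-- Cauchy's estimate for the Fréchet derivative. -/
theorem norm_fderiv_le_of_forall_ball {f : E → F} {z : E} {R M : ℝ} (hR : 0 < R)
    (hf : DifferentiableOn ℂ f (ball z R)) (hM : ∀ w ∈ ball z R, ‖f w‖ ≤ M) :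
    ‖fderiv ℂ f z‖ ≤ 2 * M / R := by
  refine Complex.norm_fderiv_le_div_of_mapsTo_ball hf (fun w hw => ?_) hR
  rw [mem_closedBall, dist_eq_norm]
  linarith [norm_sub_le (f w) (f z), hM w hw, hM z (mem_ball_self hR)]

/-- A Lipschitz estimate for bounded holomorphic functions. -/
theorem norm_sub_le_of_forall_ball {f : E → F} {z w : E} {R M : ℝ}
    (hf : DifferentiableOn ℂ f (ball z R)) (hM : ∀ w ∈ ball z R, ‖f w‖ ≤ M)
    (hw : w ∈ ball z R) : ‖f w - f z‖ ≤ 2 * M / R * ‖w - z‖ := by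
  have hR : 0 < R := nonempty_ball.mp ⟨_, hw⟩
  rw [← dist_eq_norm, ← dist_eq_norm]
  refine Complex.dist_le_div_mul_dist_of_mapsTo_ball hf (fun w hw => ?_) hw
  rw [mem_closedBall, dist_eq_norm]
  linarith [norm_sub_le (f w) (f z), hM w hw, hM z (mem_ball_self hR)]

/-- Second order Taylor estimate for bounded holomorphic functions. -/
theorem norm_taylor_le_of_forall_ball {f : E → F} {z w : E} {R M : ℝ}
    (hf : DifferentiableOn ℂ f (ball z R)) (hM : ∀ w ∈ ball z R, ‖f w‖ ≤ M)
    (hw : w ∈ ball z R) :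
    ‖f w - f z - fderiv ℂ f z (w - z)‖ ≤ 4 * M / R ^ 2 * ‖w - z‖ ^ 2 := by
  have hR : 0 < R := nonempty_ball.mp ⟨_, hw⟩
  have hz := mem_ball_self (x := z) hR
  have hda : DifferentiableAt ℂ f z := hf.differentiableAt (ball_mem_nhds z hR)
  -- Subtracting the linear part leaves a map into a ball of radius `2M + 2M` that vanishes to
  -- second order at `z`; the Schwarz lemma of order two then gives the constant `4M / R²`.
  set g : E → F := fun v => f v - fderiv ℂ f z (v - z) with hg
  have hgz : g z = f z := by simp [hg]
  have hgd : DifferentiableOn ℂ g (ball z R) := by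
    refine hf.sub (DifferentiableOn.fun_comp (t := Set.univ)
      (fderiv ℂ f z).differentiable.differentiableOn (by fun_prop) (fun _ _ => trivial))
  have hmap : Set.MapsTo g (ball z R) (closedBall (g z) (4 * M)) := by
    intro v hv
    rw [mem_closedBall, dist_eq_norm, hgz]
    have h1 : ‖fderiv ℂ f z (v - z)‖ ≤ 2 * M := by
      have hvn : ‖v - z‖ ≤ R := by rw [← dist_eq_norm]; exact (mem_ball.1 hv).le
      have h2 := norm_fderiv_le_of_forall_ball hR hf hM
      calc ‖fderiv ℂ f z (v - z)‖ ≤ 2 * M / R * R :=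
            (ContinuousLinearMap.le_opNorm _ _).trans (by gcongr; exact (norm_nonneg _).trans h2)
        _ = 2 * M := by field_simp
    have h3 : ‖f v - f z‖ ≤ 2 * M := by
      linarith [norm_sub_le (f v) (f z), hM v hv, hM z hz]
    calc ‖g v - f z‖ = ‖(f v - f z) - fderiv ℂ f z (v - z)‖ := by
          congr 1; simp only [hg]; abel
      _ ≤ 4 * M := by linarith [norm_sub_le (f v - f z) (fderiv ℂ f z (v - z))]
  have hlo : (g · - g z) =o[𝓝 z] (fun w => ‖w - z‖ ^ 1) := by
    have := hda.hasFDerivAt.isLittleO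
    simp only [pow_one]
    refine (this.norm_right).congr_left (fun v => ?_)
    simp only [hg, sub_self, map_zero, sub_zero]; abel
  have := Complex.dist_le_mul_div_pow_of_mapsTo_ball_of_isLittleO hgd hmap hlo hw
  rw [dist_eq_norm, dist_eq_norm, hgz] at this
  calc _ = ‖g w - f z‖ := by congr 1; simp only [hg]; abel
    _ ≤ _ := this
    _ = _ := by rw [div_pow]; ring

/-- A locally uniform limit of holomorphic functions is holomorphic. -/
theorem hasFDerivAt_of_tendstoUniformlyOn_ball [CompleteSpace F] {ι : Type*} {l : Filter ι} [NeBot l]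
    [l.IsCountablyGenerated]
    {f : ι → E → F} {g : E → F} {z : E} {R : ℝ} (hR : 0 < R)
    (hf : ∀ᶠ i in l, DifferentiableOn ℂ (f i) (ball z R))
    (hlim : TendstoUniformlyOn f g l (ball z R)) {M : ℝ}
    (hM : ∀ᶠ i in l, ∀ w ∈ ball z R, ‖f i w‖ ≤ M) :
    ∃ L, Tendsto (fun i => fderiv ℂ (f i) z) l (𝓝 L) ∧ HasFDerivAt g L z := by
  have hc : Cauchy (map (fun i => fderiv ℂ (f i) z) l) := by
    rw [Metric.cauchy_iff]
    refine ⟨inferInstance, fun ε hε => ?_⟩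
    -- Two errors of `εR/16` make `εR/8`, which Cauchy's estimate turns into `ε/4` for the
    -- derivatives.
    have hlim' := (Metric.tendstoUniformlyOn_iff.1 hlim) (ε * R / 16) (by positivity)
    refine ⟨(fun i => fderiv ℂ (f i) z) '' {i | DifferentiableOn ℂ (f i) (ball z R) ∧
      ∀ x ∈ ball z R, dist (g x) (f i x) < ε * R / 16}, image_mem_map (hf.and hlim'), ?_⟩
    rintro _ ⟨i, ⟨hi1, hi2⟩, rfl⟩ _ ⟨j, ⟨hj1, hj2⟩, rfl⟩
    have hd : DifferentiableOn ℂ (f i - f j) (ball z R) := hi1.sub hj1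
    have := norm_fderiv_le_of_forall_ball (M := ε * R / 8) hR hd (fun w hw => by
      have h1 := hi2 w hw
      have h2 := hj2 w hw
      rw [Pi.sub_apply, ← dist_eq_norm]
      have := dist_triangle_left (f i w) (f j w) (g w)
      linarith)
    rw [fderiv_sub (hi1.differentiableAt (ball_mem_nhds z hR))
      (hj1.differentiableAt (ball_mem_nhds z hR)), ← dist_eq_norm] at this
    refine this.trans_lt ?_
    rw [div_lt_iff₀ hR]; nlinarith [mul_pos hε hR]
  obtain ⟨L, hL⟩ := CompleteSpace.complete hc
  refine ⟨L, hL, ?_⟩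
  -- The quadratic Taylor bound is uniform along the family, so it survives the limit and identifies
  -- `L` as the derivative.
  have hkey : ∀ w ∈ ball z R, ‖g w - g z - L (w - z)‖ ≤ 4 * M / R ^ 2 * ‖w - z‖ ^ 2 := by
    intro w hw
    have h1 : Tendsto (fun i => ‖f i w - f i z - fderiv ℂ (f i) z (w - z)‖) l
        (𝓝 ‖g w - g z - L (w - z)‖) := by
      refine (((hlim.tendsto_at hw).sub (hlim.tendsto_at (mem_ball_self hR))).sub ?_).norm
      exact ((ContinuousLinearMap.apply ℂ F (w - z)).continuous.tendsto L).comp hL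
    refine le_of_tendsto h1 ?_
    filter_upwards [hf, hM] with i h2 h3
    exact norm_taylor_le_of_forall_ball h2 h3 hw
  rw [hasFDerivAt_iff_isLittleO]
  exact isLittleO_of_norm_le_sq hR hkey

theorem DifferentiableOn.exists_ball_bound {f : E → F} {U : Set E} (hU : IsOpen U)
    (hf : DifferentiableOn ℂ f U) {z : E} (hz : z ∈ U) :
    ∃ R > 0, ∃ M, ball z R ⊆ U ∧ ∀ w ∈ ball z R, ‖f w‖ ≤ M := by
  have hc : ContinuousAt f z := (hf.continuousOn.continuousAt (hU.mem_nhds hz))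
  have h1 : ∀ᶠ w in 𝓝 z, ‖f w‖ < ‖f z‖ + 1 := hc.norm.eventually_lt_const (by linarith)
  obtain ⟨R, hR, h⟩ := Metric.eventually_nhds_iff_ball.1 (h1.and (hU.mem_nhds hz))
  exact ⟨R, hR, ‖f z‖ + 1, fun w hw => (h w hw).2, fun w hw => (h w hw).1.le⟩

/-- Goursat's theorem: directional derivatives of a holomorphic function are holomorphic. -/
theorem DifferentiableOn.fderiv_apply_const [CompleteSpace F] {f : E → F} {U : Set E}
    (hU : IsOpen U) (hf : DifferentiableOn ℂ f U) (k : E) :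
    DifferentiableOn ℂ (fun z => fderiv ℂ f z k) U := by
  intro z hz
  obtain ⟨R, hR, M, hRU, hM⟩ := hf.exists_ball_bound hU hz
  have hM0 : 0 ≤ M := (norm_nonneg _).trans (hM z (mem_ball_self hR))
  have hsub : ∀ w ∈ ball z (R / 2), ball w (R / 2) ⊆ ball z R := fun w hw =>
    ball_subset_ball' (by have := mem_ball.1 hw; linarith)
  -- The difference quotients are holomorphic and, by the Taylor estimate, converge uniformly on the
  -- half ball with error `O(|s|)`.
  set q : ℂ → E → F := fun s w => s⁻¹ • (f (w + s • k) - f w) with hq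
  have hsmall : ∀ᶠ s : ℂ in 𝓝[≠] 0, s ≠ 0 ∧ ‖s • k‖ < R / 2 := by
    refine eventually_mem_nhdsWithin.and (nhdsWithin_le_nhds ?_)
    have : Tendsto (fun s : ℂ => ‖s • k‖) (𝓝 0) (𝓝 ‖(0 : ℂ) • k‖) := by
      exact (Continuous.tendsto (by fun_prop) 0)
    rw [zero_smul, norm_zero] at this
    exact this.eventually_lt_const (by positivity)
  have hadd : ∀ (s : ℂ), ‖s • k‖ < R / 2 → ∀ w ∈ ball z (R / 2), w + s • k ∈ ball w (R / 2) := by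
    intro s hs w hw; rwa [mem_ball, dist_eq_norm, add_sub_cancel_left]
  have hdiff : ∀ᶠ s in 𝓝[≠] (0 : ℂ), DifferentiableOn ℂ (q s) (ball z (R / 2)) := by
    filter_upwards [hsmall] with s hs
    refine DifferentiableOn.const_smul (DifferentiableOn.sub ?_ ?_) _
    · exact hf.comp (by fun_prop) (fun w hw => hRU (hsub w hw (hadd s hs.2 w hw)))
    · exact hf.mono (fun w hw => hRU (ball_subset_ball (by linarith) hw))
  have hbd : ∀ᶠ s in 𝓝[≠] (0 : ℂ), ∀ w ∈ ball z (R / 2),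
      ‖q s w‖ ≤ 2 * M / (R / 2) * ‖k‖ := by
    filter_upwards [hsmall] with s hs w hw
    have := norm_sub_le_of_forall_ball (hf.mono ((hsub w hw).trans hRU))
      (fun v hv => hM v (hsub w hw hv)) (hadd s hs.2 w hw)
    rw [add_sub_cancel_left, norm_smul] at this
    have hs0 : 0 < ‖s‖ := norm_pos_iff.2 hs.1
    rw [hq, norm_smul, norm_inv, inv_mul_le_iff₀ hs0]
    linarith
  have hlim : TendstoUniformlyOn q (fun w => fderiv ℂ f w k) (𝓝[≠] 0) (ball z (R / 2)) := by
    rw [Metric.tendstoUniformlyOn_iff]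
    intro ε hε
    have h0 : Tendsto (fun s : ℂ => 4 * M / (R / 2) ^ 2 * ‖k‖ ^ 2 * ‖s‖) (𝓝[≠] 0) (𝓝 0) := by
      have : Tendsto (fun s : ℂ => 4 * M / (R / 2) ^ 2 * ‖k‖ ^ 2 * ‖s‖) (𝓝 0)
        (𝓝 (4 * M / (R / 2) ^ 2 * ‖k‖ ^ 2 * ‖(0 : ℂ)‖)) := Continuous.tendsto (by fun_prop) 0
      simp only [norm_zero, mul_zero] at this
      exact this.mono_left nhdsWithin_le_nhds
    filter_upwards [hsmall, h0.eventually_lt_const hε] with s hs hsε w hw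
    have := norm_taylor_le_of_forall_ball (hf.mono ((hsub w hw).trans hRU))
      (fun v hv => hM v (hsub w hw hv)) (hadd s hs.2 w hw)
    rw [add_sub_cancel_left, norm_smul, map_smul] at this
    have hs0 : 0 < ‖s‖ := norm_pos_iff.2 hs.1
    rw [dist_comm, dist_eq_norm]
    refine lt_of_le_of_lt ?_ hsε
    have h2 : q s w - fderiv ℂ f w k = s⁻¹ • (f (w + s • k) - f w - s • fderiv ℂ f w k) := by
      simp only [hq, smul_sub, inv_smul_smul₀ hs.1]
    rw [h2, norm_smul, norm_inv, inv_mul_le_iff₀ hs0]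
    refine this.trans (le_of_eq (by ring))
  obtain ⟨L, -, hL⟩ := hasFDerivAt_of_tendstoUniformlyOn_ball (half_pos hR) hdiff hlim hbd
  exact hL.differentiableAt.differentiableWithinAt

/-- Goursat's theorem: a holomorphic function on a finite-dimensional space is smooth. -/
theorem DifferentiableOn.contDiffOn_of_finiteDimensional [CompleteSpace F] [FiniteDimensional ℂ E]
    {f : E → F} {U : Set E} (hU : IsOpen U) (hf : DifferentiableOn ℂ f U) (n : ℕ) :
    ContDiffOn ℂ n f U := by
  induction n generalizing f F with
  | zero => simpa using hf.continuousOn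
  | succ n ih =>
    push_cast
    rw [contDiffOn_succ_iff_fderiv_of_isOpen hU]
    refine ⟨hf, by simp, contDiffOn_clm_apply.2 fun k => ih (hf.fderiv_apply_const hU k)⟩

/-- A separately holomorphic, locally bounded function of two variables is holomorphic. -/
theorem differentiableOn_prod_of_separately {E' : Type*} [NormedAddCommGroup E'] [NormedSpace ℂ E']
    {f : E × E' → F} {U : Set E} {V : Set E'} (hU : IsOpen U) (hV : IsOpen V)
    (h₁ : ∀ w ∈ V, DifferentiableOn ℂ (fun z => f (z, w)) U)
    (h₂ : ∀ z ∈ U, DifferentiableOn ℂ (fun w => f (z, w)) V)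
    (hb : ∀ p ∈ U ×ˢ V, ∃ M, ∀ᶠ q in 𝓝 p, ‖f q‖ ≤ M) :
    DifferentiableOn ℂ f (U ×ˢ V) := by
  rintro ⟨z, w⟩ ⟨hz, hw⟩
  obtain ⟨M, hM⟩ := hb (z, w) ⟨hz, hw⟩
  obtain ⟨R, hR, hball⟩ := Metric.eventually_nhds_iff_ball.1
    (hM.and ((hU.prod hV).mem_nhds (show (z, w) ∈ U ×ˢ V from ⟨hz, hw⟩)))
  have hmem : ∀ z' ∈ ball z R, ∀ w' ∈ ball w R, ‖f (z', w')‖ ≤ M ∧ z' ∈ U ∧ w' ∈ V := by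
    intro z' hz' w' hw'
    have := hball (z', w') (by rw [← ball_prod_same]; exact ⟨hz', hw'⟩)
    exact ⟨this.1, this.2.1, this.2.2⟩
  have hzR := mem_ball_self (x := z) hR
  have hwR := mem_ball_self (x := w) hR
  have hd1 : ∀ w' ∈ ball w R, DifferentiableOn ℂ (fun z => f (z, w')) (ball z R) := fun w' hw' =>
    (h₁ w' (hmem z hzR w' hw').2.2).mono (fun z' hz' => (hmem z' hz' w' hw').2.1)
  have hd2 : ∀ z' ∈ ball z R, DifferentiableOn ℂ (fun w => f (z', w)) (ball w R) := fun z' hz' =>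
    (h₂ z' (hmem z' hz' w hwR).2.1).mono (fun w' hw' => (hmem z' hz' w' hw').2.2)
  have hM0 : 0 ≤ M := (norm_nonneg _).trans (hmem z hzR w hwR).1
  set A := fderiv ℂ (fun z => f (z, w)) z
  set B := fderiv ℂ (fun w => f (z, w)) w
  refine HasFDerivAt.differentiableAt (f' := A.comp (ContinuousLinearMap.fst ℂ E E') +
    B.comp (ContinuousLinearMap.snd ℂ E E')) ?_ |>.differentiableWithinAt
  -- Three errors of size `4M/R² ν²` each: a Taylor remainder in either variable, and the change of
  -- the `z`-derivative as `w` moves, which is Lipschitz by Cauchy's estimate.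
  have hkey : ∀ q ∈ ball (z, w) R, ‖f q - f (z, w) - (A (q.1 - z) + B (q.2 - w))‖ ≤
      12 * M / R ^ 2 * ‖q - (z, w)‖ ^ 2 := by
    rintro ⟨z', w'⟩ hq
    have hq' := hq
    rw [← ball_prod_same] at hq'
    obtain ⟨hz', hw'⟩ := hq'
    simp only at hz' hw'
    have e1 : ‖z' - z‖ ≤ ‖(z', w') - (z, w)‖ := norm_fst_le ((z', w') - (z, w))
    have e2 : ‖w' - w‖ ≤ ‖(z', w') - (z, w)‖ := norm_snd_le ((z', w') - (z, w))
    set ν := ‖(z', w') - (z, w)‖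
    have t1 := norm_taylor_le_of_forall_ball (hd1 w' hw') (fun v hv => (hmem v hv w' hw').1) hz'
    have t2 := norm_taylor_le_of_forall_ball (hd2 z hzR) (fun v hv => (hmem z hzR v hv).1) hw'
    have t3 : ‖fderiv ℂ (fun z => f (z, w')) z - A‖ ≤ 2 * (2 * M / R * ‖w' - w‖) / R := by
      rw [← fderiv_fun_sub ((hd1 w' hw').differentiableAt (ball_mem_nhds z hR))
        ((hd1 w hwR).differentiableAt (ball_mem_nhds z hR))]
      refine norm_fderiv_le_of_forall_ball hR ((hd1 w' hw').sub (hd1 w hwR)) (fun v hv => ?_)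
      exact norm_sub_le_of_forall_ball (hd2 v hv) (fun u hu => (hmem v hv u hu).1) hw'
    have t4 : ‖(fderiv ℂ (fun z => f (z, w')) z - A) (z' - z)‖ ≤
        2 * (2 * M / R * ν) / R * ν := by
      refine (ContinuousLinearMap.le_opNorm _ _).trans ?_
      gcongr
      exact t3.trans (by gcongr)
    have h1 : 4 * M / R ^ 2 * ‖z' - z‖ ^ 2 ≤ 4 * M / R ^ 2 * ν ^ 2 := by gcongr
    have h2 : 4 * M / R ^ 2 * ‖w' - w‖ ^ 2 ≤ 4 * M / R ^ 2 * ν ^ 2 := by gcongr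
    have h3 : 2 * (2 * M / R * ν) / R * ν = 4 * M / R ^ 2 * ν ^ 2 := by
      field_simp; ring
    have h4 : 12 * M / R ^ 2 * ν ^ 2 = 3 * (4 * M / R ^ 2 * ν ^ 2) := by ring
    have hsplit : f (z', w') - f (z, w) - (A (z' - z) + B (w' - w)) =
        (f (z', w') - f (z, w') - fderiv ℂ (fun z => f (z, w')) z (z' - z)) +
        (fderiv ℂ (fun z => f (z, w')) z - A) (z' - z) +
        (f (z, w') - f (z, w) - B (w' - w)) := by
      rw [sub_apply]; abel
    rw [hsplit, h4]
    refine (norm_add₃_le).trans ?_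
    linarith
  rw [hasFDerivAt_iff_isLittleO]
  exact isLittleO_of_norm_le_sq hR hkey

end SeveralVariables

/-! ### Mean values over circular and balanced sets. -/

section MeanValue

open Metric

/-- Rotations preserve Lebesgue measure on `ℂⁿ`. -/
theorem measurePreserving_circle_smul {n : ℕ} (a : Circle) :
    MeasurePreserving (fun z : Fin n → ℂ => (a : ℂ) • z) := by
  have h : ∀ _ : Fin n, MeasurePreserving (fun z : ℂ => (a : ℂ) * z) := fun _ =>
    (rotation a).measurePreserving
  exact volume_preserving_pi h

theorem circleMap_zero_one (θ : ℝ) : circleMap 0 1 θ = (Circle.exp θ : ℂ) := by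
  simp [circleMap, Circle.coe_exp]

/-- Integrals over circular open sets can be averaged over circles. -/
theorem setIntegral_eq_setIntegral_circleAverage {n : ℕ} {S : Set (Fin n → ℂ)}
    (hS : ∀ a : Circle, ∀ z ∈ S, (a : ℂ) • z ∈ S) (hSo : IsOpen S) {f : (Fin n → ℂ) → ℂ}
    (hf : ContinuousOn f S) (hi : IntegrableOn f S) :
    ∫ w in S, f w = ∫ w in S, Real.circleAverage (fun s : ℂ => f (s • w)) 0 1 := by
  have hpre : ∀ a : Circle, (fun z : Fin n → ℂ => (a : ℂ) • z) ⁻¹' S = S := by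
    intro a
    refine Set.Subset.antisymm (fun z hz => ?_) (fun z hz => hS a z hz)
    have := hS a⁻¹ _ hz
    rwa [smul_smul, ← Circle.coe_mul, inv_mul_cancel, Circle.coe_one, one_smul] at this
  have hemb : ∀ a : Circle, MeasurableEmbedding (fun z : Fin n → ℂ => (a : ℂ) • z) := fun a =>
    measurableEmbedding_const_smul₀ (by simp)
  have hrot : ∀ (a : Circle) {F : Type} [NormedAddCommGroup F] [NormedSpace ℝ F]
      (g : (Fin n → ℂ) → F), ∫ w in S, g ((a : ℂ) • w) = ∫ w in S, g w := by
    intro a F _ _ g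
    have := (measurePreserving_circle_smul a).setIntegral_preimage_emb (hemb a) g S
    rwa [hpre] at this
  have hroti : ∀ a : Circle, IntegrableOn (fun w => f ((a : ℂ) • w)) S := by
    intro a
    have := ((measurePreserving_circle_smul a).integrableOn_comp_preimage (hemb a)
      (f := f) (s := S)).2 hi
    rwa [hpre] at this
  set I : Set ℝ := Set.Ioc 0 (2 * Real.pi)
  have hint : Integrable (Function.uncurry fun (θ : ℝ) w => f (circleMap 0 1 θ • w))
      ((volume.restrict I).prod (volume.restrict S)) := by
    have hmeas : AEStronglyMeasurable
        (Function.uncurry fun (θ : ℝ) w => f (circleMap 0 1 θ • w))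
        ((volume.restrict I).prod (volume.restrict S)) := by
      rw [Measure.prod_restrict]
      refine ContinuousOn.aestronglyMeasurable ?_ (measurableSet_Ioc.prod hSo.measurableSet)
      refine hf.comp (Continuous.continuousOn ?_) (fun p hp => ?_)
      · exact ((continuous_circleMap 0 1).comp continuous_fst).smul continuous_snd
      · simp only [circleMap_zero_one]
        exact hS _ _ hp.2
    rw [integrable_prod_iff hmeas]
    constructor
    · refine Eventually.of_forall (fun θ => ?_)
      simp only [Function.uncurry_apply_pair, circleMap_zero_one]
      exact hroti _
    · simp only [Function.uncurry_apply_pair, circleMap_zero_one]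
      simp_rw [hrot _ (fun w => ‖f w‖)]
      exact integrable_const _
  have hswap := integral_integral_swap hint
  have hl : ∫ θ in I, ∫ w in S, f (circleMap 0 1 θ • w) = (2 * Real.pi) • ∫ w in S, f w := by
    simp only [circleMap_zero_one, hrot _ f]
    simp [I, Real.pi_pos.le]
  simp only [Real.circleAverage_def, intervalIntegral.integral_of_le Real.two_pi_pos.le]
  rw [integral_smul, ← hswap, hl, inv_smul_smul₀ Real.two_pi_pos.ne']

/-- The mean value property on balanced open sets. -/
theorem setIntegral_eq_of_balanced {n : ℕ} {S : Set (Fin n → ℂ)} (hS : Balanced ℂ S)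
    (hSo : IsOpen S) {f : (Fin n → ℂ) → ℂ} (hf : DifferentiableOn ℂ f S)
    (hi : IntegrableOn f S) : ∫ w in S, f w = volume.real S * f 0 := by
  rw [setIntegral_eq_setIntegral_circleAverage
    (fun a z hz => hS.smul_mem (by rw [Circle.norm_coe]) hz) hSo hf.continuousOn hi]
  have hr : ∫ w in S, Real.circleAverage (fun s : ℂ => f (s • w)) 0 1 = ∫ w in S, f 0 := by
    refine setIntegral_congr_fun hSo.measurableSet (fun w hw => ?_)
    -- Balancedness keeps the whole closed disc `s • w`, `|s| ≤ 1`, inside `S`, so the one-variable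
    -- mean value property applies.
    have hd : DiffContOnCl ℂ (fun s : ℂ => f (s • w)) (ball 0 |1|) := by
      refine DifferentiableOn.diffContOnCl ?_
      refine hf.comp (by fun_prop) (fun s hs => ?_)
      refine hS.smul_mem ?_ hw
      have := closure_ball_subset_closedBall hs
      simpa using this
    have h2 := hd.circleAverage
    rwa [zero_smul] at h2
  rw [hr]
  simp

/-- Square integrable holomorphic functions have bounded point evaluations. -/
theorem sq_norm_mul_volume_ball_le {n : ℕ} {f : (Fin n → ℂ) → ℂ} {z : Fin n → ℂ} {ρ : ℝ}
    (hf : DifferentiableOn ℂ f (ball z ρ)) (hi : MemLp f 2 (volume.restrict (ball z ρ))) :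
    ‖f z‖ ^ 2 * volume.real (ball (0 : Fin n → ℂ) ρ) ≤ ∫ w in ball z ρ, ‖f w‖ ^ 2 := by
  have hfin : IsFiniteMeasure (volume.restrict (ball z ρ)) :=
    ⟨by simpa using measure_ball_lt_top⟩
  have hi1 : IntegrableOn f (ball z ρ) := hi.integrable one_le_two
  have hi2 : IntegrableOn (fun w => ‖f w‖ ^ 2) (ball z ρ) :=
    (memLp_two_iff_integrable_sq_norm hi.1).1 hi
  have hpre : (fun w => z + w) ⁻¹' (ball z ρ) = ball 0 ρ := by
    ext w; simp
  have hmp : MeasurePreserving (fun w : Fin n → ℂ => z + w) := measurePreserving_add_left _ z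
  have hme : MeasurableEmbedding (fun w : Fin n → ℂ => z + w) := measurableEmbedding_addLeft z
  have h1 : ∫ w in ball z ρ, f w = volume.real (ball (0 : Fin n → ℂ) ρ) * f z := by
    have := setIntegral_eq_of_balanced (S := ball (0 : Fin n → ℂ) ρ) (f := fun w => f (z + w))
      (balanced_ball_zero) isOpen_ball (hf.comp (by fun_prop) (fun w hw => by simpa using hw))
      (by
        have := (hmp.integrableOn_comp_preimage hme (f := f) (s := ball z ρ)).2 hi1
        rwa [hpre] at this)
    rw [add_zero] at this
    rw [← this, ← hpre, hmp.setIntegral_preimage_emb hme]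
  set V := volume.real (ball (0 : Fin n → ℂ) ρ)
  have hV : volume.real (ball z ρ) = V := Measure.addHaar_real_ball_center _ _ _
  have h2 : V * ‖f z‖ ≤ ∫ w in ball z ρ, ‖f w‖ := by
    have := norm_integral_le_integral_norm (μ := volume.restrict (ball z ρ)) f
    rw [h1, norm_mul, Complex.norm_real, Real.norm_of_nonneg measureReal_nonneg] at this
    exact this
  -- Jensen's inequality by hand: nonnegativity of `∫ (|f| - |f z|)²`, combined with `V |f z| ≤ ∫
  -- |f|`, yields `V |f z|² ≤ ∫ |f|²`.
  have h3 : 0 ≤ ∫ w in ball z ρ, (‖f w‖ - ‖f z‖) ^ 2 := integral_nonneg (fun w => by positivity)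
  have h4 : ∫ w in ball z ρ, (‖f w‖ - ‖f z‖) ^ 2 =
      (∫ w in ball z ρ, ‖f w‖ ^ 2) - 2 * ‖f z‖ * (∫ w in ball z ρ, ‖f w‖) + V * ‖f z‖ ^ 2 := by
    have : ∀ w, (‖f w‖ - ‖f z‖) ^ 2 = ‖f w‖ ^ 2 - 2 * ‖f z‖ * ‖f w‖ + ‖f z‖ ^ 2 := fun w => by ring
    simp_rw [this]
    have hi3 : IntegrableOn (fun w => ‖f w‖ ^ 2 - 2 * ‖f z‖ * ‖f w‖) (ball z ρ) :=
      hi2.sub (hi1.norm.const_mul _)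
    rw [integral_add hi3 (integrable_const _),
      integral_sub hi2 (hi1.norm.const_mul _), integral_const_mul, integral_const]
    simp [hV]
  nlinarith [norm_nonneg (f z)]

end MeanValue

/-! ### Hilbert space identities in `L²` written as integrals. -/

section LTwo

variable {α : Type*} [MeasurableSpace α] {μ : Measure α} {f g : α → ℂ}

theorem inner_toLp_eq_integral (hf : MemLp f 2 μ) (hg : MemLp g 2 μ) :
    inner ℂ (hg.toLp g) (hf.toLp f) = ∫ x, f x * conj (g x) ∂μ := by
  rw [L2.inner_def]
  refine integral_congr_ae ?_
  filter_upwards [hf.coeFn_toLp, hg.coeFn_toLp] with x h1 h2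
  rw [h1, h2, RCLike.inner_apply]

theorem norm_toLp_sq_eq_integral (hf : MemLp f 2 μ) :
    ‖hf.toLp f‖ ^ 2 = ∫ x, ‖f x‖ ^ 2 ∂μ := by
  rw [@norm_sq_eq_re_inner ℂ, inner_toLp_eq_integral hf hf]
  have h2 : ∀ x, f x * conj (f x) = ((‖f x‖ ^ 2 : ℝ) : ℂ) := fun x => by
    rw [Complex.mul_conj, Complex.normSq_eq_norm_sq]
  simp_rw [h2]
  rw [integral_complex_ofReal]
  exact Complex.ofReal_re _

/-- The Cauchy-Schwarz inequality in `L²`. -/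
theorem norm_integral_mul_conj_sq_le (hf : MemLp f 2 μ) (hg : MemLp g 2 μ) :
    ‖∫ x, f x * conj (g x) ∂μ‖ ^ 2 ≤ (∫ x, ‖g x‖ ^ 2 ∂μ) * ∫ x, ‖f x‖ ^ 2 ∂μ := by
  rw [← inner_toLp_eq_integral hf hg, ← norm_toLp_sq_eq_integral hf, ← norm_toLp_sq_eq_integral hg,
    ← mul_pow]
  exact pow_le_pow_left₀ (norm_nonneg _) (norm_inner_le_norm _ _) 2

/-- Pythagoras' theorem in `L²`. -/
theorem integral_norm_add_sq_of_orthogonal (hf : MemLp f 2 μ) (hg : MemLp g 2 μ)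
    (h : ∫ x, g x * conj (f x) ∂μ = 0) (c : ℂ) :
    ∫ x, ‖f x + c * g x‖ ^ 2 ∂μ = (∫ x, ‖f x‖ ^ 2 ∂μ) + ‖c‖ ^ 2 * ∫ x, ‖g x‖ ^ 2 ∂μ := by
  have hs : MemLp (fun x => f x + c * g x) 2 μ := hf.add (hg.const_mul c)
  have e : hs.toLp _ = hf.toLp f + c • hg.toLp g := by
    rw [← MemLp.toLp_const_smul, ← MemLp.toLp_add]; rfl
  rw [← norm_toLp_sq_eq_integral hf, ← norm_toLp_sq_eq_integral hg,
    ← norm_toLp_sq_eq_integral hs, e, ← mul_pow, ← norm_smul]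
  have := norm_add_sq_eq_norm_sq_add_norm_sq_of_inner_eq_zero (𝕜 := ℂ) (hf.toLp f)
    (c • hg.toLp g) (by rw [inner_smul_right, inner_toLp_eq_integral hg hf, h, mul_zero])
  rw [pow_two, this]; ring

end LTwo

/-! ### Closedness of the Bergman space and existence of the kernel. -/

section Existence

open Metric

variable {n : ℕ} {Ω : Set (Fin n → ℂ)}

theorem volume_real_ball_pos {ρ : ℝ} (hρ : 0 < ρ) : 0 < volume.real (ball (0 : Fin n → ℂ) ρ) :=
  ENNReal.toReal_pos (measure_ball_pos _ _ hρ).ne' measure_ball_lt_top.ne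

theorem MemBergmanSpace.sq_norm_mul_le {f : (Fin n → ℂ) → ℂ} (hf : MemBergmanSpace Ω f)
    {z : Fin n → ℂ} {ρ : ℝ} (hρ : ball z ρ ⊆ Ω) :
    ‖f z‖ ^ 2 * volume.real (ball (0 : Fin n → ℂ) ρ) ≤ ∫ w in Ω, ‖f w‖ ^ 2 := by
  have hm : MemLp f 2 (volume.restrict (ball z ρ)) :=
    hf.memLp.mono_measure (Measure.restrict_mono hρ le_rfl)
  refine (sq_norm_mul_volume_ball_le (hf.differentiableOn.mono hρ) hm).trans ?_
  refine setIntegral_mono_set ((memLp_two_iff_integrable_sq_norm hf.memLp.1).1 hf.memLp)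
    (Eventually.of_forall fun w => by positivity) (Eventually.of_forall hρ)

variable (Ω) in
/-- The Bergman space as a subspace of `L²(Ω)`. -/
def bergmanSubmodule : Submodule ℂ (Lp ℂ 2 (volume.restrict Ω)) where
  carrier := {f | ∃ g, DifferentiableOn ℂ g Ω ∧ f =ᵐ[volume.restrict Ω] g}
  add_mem' := by
    rintro f₁ f₂ ⟨g₁, h₁, e₁⟩ ⟨g₂, h₂, e₂⟩
    exact ⟨g₁ + g₂, h₁.add h₂, (Lp.coeFn_add _ _).trans (e₁.add e₂)⟩
  zero_mem' := ⟨0, differentiableOn_const 0, Lp.coeFn_zero _ _ _⟩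
  smul_mem' := by
    rintro c f ⟨g, h, e⟩
    exact ⟨c • g, h.const_smul c, (Lp.coeFn_smul _ _).trans (e.const_smul c)⟩

/-- The holomorphic representative of an element of the Bergman space. -/
noncomputable def bergmanRep (f : bergmanSubmodule Ω) : (Fin n → ℂ) → ℂ := f.2.choose

theorem bergmanRep_ae (f : bergmanSubmodule Ω) :
    (f : Lp ℂ 2 (volume.restrict Ω)) =ᵐ[volume.restrict Ω] bergmanRep f := f.2.choose_spec.2

theorem memBergmanSpace_bergmanRep (f : bergmanSubmodule Ω) :
    MemBergmanSpace Ω (bergmanRep f) :=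
  ⟨f.2.choose_spec.1, (memLp_congr_ae (bergmanRep_ae f)).1 (Lp.memLp _)⟩

theorem integral_norm_bergmanRep_sq (f : bergmanSubmodule Ω) :
    ∫ w in Ω, ‖bergmanRep f w‖ ^ 2 = ‖f‖ ^ 2 := by
  rw [← norm_toLp_sq_eq_integral (memBergmanSpace_bergmanRep f).memLp]
  congr 2
  refine Lp.ext ?_
  exact (MemLp.coeFn_toLp _).trans (bergmanRep_ae f).symm

/-- Continuous functions that agree almost everywhere on an open set agree everywhere on it. This
makes point values of an `L²` class well defined and linear. -/
theorem bergmanRep_eq (hΩ : IsOpen Ω) {f : bergmanSubmodule Ω} {g : (Fin n → ℂ) → ℂ}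
    (hg : DifferentiableOn ℂ g Ω) (h : (f : Lp ℂ 2 (volume.restrict Ω)) =ᵐ[volume.restrict Ω] g) :
    Set.EqOn (bergmanRep f) g Ω :=
  Measure.eqOn_open_of_ae_eq ((bergmanRep_ae f).symm.trans h) hΩ
    (memBergmanSpace_bergmanRep f).differentiableOn.continuousOn hg.continuousOn

theorem bergmanRep_sub (hΩ : IsOpen Ω) (f g : bergmanSubmodule Ω) :
    Set.EqOn (bergmanRep (f - g)) (bergmanRep f - bergmanRep g) Ω :=
  bergmanRep_eq hΩ ((memBergmanSpace_bergmanRep f).1.sub (memBergmanSpace_bergmanRep g).1)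
    ((Lp.coeFn_sub _ _).trans ((bergmanRep_ae f).sub (bergmanRep_ae g)))

theorem norm_bergmanRep_le (f : bergmanSubmodule Ω) {z : Fin n → ℂ} {ρ : ℝ} (hρ : 0 < ρ)
    (hz : ball z ρ ⊆ Ω) :
    ‖bergmanRep f z‖ ≤ (√(volume.real (ball (0 : Fin n → ℂ) ρ)))⁻¹ * ‖f‖ := by
  have h := (memBergmanSpace_bergmanRep f).sq_norm_mul_le hz
  rw [integral_norm_bergmanRep_sq] at h
  have hV := volume_real_ball_pos (n := n) hρ
  refine le_of_sq_le_sq ?_ (by positivity)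
  rw [mul_pow, inv_pow, Real.sq_sqrt hV.le, inv_mul_eq_div, le_div_iff₀ hV]
  exact h

/-- Point evaluations are bounded by the `L²` norm, locally uniformly in the point, so `L²`
convergence forces locally uniform convergence of the representatives to a holomorphic function. An
almost everywhere convergent subsequence identifies it with the `L²` limit. -/
theorem isClosed_bergmanSubmodule (hΩ : IsOpen Ω) :
    IsClosed (bergmanSubmodule Ω : Set (Lp ℂ 2 (volume.restrict Ω))) := by
  refine IsSeqClosed.isClosed fun u f hu hlim => ?_
  set v : ℕ → bergmanSubmodule Ω := fun k => ⟨u k, hu k⟩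
  have hcau : ∀ ε > 0, ∃ N, ∀ j ≥ N, ∀ k ≥ N, ‖v j - v k‖ < ε := by
    intro ε hε
    obtain ⟨N, hN⟩ := Metric.cauchySeq_iff.1 hlim.cauchySeq ε hε
    exact ⟨N, fun j hj k hk => by
      have := hN j hj k hk
      rwa [dist_eq_norm] at this⟩
  obtain ⟨B, hB⟩ := hlim.norm.bddAbove_range
  have hB : ∀ k, ‖v k‖ ≤ B := fun k => hB ⟨k, rfl⟩
  have hB0 : 0 ≤ B := (norm_nonneg _).trans (hB 0)
  -- local uniform convergence
  have hloc : ∀ z ∈ Ω, ∃ R > 0, UniformCauchySeqOn (fun k => bergmanRep (v k)) atTop (ball z R) ∧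
      ball z R ⊆ Ω ∧ ∃ M, ∀ k, ∀ w ∈ ball z R, ‖bergmanRep (v k) w‖ ≤ M := by
    intro z hz
    obtain ⟨R, hR, hRΩ⟩ := Metric.isOpen_iff.1 hΩ z hz
    have hsub : ∀ w ∈ ball z (R / 2), ball w (R / 2) ⊆ Ω := fun w hw =>
      (ball_subset_ball' (by have := mem_ball.1 hw; linarith)).trans hRΩ
    have hV := volume_real_ball_pos (n := n) (half_pos hR)
    have hRΩ' : ball z (R / 2) ⊆ Ω := (ball_subset_ball (by linarith)).trans hRΩ
    refine ⟨R / 2, half_pos hR, ?_, hRΩ', _, fun k w hw =>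
      (norm_bergmanRep_le (v k) (half_pos hR) (hsub w hw)).trans
        (mul_le_mul_of_nonneg_left (hB k) (by positivity))⟩
    rw [Metric.uniformCauchySeqOn_iff]
    intro ε hε
    obtain ⟨N, hN⟩ := hcau (ε * √(volume.real (ball (0 : Fin n → ℂ) (R / 2)))) (by positivity)
    refine ⟨N, fun j hj k hk w hw => ?_⟩
    rw [dist_eq_norm, ← Pi.sub_apply, ← bergmanRep_sub hΩ _ _ (hRΩ' hw)]
    refine (norm_bergmanRep_le _ (half_pos hR) (hsub w hw)).trans_lt ?_
    rw [inv_mul_lt_iff₀ (by positivity), mul_comm]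
    exact hN j hj k hk
  have hpt : ∀ z ∈ Ω, ∃ y, Tendsto (fun k => bergmanRep (v k) z) atTop (𝓝 y) := by
    intro z hz
    obtain ⟨R, hR, hc, -⟩ := hloc z hz
    exact cauchySeq_tendsto_of_complete (hc.cauchySeq (mem_ball_self hR))
  choose! g hg using hpt
  refine ⟨g, fun z hz => ?_, ?_⟩
  · obtain ⟨R, hR, hc, hRΩ, M, hM⟩ := hloc z hz
    obtain ⟨L, -, hL⟩ := hasFDerivAt_of_tendstoUniformlyOn_ball hR
      (Eventually.of_forall fun k => (memBergmanSpace_bergmanRep (v k)).1.mono hRΩ)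
      (hc.tendstoUniformlyOn_of_tendsto fun w hw => hg w (hRΩ hw))
      (Eventually.of_forall hM)
    exact hL.differentiableAt.differentiableWithinAt
  · obtain ⟨ns, hns, hae⟩ := (tendstoInMeasure_of_tendsto_Lp hlim).exists_seq_tendsto_ae
    have hrep : ∀ᵐ w ∂(volume.restrict Ω), ∀ k, (u k) w = bergmanRep (v k) w :=
      ae_all_iff.2 fun k => bergmanRep_ae (v k)
    filter_upwards [hae, hrep, ae_restrict_mem hΩ.measurableSet] with w h1 h2 h3
    refine tendsto_nhds_unique h1 ?_
    simp_rw [h2]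
    exact (hg w h3).comp hns.tendsto_atTop

/-- Every open set has a Bergman kernel. -/
theorem exists_isBergmanKernel (hΩ : IsOpen Ω) : ∃ k, IsBergmanKernel Ω k := by
  have : CompleteSpace (bergmanSubmodule Ω) :=
    (isClosed_bergmanSubmodule hΩ).completeSpace_coe
  have key : ∀ t ∈ Ω, ∃ e, MemBergmanSpace Ω e ∧ ∀ f, MemBergmanSpace Ω f →
      f t = ∫ z in Ω, f z * conj (e z) := by
    intro t ht
    obtain ⟨R, hR, hRΩ⟩ := Metric.isOpen_iff.1 hΩ t ht
    -- Evaluation at `t` is a bounded functional on a Hilbert space; its Riesz representative is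
    -- `K(·, t)`.
    let ℓ : bergmanSubmodule Ω →L[ℂ] ℂ := LinearMap.mkContinuous
      { toFun := fun f => bergmanRep f t
        map_add' := fun f g => bergmanRep_eq hΩ
          ((memBergmanSpace_bergmanRep f).1.add (memBergmanSpace_bergmanRep g).1)
          ((Lp.coeFn_add _ _).trans ((bergmanRep_ae f).add (bergmanRep_ae g))) ht
        map_smul' := fun c f => bergmanRep_eq hΩ
          ((memBergmanSpace_bergmanRep f).1.const_smul c)
          ((Lp.coeFn_smul _ _).trans ((bergmanRep_ae f).const_smul c)) ht }
      _ (fun f => norm_bergmanRep_le f hR hRΩ)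
    set e := (InnerProductSpace.toDual ℂ (bergmanSubmodule Ω)).symm ℓ
    refine ⟨bergmanRep e, memBergmanSpace_bergmanRep e, fun f hf => ?_⟩
    set F : bergmanSubmodule Ω := ⟨hf.memLp.toLp f, f, hf.differentiableOn, hf.memLp.coeFn_toLp⟩
    have h1 : inner ℂ e F = bergmanRep F t := InnerProductSpace.toDual_symm_apply
    rw [bergmanRep_eq hΩ hf.differentiableOn hf.memLp.coeFn_toLp ht, Submodule.coe_inner,
      L2.inner_def] at h1
    rw [← h1]
    refine integral_congr_ae ?_
    filter_upwards [hf.memLp.coeFn_toLp, bergmanRep_ae e] with x h2 h3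
    rw [RCLike.inner_apply, h3]
    congr 1
  choose! k hk using key
  exact ⟨fun z t => k t z, fun t ht => (hk t ht).1, fun t ht => (hk t ht).2⟩

end Existence

/-! ### Extremal property, positivity and smoothness of the kernel. -/

section KernelBasics

open Metric

variable {n : ℕ} {Ω : Set (Fin n → ℂ)}

theorem isBergmanKernel_bergmanKernel (hΩ : IsOpen Ω) : IsBergmanKernel Ω (bergmanKernel Ω) := by
  have h := exists_isBergmanKernel hΩ
  rw [show bergmanKernel Ω = h.choose from dif_pos h]
  exact h.choose_spec

theorem bergmanKernel_conj (hΩ : IsOpen Ω) {z t : Fin n → ℂ} (hz : z ∈ Ω) (ht : t ∈ Ω) :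
    bergmanKernel Ω z t = conj (bergmanKernel Ω t z) := by
  have hk := isBergmanKernel_bergmanKernel hΩ
  have h1 := hk.reproducing z hz _ (hk.mem t ht)
  have h2 := hk.reproducing t ht _ (hk.mem z hz)
  rw [h1, h2, ← integral_conj]
  simp [mul_comm]

theorem bergmanKernel_self (hΩ : IsOpen Ω) {z : Fin n → ℂ} (hz : z ∈ Ω) :
    bergmanKernel Ω z z = ((∫ w in Ω, ‖bergmanKernel Ω w z‖ ^ 2 : ℝ) : ℂ) := by
  have hk := isBergmanKernel_bergmanKernel hΩ
  have h1 := hk.reproducing z hz _ (hk.mem z hz)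
  rw [h1, ← integral_complex_ofReal]
  refine integral_congr_ae (Eventually.of_forall fun w => ?_)
  simp only [Complex.mul_conj, Complex.normSq_eq_norm_sq]

theorem bergmanKernel_self_re (hΩ : IsOpen Ω) {z : Fin n → ℂ} (hz : z ∈ Ω) :
    (bergmanKernel Ω z z).re = ∫ w in Ω, ‖bergmanKernel Ω w z‖ ^ 2 := by
  rw [bergmanKernel_self hΩ hz, Complex.ofReal_re]

theorem bergmanKernel_self_eq_ofReal (hΩ : IsOpen Ω) {z : Fin n → ℂ} (hz : z ∈ Ω) :
    bergmanKernel Ω z z = ((bergmanKernel Ω z z).re : ℂ) := by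
  rw [bergmanKernel_self hΩ hz, Complex.ofReal_re]

theorem bergmanKernel_self_nonneg (hΩ : IsOpen Ω) {z : Fin n → ℂ} (hz : z ∈ Ω) :
    0 ≤ (bergmanKernel Ω z z).re := by
  rw [bergmanKernel_self_re hΩ hz]
  exact integral_nonneg fun w => by positivity

/-- The extremal property of the Bergman kernel on the diagonal. -/
theorem MemBergmanSpace.sq_norm_le (hΩ : IsOpen Ω) {f : (Fin n → ℂ) → ℂ}
    (hf : MemBergmanSpace Ω f) {t : Fin n → ℂ} (ht : t ∈ Ω) :
    ‖f t‖ ^ 2 ≤ (bergmanKernel Ω t t).re * ∫ w in Ω, ‖f w‖ ^ 2 := by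
  have hk := isBergmanKernel_bergmanKernel hΩ
  rw [hk.reproducing t ht f hf, bergmanKernel_self_re hΩ ht]
  exact norm_integral_mul_conj_sq_le hf.memLp (hk.mem t ht).memLp

/-- Applying the sub-mean-value inequality to `K(·, z)` itself gives `K(z, z)² V ≤ K(z, z)`. This
local bound is what makes the kernel locally bounded in both variables. -/
theorem bergmanKernel_self_le (hΩ : IsOpen Ω) {z : Fin n → ℂ} {ρ : ℝ} (hρ : 0 < ρ)
    (hz : ball z ρ ⊆ Ω) :
    (bergmanKernel Ω z z).re ≤ (volume.real (ball (0 : Fin n → ℂ) ρ))⁻¹ := by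
  have hzΩ := hz (mem_ball_self hρ)
  have h := ((isBergmanKernel_bergmanKernel hΩ).mem z hzΩ).sq_norm_mul_le hz
  rw [← bergmanKernel_self_re hΩ hzΩ] at h
  have hV := volume_real_ball_pos (n := n) hρ
  have h0 := bergmanKernel_self_nonneg hΩ hzΩ
  rw [bergmanKernel_self_eq_ofReal hΩ hzΩ, Complex.norm_real, Real.norm_of_nonneg h0,
    Complex.ofReal_re] at h
  rw [← one_div, le_div_iff₀ hV]
  rcases h0.eq_or_lt with h0 | h0
  · rw [← h0]; simp
  · by_contra hcon
    push Not at hcon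
    nlinarith

theorem sq_norm_bergmanKernel_le (hΩ : IsOpen Ω) {z t : Fin n → ℂ} (hz : z ∈ Ω) (ht : t ∈ Ω) :
    ‖bergmanKernel Ω z t‖ ^ 2 ≤ (bergmanKernel Ω z z).re * (bergmanKernel Ω t t).re := by
  rw [bergmanKernel_self_re hΩ ht]
  exact ((isBergmanKernel_bergmanKernel hΩ).mem t ht).sq_norm_le hΩ hz

theorem MemBergmanSpace.of_bounded (hΩ : IsOpen Ω) (hvol : volume Ω ≠ ∞) {f : (Fin n → ℂ) → ℂ}
    (hf : DifferentiableOn ℂ f Ω) {C : ℝ} (hC : ∀ z ∈ Ω, ‖f z‖ ≤ C) : MemBergmanSpace Ω f := by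
  have : IsFiniteMeasure (volume.restrict Ω) := ⟨by simpa using hvol.lt_top⟩
  exact ⟨hf, MemLp.of_bound (hf.continuousOn.aestronglyMeasurable hΩ.measurableSet) C
    ((ae_restrict_mem hΩ.measurableSet).mono fun z hz => hC z hz)⟩

/-- The extremal property tested on the constant function `1`. -/
theorem one_le_bergmanKernel_self_mul_volume (hΩ : IsOpen Ω) (hvol : volume Ω ≠ ∞)
    {z : Fin n → ℂ} (hz : z ∈ Ω) : 1 ≤ (bergmanKernel Ω z z).re * volume.real Ω := by
  have h := (MemBergmanSpace.of_bounded hΩ hvol (differentiableOn_const (1 : ℂ)) (C := 1)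
    (fun z _ => by simp)).sq_norm_le hΩ hz
  simpa using h

theorem bergmanKernel_self_pos (hΩ : IsOpen Ω) (hvol : volume Ω ≠ ∞)
    {z : Fin n → ℂ} (hz : z ∈ Ω) : 0 < (bergmanKernel Ω z z).re := by
  have h := one_le_bergmanKernel_self_mul_volume hΩ hvol hz
  have h0 := bergmanKernel_self_nonneg hΩ hz
  by_contra hcon
  rw [le_antisymm (not_lt.1 hcon) h0] at h
  linarith

theorem differentiableOn_bergmanKernel_left (hΩ : IsOpen Ω) {t : Fin n → ℂ} (ht : t ∈ Ω) :
    DifferentiableOn ℂ (fun z => bergmanKernel Ω z t) Ω :=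
  ((isBergmanKernel_bergmanKernel hΩ).mem t ht).differentiableOn

/-- The Bergman kernel on the diagonal is smooth. -/
theorem contDiffOn_bergmanKernel_self (hΩ : IsOpen Ω) :
    ContDiffOn ℝ 2 (fun z => (bergmanKernel Ω z z).re) Ω := by
  set V : Set (Fin n → ℂ) := star ⁻¹' Ω with hVdef
  have hV : IsOpen V := hΩ.preimage continuous_star
  -- Conjugating the second argument makes the kernel holomorphic in each variable separately; it is
  -- locally bounded by Cauchy-Schwarz, hence jointly holomorphic and smooth. The diagonal is
  -- recovered by restricting to `(z, z̄)`.
  set G : (Fin n → ℂ) × (Fin n → ℂ) → ℂ := fun p => bergmanKernel Ω p.1 (star p.2) with hG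
  have hd : DifferentiableOn ℂ G (Ω ×ˢ V) := by
    refine differentiableOn_prod_of_separately hΩ hV
      (fun w hw => differentiableOn_bergmanKernel_left hΩ hw) (fun z hz => ?_) ?_
    · have h1 : DifferentiableOn ℂ (star ∘ (fun t => bergmanKernel Ω t z) ∘ star) V := by
        intro w hw
        have := ((differentiableOn_bergmanKernel_left hΩ hz).differentiableAt
          (hΩ.mem_nhds hw)).star_star
        rw [star_star] at this
        exact this.differentiableWithinAt
      exact h1.congr fun w hw => bergmanKernel_conj hΩ hz hw
    · rintro ⟨z, w⟩ ⟨hz, hw⟩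
      have hloc : ∀ x ∈ Ω, ∃ C ≥ 0, ∀ᶠ y in 𝓝 x, y ∈ Ω ∧ (bergmanKernel Ω y y).re ≤ C := by
        intro x hx
        obtain ⟨R, hR, hRΩ⟩ := Metric.isOpen_iff.1 hΩ x hx
        refine ⟨(volume.real (ball (0 : Fin n → ℂ) (R / 2)))⁻¹, by positivity, ?_⟩
        filter_upwards [ball_mem_nhds x (half_pos hR)] with y hy
        have hsub : ball y (R / 2) ⊆ Ω :=
          (ball_subset_ball' (by have := mem_ball.1 hy; linarith)).trans hRΩ
        exact ⟨hsub (mem_ball_self (half_pos hR)), bergmanKernel_self_le hΩ (half_pos hR) hsub⟩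
      obtain ⟨C, hC0, hC⟩ := hloc z hz
      obtain ⟨C', hC0', hC'⟩ := hloc (star w) hw
      refine ⟨√(C * C'), ?_⟩
      have hC'' : ∀ᶠ v in 𝓝 w, star v ∈ Ω ∧ (bergmanKernel Ω (star v) (star v)).re ≤ C' :=
        continuous_star.continuousAt.eventually hC'
      filter_upwards [hC.prod_nhds hC''] with q hq
      refine Real.le_sqrt_of_sq_le ((sq_norm_bergmanKernel_le hΩ hq.1.1 hq.2.1).trans ?_)
      exact mul_le_mul hq.1.2 hq.2.2 (bergmanKernel_self_nonneg hΩ hq.2.1) hC0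
  have h2 : ContDiffOn ℝ 2 G (Ω ×ˢ V) :=
    (hd.contDiffOn_of_finiteDimensional (hΩ.prod hV) 2).restrict_scalars ℝ
  have hstar : ContDiff ℝ 2 (fun z : Fin n → ℂ => star z) := by
    refine contDiff_pi.2 fun i => ?_
    exact Complex.conjCLE.contDiff.comp (contDiff_apply ℝ ℂ i)
  have h3 : ContDiffOn ℝ 2 (fun z => G (z, star z)) Ω :=
    h2.comp (contDiff_id.prodMk hstar).contDiffOn fun z hz => ⟨hz, by simpa [hVdef] using hz⟩
  have h4 := Complex.reCLM.contDiff.comp_contDiffOn h3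
  refine h4.congr fun z _ => ?_
  simp [hG]

theorem contDiffOn_log_bergmanKernel_self (hΩ : IsOpen Ω) (hvol : volume Ω ≠ ∞) :
    ContDiffOn ℝ 2 (fun z => Real.log (bergmanKernel Ω z z).re) Ω :=
  (contDiffOn_bergmanKernel_self hΩ).log fun _ hz => (bergmanKernel_self_pos hΩ hvol hz).ne'

/-- Comparison of the diastasis with a coordinate function. -/
theorem sq_norm_bergmanKernel_mul_le (hΩ : IsOpen Ω) {z w : Fin n → ℂ}
    (hz : z ∈ Ω) (hw : w ∈ Ω) (j : Fin n) {R : ℝ} (hR : 0 < R) (hj : ∀ x ∈ Ω, ‖x j - z j‖ ≤ R) :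
    ‖bergmanKernel Ω w z‖ ^ 2 * (1 + (‖w j - z j‖ / R) ^ 2) ≤
      (bergmanKernel Ω w w).re * (bergmanKernel Ω z z).re := by
  have hk := isBergmanKernel_bergmanKernel hΩ
  set φ : (Fin n → ℂ) → ℂ := fun x => bergmanKernel Ω x z
  set f : (Fin n → ℂ) → ℂ := fun x => (x j - z j) / R
  have hφ : MemBergmanSpace Ω φ := hk.mem z hz
  have hfd : Differentiable ℂ f := by fun_prop
  have hfn : ∀ x, ‖f x‖ = ‖x j - z j‖ / R := fun x => by
    simp only [f]; rw [norm_div, Complex.norm_real, Real.norm_of_nonneg hR.le]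
  have hf1 : ∀ x ∈ Ω, ‖f x‖ ≤ 1 := fun x hx => by
    rw [hfn, div_le_one hR]; exact hj x hx
  have hψL : MemLp (fun x => f x * φ x) 2 (volume.restrict Ω) := by
    refine MemLp.mono hφ.memLp
      (hfd.continuous.aestronglyMeasurable.mul hφ.memLp.aestronglyMeasurable) ?_
    filter_upwards [ae_restrict_mem hΩ.measurableSet] with x hx
    rw [norm_mul]
    exact mul_le_of_le_one_left (norm_nonneg _) (hf1 x hx)
  have hψ : MemBergmanSpace Ω (fun x => f x * φ x) :=
    ⟨hfd.differentiableOn.mul hφ.differentiableOn, hψL⟩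
  -- `f φ` vanishes at `z`, so it is orthogonal to the reproducing element `φ = K(·, z)`.
  have horth : ∫ x in Ω, f x * φ x * conj (φ x) = 0 := by
    rw [← hk.reproducing z hz _ hψ]; simp [f]
  -- With this `c` the test function takes the value `(1 + |f w|²) φ(w)` at `w`, while by Pythagoras
  -- its squared norm is at most `(1 + |f w|²) K(z, z)`. One factor cancels in the extremal
  -- inequality.
  set c := conj (f w)
  have hF : MemBergmanSpace Ω (fun x => φ x + c * (f x * φ x)) :=
    ⟨hφ.1.add (hψ.1.const_mul c), hφ.2.add (hψ.2.const_mul c)⟩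
  have h1 := hF.sq_norm_le hΩ hw
  rw [integral_norm_add_sq_of_orthogonal hφ.memLp hψL horth c,
    ← bergmanKernel_self_re hΩ hz] at h1
  have h2 : ∫ x in Ω, ‖f x * φ x‖ ^ 2 ≤ (bergmanKernel Ω z z).re := by
    rw [bergmanKernel_self_re hΩ hz]
    refine setIntegral_mono_on ((memLp_two_iff_integrable_sq_norm hψL.1).1 hψL)
      ((memLp_two_iff_integrable_sq_norm hφ.2.1).1 hφ.2) hΩ.measurableSet fun x hx => ?_
    rw [norm_mul]
    gcongr
    exact mul_le_of_le_one_left (norm_nonneg _) (hf1 x hx)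
  have hcn : ‖c‖ = ‖w j - z j‖ / R := by rw [RCLike.norm_conj, hfn]
  set a := ‖w j - z j‖ / R
  have h3 : φ w + c * (f w * φ w) = ((1 + a ^ 2 : ℝ) : ℂ) * φ w := by
    have : c * f w = ((a ^ 2 : ℝ) : ℂ) := by
      rw [mul_comm, Complex.mul_conj, Complex.normSq_eq_norm_sq, hfn]
    rw [← mul_assoc, this]; push_cast; ring
  rw [h3, norm_mul, Complex.norm_real, Real.norm_of_nonneg (by positivity), hcn] at h1
  have hKw := bergmanKernel_self_nonneg hΩ hw
  have h4 : (1 + a ^ 2) ^ 2 * ‖φ w‖ ^ 2 ≤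
      (bergmanKernel Ω w w).re * (bergmanKernel Ω z z).re * (1 + a ^ 2) := by
    calc _ = ((1 + a ^ 2) * ‖φ w‖) ^ 2 := by ring
      _ ≤ _ := h1
      _ ≤ (bergmanKernel Ω w w).re *
        ((bergmanKernel Ω z z).re + a ^ 2 * (bergmanKernel Ω z z).re) := by gcongr
      _ = _ := by ring
  have h5 : 0 < 1 + a ^ 2 := by positivity
  refine le_of_mul_le_mul_right ?_ h5
  calc _ = (1 + a ^ 2) ^ 2 * ‖φ w‖ ^ 2 := by ring
    _ ≤ _ := h4

end KernelBasics

/-! ### The Levi form as a Laplacian along complex lines. -/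

section LeviForm

open Laplacian InnerProductSpace

variable {n : ℕ}

theorem clm_apply_eq_sum (d : (Fin n → ℂ) →L[ℝ] ℂ) (Y : Fin n → ℂ) :
    d Y = ∑ β, ((Y β).re * d (Pi.single β 1) + (Y β).im * d (Pi.single β Complex.I)) := by
  have h : Y = ∑ β, ((Y β).re • (Pi.single β 1 : Fin n → ℂ) +
      (Y β).im • (Pi.single β Complex.I : Fin n → ℂ)) := by
    ext i
    simp only [Finset.sum_apply, Pi.add_apply, Pi.smul_apply, Pi.single_apply, smul_ite, smul_zero]
    rw [Finset.sum_add_distrib]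
    simp [Complex.re_add_im]
  conv_lhs => rw [h]
  simp only [map_sum, map_add, map_smul, Complex.real_smul]

theorem sum_mul_wirtingerDzbar (f : (Fin n → ℂ) → ℂ) (w X : Fin n → ℂ) :
    ∑ β, conj (X β) * wirtingerDzbar β f w =
      (fderiv ℝ f w X + Complex.I * fderiv ℝ f w (Complex.I • X)) / 2 := by
  rw [clm_apply_eq_sum _ X, clm_apply_eq_sum _ (Complex.I • X), Finset.mul_sum,
    ← Finset.sum_add_distrib, Finset.sum_div]
  refine Finset.sum_congr rfl fun β _ => ?_
  have h1 : conj (X β) = (X β).re - (X β).im * Complex.I := by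
    apply Complex.ext <;> simp
  simp only [wirtingerDzbar, Pi.smul_apply, smul_eq_mul, Complex.I_mul_re, Complex.I_mul_im]
  rw [h1]
  push_cast
  linear_combination (-(X β).im * fderiv ℝ f w (Pi.single β Complex.I) / 2) * Complex.I_mul_I

theorem sum_mul_wirtingerDz (f : (Fin n → ℂ) → ℂ) (w X : Fin n → ℂ) :
    ∑ α, X α * wirtingerDz α f w =
      (fderiv ℝ f w X - Complex.I * fderiv ℝ f w (Complex.I • X)) / 2 := by
  rw [clm_apply_eq_sum _ X, clm_apply_eq_sum _ (Complex.I • X), Finset.mul_sum,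
    ← Finset.sum_sub_distrib, Finset.sum_div]
  refine Finset.sum_congr rfl fun β _ => ?_
  have h1 : X β = (X β).re + (X β).im * Complex.I := (Complex.re_add_im _).symm
  simp only [wirtingerDz, Pi.smul_apply, smul_eq_mul, Complex.I_mul_re, Complex.I_mul_im]
  rw [h1]
  simp only [Complex.add_re, Complex.add_im, Complex.mul_re, Complex.mul_im, Complex.ofReal_re,
    Complex.ofReal_im, Complex.I_re, Complex.I_im]
  push_cast
  linear_combination (-(X β).im * fderiv ℝ f w (Pi.single β Complex.I) / 2) * Complex.I_mul_I

theorem ContDiffAt.differentiableAt_fderiv {E F : Type*} [NormedAddCommGroup E] [NormedSpace ℝ E]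
    [NormedAddCommGroup F] [NormedSpace ℝ F] {u : E → F} {z : E} (hu : ContDiffAt ℝ 2 u z) :
    DifferentiableAt ℝ (fderiv ℝ u) z :=
  (hu.fderiv_right (m := 1) (by norm_num)).differentiableAt one_ne_zero

theorem ContDiffAt.eventually_differentiableAt {E F : Type*} [NormedAddCommGroup E]
    [NormedSpace ℝ E] [NormedAddCommGroup F] [NormedSpace ℝ F] {u : E → F} {z : E}
    (hu : ContDiffAt ℝ 2 u z) : ∀ᶠ w in 𝓝 z, DifferentiableAt ℝ u w :=
  (hu.eventually (by simp)).mono fun _ h => h.differentiableAt two_ne_zero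

/-- The Laplacian along a complex line. -/
theorem laplacian_comp_line {u : (Fin n → ℂ) → ℝ} {z : Fin n → ℂ} (hu : ContDiffAt ℝ 2 u z)
    (X : Fin n → ℂ) : Δ (fun s : ℂ => u (z + s • X)) 0 =
      fderiv ℝ (fderiv ℝ u) z X X +
        fderiv ℝ (fderiv ℝ u) z (Complex.I • X) (Complex.I • X) := by
  set ℓ : ℂ →L[ℝ] (Fin n → ℂ) := (ContinuousLinearMap.toSpanSingleton ℂ X).restrictScalars ℝ
  have hℓ : ∀ s, ℓ s = s • X := fun s => rfl
  have hline : ∀ s : ℂ, HasFDerivAt (fun s : ℂ => z + s • X) ℓ s := fun s =>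
    ℓ.hasFDerivAt.const_add z
  have hcont : Tendsto (fun s : ℂ => z + s • X) (𝓝 0) (𝓝 z) := by
    have := (hline 0).continuousAt.tendsto
    simpa using this
  have h1 : fderiv ℝ (fun s : ℂ => u (z + s • X)) =ᶠ[𝓝 0]
      fun s => (fderiv ℝ u (z + s • X)).comp ℓ := by
    filter_upwards [hcont.eventually hu.eventually_differentiableAt] with s hs
    exact (hs.hasFDerivAt.comp s (hline s)).fderiv
  have hd : HasFDerivAt (fderiv ℝ u) (fderiv ℝ (fderiv ℝ u) z) (z + (0 : ℂ) • X) := by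
    simpa using hu.differentiableAt_fderiv.hasFDerivAt
  have h2 : HasFDerivAt (fun s : ℂ => (fderiv ℝ u (z + s • X)).comp ℓ)
      (((ContinuousLinearMap.compL ℝ ℂ (Fin n → ℂ) ℝ).flip ℓ).comp
        ((fderiv ℝ (fderiv ℝ u) z).comp ℓ)) 0 :=
    (((ContinuousLinearMap.compL ℝ ℂ (Fin n → ℂ) ℝ).flip ℓ).hasFDerivAt).comp 0
      (hd.comp 0 (hline 0))
  rw [laplacian_eq_iteratedFDeriv_complexPlane]
  simp only [iteratedFDeriv_two_apply]
  rw [h1.fderiv_eq, h2.fderiv]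
  simp [hℓ]

/-- Contracting with `X` turns the Wirtinger operators into `(∂_X - i ∂_{iX}) / 2` and `(∂_X + i
∂_{iX}) / 2`. In their composition the mixed terms cancel by symmetry of the second derivative. -/
theorem sum_wirtinger_eq_laplacian {u : (Fin n → ℂ) → ℝ} {z : Fin n → ℂ}
    (hu : ContDiffAt ℝ 2 u z) (X : Fin n → ℂ) :
    ∑ α, ∑ β, wirtingerDz α (wirtingerDzbar β (fun z => (u z : ℂ))) z * X α * conj (X β) =
      ((Δ (fun s : ℂ => u (z + s • X)) 0 / 4 : ℝ) : ℂ) := by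
  set U : (Fin n → ℂ) → ℂ := fun z => (u z : ℂ)
  set D := fderiv ℝ (fderiv ℝ u) z
  have hU : ∀ᶠ w in 𝓝 z, ∀ Y, fderiv ℝ U w Y = ((fderiv ℝ u w Y : ℝ) : ℂ) := by
    filter_upwards [hu.eventually_differentiableAt] with w hw Y
    have := (Complex.ofRealCLM.hasFDerivAt (x := u w)).comp w hw.hasFDerivAt
    rw [show U = Complex.ofRealCLM ∘ u from rfl, this.fderiv]
    rfl
  have hD : ∀ a, HasFDerivAt (fun w => ((fderiv ℝ u w a : ℝ) : ℂ))
      (Complex.ofRealCLM.comp ((ContinuousLinearMap.apply ℝ ℝ a).comp D)) z := fun a =>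
    (Complex.ofRealCLM.hasFDerivAt).comp z
      (((ContinuousLinearMap.apply ℝ ℝ a).hasFDerivAt).comp z
        hu.differentiableAt_fderiv.hasFDerivAt)
  have hG : ∀ a b, HasFDerivAt (fun w => (fderiv ℝ U w a + Complex.I * fderiv ℝ U w b) / 2)
      ((2 : ℂ)⁻¹ • (Complex.ofRealCLM.comp ((ContinuousLinearMap.apply ℝ ℝ a).comp D) +
        Complex.I • Complex.ofRealCLM.comp ((ContinuousLinearMap.apply ℝ ℝ b).comp D))) z := by
    intro a b
    refine (((hD a).add ((hD b).const_mul Complex.I)).const_mul (2 : ℂ)⁻¹).congr_of_eventuallyEq ?_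
    filter_upwards [hU] with w hw
    rw [hw a, hw b, div_eq_inv_mul]
    rfl
  set V : (Fin n → ℂ) → ℂ := fun w => ∑ β, conj (X β) * wirtingerDzbar β U w
  have hV : V = fun w => (fderiv ℝ U w X + Complex.I * fderiv ℝ U w (Complex.I • X)) / 2 :=
    funext fun w => sum_mul_wirtingerDzbar U w X
  have hβ : ∀ β, DifferentiableAt ℝ (wirtingerDzbar β U) z := fun β =>
    (hG (Pi.single β 1) (Pi.single β Complex.I)).differentiableAt
  have hVd : ∀ Y, fderiv ℝ V z Y = ∑ β, conj (X β) * fderiv ℝ (wirtingerDzbar β U) z Y := by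
    intro Y
    have : HasFDerivAt V (∑ β, conj (X β) • fderiv ℝ (wirtingerDzbar β U) z) z :=
      HasFDerivAt.fun_sum fun β _ => (hβ β).hasFDerivAt.const_mul _
    rw [this.fderiv]
    simp
  have hVY : ∀ Y, fderiv ℝ V z Y = ((D Y X : ℝ) + Complex.I * (D Y (Complex.I • X) : ℝ)) / 2 := by
    intro Y
    rw [hV, (hG X (Complex.I • X)).fderiv, div_eq_inv_mul]
    rfl
  have hsum : ∑ α, ∑ β, wirtingerDz α (wirtingerDzbar β U) z * X α * conj (X β) =
      (fderiv ℝ V z X - Complex.I * fderiv ℝ V z (Complex.I • X)) / 2 := by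
    rw [Finset.sum_comm, hVd, hVd, Finset.mul_sum, ← Finset.sum_sub_distrib, Finset.sum_div]
    refine Finset.sum_congr rfl fun β _ => ?_
    have := sum_mul_wirtingerDz (wirtingerDzbar β U) z X
    calc _ = conj (X β) * ∑ α, X α * wirtingerDz α (wirtingerDzbar β U) z := by
          rw [Finset.mul_sum]; refine Finset.sum_congr rfl fun α _ => by ring
      _ = _ := by rw [this]; ring
  have hsymm : D X (Complex.I • X) = D (Complex.I • X) X :=
    hu.isSymmSndFDerivAt (by simp) _ _
  rw [hsum, hVY, hVY, laplacian_comp_line hu, hsymm]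
  push_cast
  linear_combination (-(D (Complex.I • X) (Complex.I • X) : ℂ) / 4) * Complex.I_mul_I

/-- A negative second derivative along a line would make the minimum also a local maximum, so the
function would be locally constant there and its second derivative zero. -/
theorem fderiv_fderiv_nonneg_of_isLocalMin {E : Type*} [NormedAddCommGroup E] [NormedSpace ℝ E]
    {v : E → ℝ} {x : E} (hv : ContDiffAt ℝ 2 v x) (hmin : IsLocalMin v x) (a : E) :
    0 ≤ fderiv ℝ (fderiv ℝ v) x a a := by
  by_contra! hneg
  set g : ℝ → ℝ := fun t => v (x + t • a)
  have hline : ∀ t : ℝ, HasDerivAt (fun t : ℝ => x + t • a) a t := fun t => by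
    simpa using ((hasDerivAt_id t).smul_const a).const_add x
  have hcont : Tendsto (fun t : ℝ => x + t • a) (𝓝 0) (𝓝 x) := by
    simpa using (hline 0).continuousAt.tendsto
  have h1 : deriv g =ᶠ[𝓝 0] fun t => fderiv ℝ v (x + t • a) a := by
    filter_upwards [hcont.eventually hv.eventually_differentiableAt] with t ht
    exact (ht.hasFDerivAt.comp_hasDerivAt t (hline t)).deriv
  have h2 : deriv (deriv g) 0 = fderiv ℝ (fderiv ℝ v) x a a := by
    rw [h1.deriv_eq]
    have hd : HasFDerivAt (fun w => fderiv ℝ v w a)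
        ((ContinuousLinearMap.apply ℝ ℝ a).comp (fderiv ℝ (fderiv ℝ v) x)) (x + (0 : ℝ) • a) := by
      rw [zero_smul, add_zero]
      exact ((ContinuousLinearMap.apply ℝ ℝ a).hasFDerivAt).comp x
        hv.differentiableAt_fderiv.hasFDerivAt
    exact (hd.comp_hasDerivAt 0 (hline 0)).deriv
  have hgmin : IsLocalMin g 0 := by
    have := hcont.eventually hmin
    simpa [IsLocalMin, IsMinFilter, g] using this
  have hgc : ContinuousAt g 0 := by
    have : ContinuousAt v (x + (0 : ℝ) • a) := by simpa using hv.continuousAt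
    exact ContinuousAt.comp (g := v) this (hline 0).continuousAt
  have hmax := isLocalMax_of_deriv_deriv_neg (h2 ▸ hneg) hgmin.deriv_eq_zero hgc
  have hconst : g =ᶠ[𝓝 0] fun _ => g 0 := by
    filter_upwards [hgmin, hmax] with t h3 h4
    exact le_antisymm h4 h3
  have : deriv (deriv g) 0 = 0 := by
    rw [(hconst.deriv).deriv_eq]
    simp
  rw [← h2, this] at hneg
  exact lt_irrefl _ hneg

theorem laplacian_nonneg_of_isLocalMin {v : ℂ → ℝ} {x : ℂ} (hv : ContDiffAt ℝ 2 v x)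
    (hmin : IsLocalMin v x) : 0 ≤ Δ v x := by
  rw [laplacian_eq_iteratedFDeriv_complexPlane]
  simp only [iteratedFDeriv_two_apply]
  exact add_nonneg (fderiv_fderiv_nonneg_of_isLocalMin hv hmin _)
    (fderiv_fderiv_nonneg_of_isLocalMin hv hmin _)

theorem laplacian_norm_sq (s : ℂ) : Δ (fun s : ℂ => ‖s‖ ^ 2) s = 4 := by
  have h : fderiv ℝ (fun x : ℂ => ‖x‖ ^ 2) = ((2 : ℝ) • innerSL ℝ : ℂ →L[ℝ] ℂ →L[ℝ] ℝ) := by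
    rw [fderiv_norm_sq]
    ext x y
    simp
    ring
  rw [laplacian_eq_iteratedFDeriv_complexPlane]
  simp only [iteratedFDeriv_two_apply]
  rw [h, ContinuousLinearMap.fderiv]
  change 2 * inner ℝ (1 : ℂ) 1 + 2 * inner ℝ Complex.I Complex.I = (4 : ℝ)
  rw [real_inner_self_eq_norm_sq, real_inner_self_eq_norm_sq]
  norm_num

end LeviForm

/-! ### Bounds for the Bergman metric and a criterion for incompleteness. -/

section BergmanMetric

open Laplacian InnerProductSpace

variable {n : ℕ} {Ω : Set (Fin n → ℂ)}

theorem contDiffAt_log_bergmanKernel_self (hΩ : IsOpen Ω) (hvol : volume Ω ≠ ∞) {z : Fin n → ℂ}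
    (hz : z ∈ Ω) : ContDiffAt ℝ 2 (fun z => Real.log (bergmanKernel Ω z z).re) z :=
  (contDiffOn_log_bergmanKernel_self hΩ hvol).contDiffAt (hΩ.mem_nhds hz)

/-- The Bergman length of a vector is a Laplacian along a complex line. -/
theorem bergmanNorm_eq (hΩ : IsOpen Ω) (hvol : volume Ω ≠ ∞) {z : Fin n → ℂ}
    (hz : z ∈ Ω) (X : Fin n → ℂ) : bergmanNorm Ω z X =
      √(Δ (fun s : ℂ => Real.log (bergmanKernel Ω (z + s • X) (z + s • X)).re) 0 / 4) := by
  have h := sum_wirtinger_eq_laplacian (contDiffAt_log_bergmanKernel_self hΩ hvol hz) X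
  rw [bergmanNorm]
  simp only [bergmanMetricCoeff]
  rw [h, Complex.ofReal_re]

theorem bergmanNorm_eq_fderiv (hΩ : IsOpen Ω) (hvol : volume Ω ≠ ∞) {z : Fin n → ℂ}
    (hz : z ∈ Ω) (X : Fin n → ℂ) : bergmanNorm Ω z X =
      √((fderiv ℝ (fderiv ℝ (fun z => Real.log (bergmanKernel Ω z z).re)) z X X +
        fderiv ℝ (fderiv ℝ (fun z => Real.log (bergmanKernel Ω z z).re)) z
          (Complex.I • X) (Complex.I • X)) / 4) := by
  rw [bergmanNorm_eq hΩ hvol hz,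
    ← laplacian_comp_line (contDiffAt_log_bergmanKernel_self hΩ hvol hz)]

theorem bergmanNorm_smul (hΩ : IsOpen Ω) (hvol : volume Ω ≠ ∞) {z : Fin n → ℂ}
    (hz : z ∈ Ω) (c : ℝ) (X : Fin n → ℂ) : bergmanNorm Ω z (c • X) = |c| * bergmanNorm Ω z X := by
  rw [bergmanNorm_eq_fderiv hΩ hvol hz, bergmanNorm_eq_fderiv hΩ hvol hz, smul_comm Complex.I c,
    ← Real.sqrt_sq_eq_abs, ← Real.sqrt_mul (sq_nonneg c)]
  congr 1
  simp only [map_smul, smul_apply, smul_eq_mul]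
  ring

/-- The Bergman metric is bounded near each point of the domain. -/
theorem eventually_bergmanNorm_le (hΩ : IsOpen Ω) (hvol : volume Ω ≠ ∞) {p : Fin n → ℂ}
    (hp : p ∈ Ω) (X : Fin n → ℂ) : ∃ C, ∀ᶠ z in 𝓝 p, bergmanNorm Ω z X ≤ C := by
  have hu := contDiffAt_log_bergmanKernel_self hΩ hvol hp
  have h2 : ContinuousAt
      (fderiv ℝ (fderiv ℝ (fun z => Real.log (bergmanKernel Ω z z).re))) p :=
    ((hu.fderiv_right (m := 1) (by norm_num)).fderiv_right (m := 0) (by norm_num)).continuousAt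
  have h3 : ContinuousAt (fun z =>
      √((fderiv ℝ (fderiv ℝ (fun z => Real.log (bergmanKernel Ω z z).re)) z X X +
        fderiv ℝ (fderiv ℝ (fun z => Real.log (bergmanKernel Ω z z).re)) z
          (Complex.I • X) (Complex.I • X)) / 4)) p := by
    have hY : ∀ Y, ContinuousAt (fun z =>
        fderiv ℝ (fderiv ℝ (fun z => Real.log (bergmanKernel Ω z z).re)) z Y Y) p := fun Y =>
      (h2.clm_apply continuousAt_const).clm_apply continuousAt_const
    exact (((hY X).add (hY (Complex.I • X))).div_const 4).sqrt
  have h4 := h3.eventually_le_const (lt_add_one _)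
  exact ⟨_, (h4.and (hΩ.mem_nhds hp)).mono fun z hz =>
    (bergmanNorm_eq_fderiv hΩ hvol hz.2 X).trans_le hz.1⟩

/-- A lower bound for the Bergman metric. -/
theorem le_bergmanNorm (hΩ : IsOpen Ω) (hvol : volume Ω ≠ ∞) {z : Fin n → ℂ}
    (hz : z ∈ Ω) (X : Fin n → ℂ) (j : Fin n) {R : ℝ} (hR : 0 < R)
    (hj : ∀ x ∈ Ω, ‖x j - z j‖ ≤ R) : ‖X j‖ / (2 * R) ≤ bergmanNorm Ω z X := by
  set c := ‖X j‖ / R with hc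
  have hc0 : 0 ≤ c := by positivity
  have hline : Continuous (fun s : ℂ => z + s • X) := by fun_prop
  have hK : 0 < (bergmanKernel Ω z z).re := bergmanKernel_self_pos hΩ hvol hz
  set g : ℂ → ℝ := fun s => Real.log (bergmanKernel Ω (z + s • X) (z + s • X)).re
  set φ : ℂ → ℂ := fun s => bergmanKernel Ω (z + s • X) z
  have hg : ContDiffAt ℝ 2 g 0 := by
    have h1 : ContDiffAt ℝ 2 (fun z => Real.log (bergmanKernel Ω z z).re) (z + (0 : ℂ) • X) := by
      simpa using contDiffAt_log_bergmanKernel_self hΩ hvol hz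
    exact h1.comp (0 : ℂ) (f := fun s : ℂ => z + s • X) (by fun_prop)
  have hmem : ∀ᶠ s : ℂ in 𝓝 0, z + s • X ∈ Ω :=
    hline.continuousAt.eventually (hΩ.mem_nhds (by simpa using hz))
  have hφd : ∀ᶠ s in 𝓝 (0 : ℂ), DifferentiableAt ℂ φ s := by
    filter_upwards [hmem] with s hs
    exact ((differentiableOn_bergmanKernel_left hΩ hz).differentiableAt
      (hΩ.mem_nhds hs)).comp s (f := fun s : ℂ => z + s • X) (by fun_prop)
  have hφ0 : φ 0 = ((bergmanKernel Ω z z).re : ℂ) := by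
    simp only [φ, zero_smul, add_zero]
    exact bergmanKernel_self_eq_ofReal hΩ hz
  have hφne : φ 0 ≠ 0 := by rw [hφ0]; exact_mod_cast hK.ne'
  have hφn : ∀ᶠ s in 𝓝 (0 : ℂ), φ s ≠ 0 :=
    hφd.self_of_nhds.continuousAt.eventually_ne hφne
  have hharm := (Complex.analyticAt_iff_eventually_differentiableAt.2 hφd).harmonicAt_log_norm hφne
  have hsmall : ∀ᶠ s in 𝓝 (0 : ℂ), (c * ‖s‖) ^ 2 < 1 := by
    have : ContinuousAt (fun s : ℂ => (c * ‖s‖) ^ 2) 0 := by fun_prop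
    exact this.eventually_lt_const (by simp)
  -- `2 log |K(·, z)|` is harmonic along the line near `0`, so subtracting it from `log K` on the
  -- diagonal leaves the Laplacian unchanged; what remains is, up to a constant, the diastasis. It
  -- dominates `c²|s|²/2`, so `v` has a local minimum at `0`.
  set v : ℂ → ℝ := (g - (2 : ℝ) • (fun s => Real.log ‖φ s‖)) - (c ^ 2 / 2) • (fun s : ℂ => ‖s‖ ^ 2)
  have hn : ContDiffAt ℝ 2 (fun s : ℂ => ‖s‖ ^ 2) 0 := (contDiff_norm_sq ℝ).contDiffAt
  have hn' : ContDiffAt ℝ 2 ((c ^ 2 / 2) • (fun s : ℂ => ‖s‖ ^ 2)) 0 := hn.const_smul (c ^ 2 / 2)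
  have hh' : ContDiffAt ℝ 2 ((2 : ℝ) • (fun s => Real.log ‖φ s‖)) 0 := hharm.1.const_smul (2 : ℝ)
  have hv1 : ContDiffAt ℝ 2 (g - (2 : ℝ) • (fun s => Real.log ‖φ s‖)) 0 :=
    hg.sub hh'
  have hv : ContDiffAt ℝ 2 v 0 := hv1.sub hn'
  have hv0 : v 0 = - Real.log (bergmanKernel Ω z z).re := by
    simp only [v, g, Pi.sub_apply, Pi.smul_apply, hφ0, zero_smul, add_zero, norm_zero,
      Complex.norm_real, Real.norm_of_nonneg hK.le, smul_eq_mul]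
    ring
  have hmin : IsLocalMin v 0 := by
    filter_upwards [hmem, hφn, hsmall] with s h1 h2 h3
    have h4 := sq_norm_bergmanKernel_mul_le hΩ hz h1 j hR hj
    have h5 : ‖(z + s • X) j - z j‖ / R = c * ‖s‖ := by
      simp only [Pi.add_apply, Pi.smul_apply, add_sub_cancel_left, norm_smul, hc]; ring
    rw [h5] at h4
    have hKs := bergmanKernel_self_pos hΩ hvol h1
    have hφpos : 0 < ‖φ s‖ := norm_pos_iff.2 h2
    have h6 := Real.log_le_log (by positivity) h4
    rw [Real.log_mul (by positivity) (by positivity), Real.log_mul hKs.ne' hK.ne',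
      Real.log_pow] at h6
    -- `log (1 + y) ≥ y / (1 + y) ≥ y / 2` for `0 ≤ y < 1`, with `y = (c|s|)²`.
    have h7 := Real.one_sub_inv_le_log_of_pos (x := 1 + (c * ‖s‖) ^ 2) (by positivity)
    have h8 : (c * ‖s‖) ^ 2 / 2 ≤ 1 - (1 + (c * ‖s‖) ^ 2)⁻¹ := by
      have h9 : 0 ≤ (c * ‖s‖) ^ 2 := by positivity
      set y := (c * ‖s‖) ^ 2
      have : 1 - (1 + y)⁻¹ = y / (1 + y) := by field_simp; ring
      rw [this]
      exact div_le_div_of_nonneg_left h9 (by positivity) (by linarith)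
    rw [hv0]
    simp only [v, g, Pi.sub_apply, Pi.smul_apply, smul_eq_mul]
    have h10 : c ^ 2 / 2 * ‖s‖ ^ 2 = (c * ‖s‖) ^ 2 / 2 := by ring
    rw [h10]
    push_cast at h6
    linarith
  have hΔ := laplacian_nonneg_of_isLocalMin hv hmin
  have e1 : Δ v 0 = Δ g 0 - 2 * c ^ 2 := by
    simp only [v]
    rw [ContDiffAt.laplacian_sub hv1 hn',
      ContDiffAt.laplacian_sub hg hh',
      laplacian_smul _ hharm.1, laplacian_smul _ hn, hharm.2.self_of_nhds, laplacian_norm_sq]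
    simp only [Pi.zero_apply, smul_eq_mul]; ring
  rw [bergmanNorm_eq hΩ hvol hz]
  refine Real.le_sqrt_of_sq_le ?_
  -- The minimum gives `Δ g ≥ 2c²`; the weaker `Δ g ≥ c²` is all that is needed.
  have e2 : (‖X j‖ / (2 * R)) ^ 2 = c ^ 2 / 4 := by rw [hc]; ring
  rw [e2]
  change c ^ 2 / 4 ≤ Δ g 0 / 4
  nlinarith [sq_nonneg c]

/-- The Bergman distance dominates a multiple of the sup norm distance. -/
theorem enorm_sub_le_mul_bergmanDist (hΩ : IsOpen Ω) (hb : Bornology.IsBounded Ω) :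
    ∃ R : ℝ, 0 < R ∧ ∀ p q, ‖q - p‖ₑ ≤ ENNReal.ofReal R * bergmanDist Ω p q := by
  obtain ⟨D, hD⟩ := Metric.isBounded_iff.1 hb
  have hvol : volume Ω ≠ ∞ := hb.measure_lt_top.ne
  set R := max D 1
  have hR : 0 < R := lt_max_of_lt_right one_pos
  refine ⟨2 * R, by positivity, fun p q => ?_⟩
  have h0 : ENNReal.ofReal (2 * R) ≠ 0 := by simpa using hR
  rw [mul_comm, ← ENNReal.div_le_iff_le_mul (Or.inl h0) (Or.inl ENNReal.ofReal_ne_top)]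
  -- For each competing curve the sup norm of the velocity is at most `2R` times its Bergman norm,
  -- coordinate by coordinate, where `R` bounds the diameter of `Ω`.
  refine le_iInf₂ fun γ hγ => ?_
  obtain ⟨hγ1, hγ2, rfl, rfl⟩ := hγ
  rw [ENNReal.div_le_iff_le_mul (Or.inl h0) (Or.inl ENNReal.ofReal_ne_top), mul_comm,
    bergmanLength, ← lintegral_const_mul' _ _ ENNReal.ofReal_ne_top]
  refine (enorm_sub_le_lintegral_derivWithin_Icc_of_contDiffOn_Icc hγ1 zero_le_one).trans ?_
  refine setLIntegral_mono' measurableSet_Icc fun t ht => ?_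
  rw [← ENNReal.ofReal_mul (by positivity), ← ofReal_norm]
  refine ENNReal.ofReal_le_ofReal ?_
  set X := derivWithin γ (Set.Icc 0 1) t
  rw [← div_le_iff₀' (by positivity)]
  rw [div_le_iff₀' (by positivity)]
  refine (pi_norm_le_iff_of_nonneg (mul_nonneg (by positivity) (Real.sqrt_nonneg _))).2 fun j => ?_
  rw [← div_le_iff₀' (by positivity)]
  refine le_bergmanNorm hΩ hvol (hγ2 ht) X j hR fun x hx => ?_
  refine (norm_le_pi_norm (x - γ t) j).trans ?_
  rw [← dist_eq_norm]
  exact (hD hx (hγ2 ht)).trans (le_max_left _ _)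

/-- An interior puncture at finite Bergman distance prevents completeness. -/
theorem not_bergmanComplete_of_segment (hΩ : IsOpen Ω) (hb : Bornology.IsBounded Ω)
    {p e : Fin n → ℂ} (hp : p ∉ Ω) {δ C : ℝ} (hδ : 0 < δ)
    (hmem : ∀ s : ℝ, 0 < s → s ≤ δ → p + s • e ∈ Ω)
    (hC : ∀ s : ℝ, 0 < s → s ≤ δ → bergmanNorm Ω (p + s • e) e ≤ C) :
    ¬ BergmanComplete Ω := by
  intro hcomp
  have hvol : volume Ω ≠ ∞ := hb.measure_lt_top.ne
  set s : ℕ → ℝ := fun k => δ / (k + 1)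
  have hs0 : ∀ k, 0 < s k := fun k => by positivity
  have hsδ : ∀ k, s k ≤ δ := fun k => div_le_self hδ.le (by linarith [k.cast_nonneg (α := ℝ)])
  have hslim : Tendsto s atTop (𝓝 0) := tendsto_const_div_atTop_nhds_zero_nat δ |>.comp
    (tendsto_add_atTop_nat 1) |>.congr fun k => by simp [s]
  have hC0 : 0 ≤ C := (Real.sqrt_nonneg _).trans (hC δ hδ le_rfl)
  have hdist : ∀ j k, bergmanDist Ω (p + s j • e) (p + s k • e) ≤
      ENNReal.ofReal (|s k - s j| * C) := by
    intro j k
    -- The straight piece of the segment between two points of the sequence, whose length is at most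
    -- `|s k - s j| C`.
    set γ : ℝ → (Fin n → ℂ) := fun t => p + (s j + t * (s k - s j)) • e
    have hpar : ∀ t ∈ Set.Icc (0 : ℝ) 1, 0 < s j + t * (s k - s j) ∧
        s j + t * (s k - s j) ≤ δ := by
      rintro t ⟨ht0, ht1⟩
      have e1 : s j + t * (s k - s j) = (1 - t) * s j + t * s k := by ring
      rw [e1]
      constructor
      · rcases ht0.eq_or_lt with rfl | ht0
        · simpa using hs0 j
        · nlinarith [mul_nonneg (sub_nonneg.2 ht1) (hs0 j).le, mul_pos ht0 (hs0 k)]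
      · nlinarith [mul_le_mul_of_nonneg_left (hsδ j) (sub_nonneg.2 ht1),
          mul_le_mul_of_nonneg_left (hsδ k) ht0]
    have hγmem : ∀ t ∈ Set.Icc (0 : ℝ) 1, γ t ∈ Ω := fun t ht =>
      hmem _ (hpar t ht).1 (hpar t ht).2
    have hγd : ∀ t, HasDerivAt γ ((s k - s j) • e) t := by
      intro t
      have h1 : HasDerivAt (fun t : ℝ => s j + t * (s k - s j)) (s k - s j) t := by
        simpa using ((hasDerivAt_id t).mul_const (s k - s j)).const_add (s j)
      exact (h1.smul_const e).const_add p
    have hγc : ContDiff ℝ 1 γ := by fun_prop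
    refine (iInf₂_le γ ⟨hγc.contDiffOn, hγmem, by simp [γ], by simp [γ]⟩).trans ?_
    rw [bergmanLength]
    calc _ ≤ ∫⁻ _ in Set.Icc (0 : ℝ) 1, ENNReal.ofReal (|s k - s j| * C) := by
          refine setLIntegral_mono' measurableSet_Icc fun t ht => ENNReal.ofReal_le_ofReal ?_
          rw [(hγd t).hasDerivWithinAt.derivWithin (uniqueDiffOn_Icc zero_lt_one t ht),
            bergmanNorm_smul hΩ hvol (hγmem t ht)]
          exact mul_le_mul_of_nonneg_left (hC _ (hpar t ht).1 (hpar t ht).2) (abs_nonneg _)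
      _ = _ := by simp
  obtain ⟨q, hq, hlim⟩ := hcomp (fun k => p + s k • e) (fun k => hmem _ (hs0 k) (hsδ k)) (by
    intro ε hε
    have h1 : Tendsto (fun jk : ℕ × ℕ => ENNReal.ofReal (|s jk.2 - s jk.1| * C)) atTop (𝓝 0) := by
      have h2 : Tendsto (fun jk : ℕ × ℕ => |s jk.2 - s jk.1| * C) atTop (𝓝 0) := by
        rw [← prod_atTop_atTop_eq]
        have := ((hslim.comp tendsto_snd).sub (hslim.comp tendsto_fst)).abs.mul_const C
        simpa using this
      simpa using ENNReal.tendsto_ofReal h2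
    obtain ⟨⟨N₁, N₂⟩, hN⟩ := eventually_atTop.1 (h1.eventually_lt_const hε)
    refine ⟨max N₁ N₂, fun j hj k hk => (hdist j k).trans_lt (hN (j, k) ⟨?_, ?_⟩)⟩
    · exact (le_max_left _ _).trans hj
    · exact (le_max_right _ _).trans hk)
  -- A Bergman limit `q` is also a Euclidean limit, and the Euclidean limit of the sequence is `p`,
  -- which lies outside `Ω`.
  obtain ⟨R, hR, hlow⟩ := enorm_sub_le_mul_bergmanDist hΩ hb
  have h1 : Tendsto (fun k => ENNReal.ofReal R * bergmanDist Ω (p + s k • e) q) atTop (𝓝 0) := by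
    have := ENNReal.Tendsto.const_mul hlim (Or.inr ENNReal.ofReal_ne_top) (a := ENNReal.ofReal R)
    simpa using this
  have h2 : Tendsto (fun k => ‖q - (p + s k • e)‖ₑ) atTop (𝓝 ‖q - p‖ₑ) := by
    have : Tendsto (fun k => q - (p + s k • e)) atTop (𝓝 (q - (p + (0 : ℝ) • e))) :=
      ((hslim.smul_const e).const_add p).const_sub q
    rw [zero_smul, add_zero] at this
    exact this.enorm
  have h3 : ‖q - p‖ₑ ≤ 0 := le_of_tendsto_of_tendsto' h2 h1 fun k => hlow _ _
  have h4 : q = p := by simpa [sub_eq_zero] using h3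
  exact hp (h4 ▸ hq)

end BergmanMetric

/-! ### Laurent series from Fourier series on circles. -/

section Laurent

open Metric

theorem circleMap_zero_eq_mul (ρ θ : ℝ) : circleMap 0 ρ θ = ρ * circleMap 0 1 θ := by
  simp [circleMap]

/-- Laurent expansion on a round annulus. -/
theorem exists_laurent_expansion {f : ℂ → ℂ} {r R : ℝ} (hr : 0 ≤ r)
    (hf : DifferentiableOn ℂ f {w | r < ‖w‖ ∧ ‖w‖ < R}) :
    ∃ c : ℤ → ℂ, (∀ ρ, r < ρ → ρ < R → ∀ n : ℤ,
      ∫ θ in (0 : ℝ)..2 * Real.pi, f (circleMap 0 ρ θ) * circleMap 0 1 θ ^ (-n) =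
        2 * Real.pi * (c n * (ρ : ℂ) ^ n)) ∧
      ∀ z, r < ‖z‖ → ‖z‖ < R → HasSum (fun n : ℤ => c n * z ^ n) (f z) := by
  set A : Set ℂ := {w | r < ‖w‖ ∧ ‖w‖ < R}
  have hAo : IsOpen A := (isOpen_lt continuous_const continuous_norm).inter
    (isOpen_lt continuous_norm continuous_const)
  have hcm : ∀ ρ, r < ρ → ρ < R → ∀ θ, circleMap 0 ρ θ ∈ A := by
    intro ρ h1 h2 θ
    have : ‖circleMap 0 ρ θ‖ = ρ := by simp [abs_of_pos (hr.trans_lt h1)]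
    exact ⟨by rwa [this], by rwa [this]⟩
  -- the coefficient functional on a circle of radius `ρ`
  set J : ℝ → ℤ → ℂ := fun ρ n => ∮ w in C(0, ρ), f w * w ^ (-n - 1)
  have hJ : ∀ ρ, r < ρ → ∀ n, J ρ n = Complex.I * (ρ : ℂ) ^ (-n) *
      ∫ θ in (0 : ℝ)..2 * Real.pi, f (circleMap 0 ρ θ) * circleMap 0 1 θ ^ (-n) := by
    intro ρ h1 n
    have hρ : (ρ : ℂ) ≠ 0 := by exact_mod_cast (hr.trans_lt h1).ne'
    rw [← intervalIntegral.integral_const_mul]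
    simp only [J, circleIntegral, deriv_circleMap, smul_eq_mul]
    refine intervalIntegral.integral_congr fun θ _ => ?_
    have hne : circleMap 0 ρ θ ≠ 0 := by
      rw [circleMap_zero_eq_mul]; simp [hρ, circleMap_zero_one]
    rw [zpow_sub_one₀ hne, show circleMap 0 ρ θ * Complex.I * (f (circleMap 0 ρ θ) *
      (circleMap 0 ρ θ ^ (-n) * (circleMap 0 ρ θ)⁻¹)) = Complex.I * f (circleMap 0 ρ θ) *
      circleMap 0 ρ θ ^ (-n) by field_simp]
    conv_lhs => rw [circleMap_zero_eq_mul ρ θ, mul_zpow]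
    rw [← circleMap_zero_eq_mul ρ θ]
    ring
  -- Cauchy's theorem on the annulus between two circles: the coefficients do not depend on the
  -- radius.
  have hJeq : ∀ ρ₁ ρ₂, r < ρ₁ → ρ₁ ≤ ρ₂ → ρ₂ < R → ∀ n, J ρ₂ n = J ρ₁ n := by
    intro ρ₁ ρ₂ h1 h2 h3 n
    have hd : ∀ w : ℂ, w ∈ A → DifferentiableAt ℂ (fun w => f w * w ^ (-n - 1)) w := by
      intro w hw
      have hw0 : w ≠ 0 := norm_pos_iff.1 (hr.trans_lt hw.1)
      exact (hf.differentiableAt (hAo.mem_nhds hw)).mul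
        (differentiableAt_zpow.2 (Or.inl hw0))
    refine Complex.circleIntegral_eq_of_differentiable_on_annulus_off_countable
      (hr.trans_lt h1) h2 Set.countable_empty (fun w hw => ?_) (fun w hw => ?_)
    · refine (hd w ⟨?_, ?_⟩).continuousAt.continuousWithinAt
      · have : ρ₁ ≤ ‖w‖ := by simpa using hw.2
        exact h1.trans_le this
      · have : ‖w‖ ≤ ρ₂ := by simpa using hw.1
        exact this.trans_lt h3
    · refine hd w ⟨?_, ?_⟩
      · have : ρ₁ < ‖w‖ := by simpa using hw.1.2
        exact h1.trans this
      · have : ‖w‖ < ρ₂ := by simpa using hw.1.1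
        exact this.trans h3
  have hJc : ∀ ρ₁ ρ₂, r < ρ₁ → ρ₁ < R → r < ρ₂ → ρ₂ < R → ∀ n, J ρ₂ n = J ρ₁ n := by
    intro ρ₁ ρ₂ h1 h2 h3 h4 n
    rcases le_total ρ₁ ρ₂ with h | h
    · exact hJeq _ _ h1 h h4 n
    · exact (hJeq _ _ h3 h h2 n).symm
  by_cases hrR : r < R
  swap
  · exact ⟨0, fun ρ h1 h2 => absurd (h1.trans h2) hrR, fun z h1 h2 => absurd (h1.trans h2) hrR⟩
  obtain ⟨ρ₀, h₀, h₀'⟩ := exists_between hrR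
  set c : ℤ → ℂ := fun n => (2 * Real.pi * Complex.I)⁻¹ * J ρ₀ n
  have hpi : (Real.pi : ℂ) ≠ 0 := by exact_mod_cast Real.pi_ne_zero
  have hcoef : ∀ ρ, r < ρ → ρ < R → ∀ n : ℤ,
      ∫ θ in (0 : ℝ)..2 * Real.pi, f (circleMap 0 ρ θ) * circleMap 0 1 θ ^ (-n) =
        2 * Real.pi * (c n * (ρ : ℂ) ^ n) := by
    intro ρ h1 h2 n
    have hρ : (ρ : ℂ) ≠ 0 := by exact_mod_cast (hr.trans_lt h1).ne'
    simp only [c]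
    rw [← hJc ρ₀ ρ h₀ h₀' h1 h2 n, hJ ρ h1 n, zpow_neg]
    have hρn : (ρ : ℂ) ^ n ≠ 0 := zpow_ne_zero _ hρ
    have hI := Complex.I_ne_zero
    field_simp
  have hbound : ∀ ρ, r < ρ → ρ < R → ∃ M, ∀ n : ℤ, ‖c n‖ * ρ ^ n ≤ M := by
    intro ρ h1 h2
    have hρ : 0 < ρ := hr.trans_lt h1
    have hcont : Continuous fun θ : ℝ => f (circleMap 0 ρ θ) :=
      hf.continuousOn.comp_continuous (continuous_circleMap 0 ρ) (hcm ρ h1 h2)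
    obtain ⟨M, hM⟩ := isCompact_Icc.exists_bound_of_continuousOn
      (s := Set.Icc 0 (2 * Real.pi)) hcont.continuousOn
    refine ⟨M, fun n => ?_⟩
    have h3 := intervalIntegral.norm_integral_le_of_norm_le_const (a := 0) (b := 2 * Real.pi)
      (C := M) (f := fun θ => f (circleMap 0 ρ θ) * circleMap 0 1 θ ^ (-n)) (fun θ hθ => by
        rw [Set.uIoc_of_le Real.two_pi_pos.le] at hθ
        rw [norm_mul, norm_zpow, circleMap_zero_one, Circle.norm_coe, one_zpow, mul_one]
        exact hM θ ⟨hθ.1.le, hθ.2⟩)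
    rw [hcoef ρ h1 h2 n, sub_zero, abs_of_pos Real.two_pi_pos, norm_mul, norm_mul, norm_mul,
      norm_zpow, Complex.norm_real, Complex.norm_real, Real.norm_of_nonneg hρ.le,
      Real.norm_of_nonneg Real.pi_pos.le, Complex.norm_ofNat] at h3
    have := Real.two_pi_pos
    rw [mul_comm M] at h3
    exact le_of_mul_le_mul_left h3 this
  refine ⟨c, hcoef, fun z hz1 hz2 => ?_⟩
  set ρ := ‖z‖
  have hρ : 0 < ρ := hr.trans_lt hz1
  -- Coefficient bounds on a larger circle control the nonnegative powers, those on a smaller circle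
  -- the nonpositive ones, each by a geometric series.
  have hsum : Summable (fun n : ℤ => c n * (ρ : ℂ) ^ n) := by
    obtain ⟨ρ₁, h1, h1'⟩ := exists_between hz1
    obtain ⟨ρ₂, h2, h2'⟩ := exists_between hz2
    have hρ₁ : 0 < ρ₁ := hr.trans_lt h1
    have hρ₂ : 0 < ρ₂ := hρ.trans h2
    obtain ⟨M₁, hM₁⟩ := hbound ρ₁ h1 (h1'.trans hz2)
    obtain ⟨M₂, hM₂⟩ := hbound ρ₂ (hz1.trans h2) h2'
    refine Summable.of_nat_of_neg ?_ ?_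
    · refine Summable.of_norm_bounded (g := fun n : ℕ => M₂ * (ρ / ρ₂) ^ n)
        ((summable_geometric_of_lt_one (by positivity) ((div_lt_one hρ₂).2 h2)).mul_left _)
        fun n => ?_
      have := hM₂ n
      rw [norm_mul, norm_zpow, Complex.norm_real, Real.norm_of_nonneg hρ.le, zpow_natCast, div_pow]
      rw [zpow_natCast] at this
      calc ‖c n‖ * ρ ^ n = (‖c n‖ * ρ₂ ^ n) * (ρ ^ n / ρ₂ ^ n) := by field_simp
        _ ≤ _ := by gcongr
    · refine Summable.of_norm_bounded (g := fun n : ℕ => M₁ * (ρ₁ / ρ) ^ n)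
        ((summable_geometric_of_lt_one (by positivity) ((div_lt_one hρ).2 h1')).mul_left _)
        fun n => ?_
      have := hM₁ (-n)
      rw [norm_mul, norm_zpow, Complex.norm_real, Real.norm_of_nonneg hρ.le, zpow_neg,
        zpow_natCast, div_pow]
      rw [zpow_neg, zpow_natCast] at this
      calc ‖c (-n)‖ * (ρ ^ n)⁻¹ = (‖c (-n)‖ * (ρ₁ ^ n)⁻¹) * (ρ₁ ^ n / ρ ^ n) := by field_simp
        _ ≤ _ := by gcongr
  have : Fact (0 < 2 * Real.pi) := ⟨Real.two_pi_pos⟩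
  have htc : ∀ x : AddCircle (2 * Real.pi), (ρ : ℂ) * (AddCircle.toCircle x : ℂ) ∈ A := by
    intro x
    have : ‖(ρ : ℂ) * (AddCircle.toCircle x : ℂ)‖ = ρ := by
      rw [norm_mul, Circle.norm_coe, Complex.norm_real, Real.norm_of_nonneg hρ.le, mul_one]
    exact ⟨by rwa [this], by rwa [this]⟩
  -- The restriction of `f` to the circle through `z`. Its Fourier coefficients `c n ρⁿ` are
  -- summable, so its Fourier series converges to it pointwise.
  let g : C(AddCircle (2 * Real.pi), ℂ) :=
    ⟨fun x => f (ρ * (AddCircle.toCircle x : ℂ)), hf.continuousOn.comp_continuous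
      (continuous_const.mul (continuous_subtype_val.comp AddCircle.continuous_toCircle)) htc⟩
  have htoc : ∀ θ : ℝ, ((AddCircle.toCircle (θ : AddCircle (2 * Real.pi)) : Circle) : ℂ) =
      circleMap 0 1 θ := by
    intro θ
    rw [AddCircle.toCircle_apply_mk, circleMap_zero_one]
    congr 2
    field_simp
  have hfour : ∀ n : ℤ, ∀ θ : ℝ, fourier n (θ : AddCircle (2 * Real.pi)) =
      circleMap 0 1 θ ^ n := by
    intro n θ
    rw [fourier_apply, AddCircle.toCircle_zsmul, Circle.coe_zpow, htoc]
  have hgc : ∀ n, fourierCoeff g n = c n * (ρ : ℂ) ^ n := by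
    intro n
    rw [fourierCoeff_eq_intervalIntegral g n 0, zero_add]
    have : ∫ x in (0 : ℝ)..2 * Real.pi, fourier (-n) (x : AddCircle (2 * Real.pi)) • g x =
        ∫ θ in (0 : ℝ)..2 * Real.pi, f (circleMap 0 ρ θ) * circleMap 0 1 θ ^ (-n) := by
      refine intervalIntegral.integral_congr fun θ _ => ?_
      simp only [hfour, smul_eq_mul, g, ContinuousMap.coe_mk, htoc, ← circleMap_zero_eq_mul]
      ring
    rw [this, hcoef ρ hz1 hz2 n, Complex.real_smul]
    push_cast
    field_simp
  have h := has_pointwise_sum_fourier_series_of_summable (f := g)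
    (by rw [show fourierCoeff g = fun n => c n * (ρ : ℂ) ^ n from funext hgc]; exact hsum)
    (Complex.arg z : AddCircle (2 * Real.pi))
  have hz : (ρ : ℂ) * circleMap 0 1 (Complex.arg z) = z := by
    simp [circleMap, ρ, Complex.norm_mul_exp_arg_mul_I]
  have hgz : g (Complex.arg z : AddCircle (2 * Real.pi)) = f z := by
    simp only [g, ContinuousMap.coe_mk, htoc, hz]
  rw [hgz] at h
  convert h using 2 with n
  rw [hgc, hfour, smul_eq_mul]
  conv_lhs => rw [← hz, mul_zpow]
  ring

theorem circleAverage_comp_mul (G : ℂ → ℂ) (w : ℂ) :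
    Real.circleAverage (fun s => G (s * w)) 0 1 = Real.circleAverage G 0 ‖w‖ := by
  rw [Real.circleAverage_eq_integral_add (f := G) w.arg, Real.circleAverage_def]
  congr 1
  refine intervalIntegral.integral_congr fun θ _ => ?_
  have : circleMap 0 ‖w‖ (θ + w.arg) = circleMap 0 1 θ * w := by
    conv_rhs => rw [← Complex.norm_mul_exp_arg_mul_I w]
    simp only [circleMap, zero_add]
    push_cast
    rw [add_mul, Complex.exp_add]
    ring
  simp only [this]

end Laurent

/-! ### Laurent expansion of the annulus kernel and the moments of monomials. -/

section AnnulusKernel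

variable {r : ℝ}

theorem isOpen_annulus (r : ℝ) : IsOpen (annulus r) :=
  (isOpen_lt continuous_const (continuous_apply 0).norm).inter
    (isOpen_lt (continuous_apply 0).norm continuous_const)

theorem isBounded_annulus (r : ℝ) : Bornology.IsBounded (annulus r) := by
  refine (Metric.isBounded_ball (x := (0 : Fin 1 → ℂ)) (r := 1)).subset fun z hz => ?_
  rw [mem_ball_zero_iff, pi_norm_lt_iff one_pos]
  intro i
  rw [Subsingleton.elim i 0]
  exact hz.2

theorem volume_annulus_ne_top (r : ℝ) : volume (annulus r) ≠ ∞ :=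
  (isBounded_annulus r).measure_lt_top.ne

theorem zpow_le_one_add_zpow (hr : 0 < r) {x : ℝ} (h1 : r ≤ x) (h2 : x ≤ 1) (n : ℤ) :
    x ^ n ≤ 1 + r ^ n := by
  have hx : 0 < x := hr.trans_le h1
  have hrn : 0 < r ^ n := zpow_pos hr n
  rcases le_total 0 n with hn | hn
  · have := zpow_le_one₀ hx h2 hn
    linarith
  · have : x ^ n ≤ r ^ n := by
      obtain ⟨m, rfl⟩ := Int.exists_eq_neg_ofNat hn
      rw [zpow_neg, zpow_neg, zpow_natCast, zpow_natCast]
      gcongr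
    linarith

/-- The squared norm of the monomial `zⁿ` on the annulus. -/
noncomputable def annulusMoment (r : ℝ) (n : ℤ) : ℝ := ∫ z in annulus r, ‖z 0‖ ^ (2 * n)

theorem memBergmanSpace_annulus_zpow (hr : 0 < r) (n : ℤ) :
    MemBergmanSpace (annulus r) (fun z => z 0 ^ n) := by
  refine MemBergmanSpace.of_bounded (isOpen_annulus r) (volume_annulus_ne_top r) (fun z hz => ?_)
    (C := 1 + r ^ n) fun z hz => ?_
  · have hz0 : z 0 ≠ 0 := norm_pos_iff.1 (hr.trans hz.1)
    have h1 : DifferentiableAt ℂ (fun z : Fin 1 → ℂ => z 0) z := by fun_prop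
    exact ((differentiableAt_zpow.2 (Or.inl hz0)).comp z h1).differentiableWithinAt
  · rw [norm_zpow]
    exact zpow_le_one_add_zpow hr hz.1.le hz.2.le n

/-- The Laurent expansion of the Bergman kernel of the annulus. -/
theorem hasSum_bergmanKernel_annulus (hr : 0 < r) {z t : Fin 1 → ℂ} (hz : z ∈ annulus r)
    (ht : t ∈ annulus r) :
    HasSum (fun n : ℤ => (z 0 * conj (t 0)) ^ n / annulusMoment r n)
      (bergmanKernel (annulus r) z t) := by
  have hΩ := isOpen_annulus r
  have hk := isBergmanKernel_bergmanKernel hΩ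
  have heta : ∀ w : Fin 1 → ℂ, (fun _ => w 0) = w := fun w => by
    funext i; rw [Subsingleton.elim i 0]
  set F : ℂ → ℂ := fun w => bergmanKernel (annulus r) (fun _ => w) t
  have hFd : DifferentiableOn ℂ F {w | r < ‖w‖ ∧ ‖w‖ < 1} :=
    (differentiableOn_bergmanKernel_left hΩ ht).comp (t := annulus r)
      (f := fun (w : ℂ) (_ : Fin 1) => w) (by fun_prop) fun w hw => hw
  have hFz : ∀ w : Fin 1 → ℂ, bergmanKernel (annulus r) w t = F (w 0) := fun w => by
    simp only [F, heta]
  obtain ⟨c, hc1, hc2⟩ := exists_laurent_expansion hr.le hFd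
  have hcn : ∀ n : ℤ, c n = conj (t 0) ^ n / annulusMoment r n := by
    intro n
    have hp := memBergmanSpace_annulus_zpow hr n
    have hkt := hk.mem t ht
    have h1 : conj (t 0) ^ n =
        ∫ w in annulus r, bergmanKernel (annulus r) w t * conj (w 0 ^ n) := by
      have := congrArg conj (hk.reproducing t ht _ hp)
      rw [← integral_conj, map_zpow₀] at this
      rw [this]
      refine integral_congr_ae (Eventually.of_forall fun w => ?_)
      simp [mul_comm]
    have hint : IntegrableOn (fun w => bergmanKernel (annulus r) w t * conj (w 0 ^ n))
        (annulus r) := hkt.memLp.integrable_mul (hp.memLp.star)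
    have hcont : ContinuousOn (fun w => bergmanKernel (annulus r) w t * conj (w 0 ^ n))
        (annulus r) :=
      hkt.differentiableOn.continuousOn.mul
        (Complex.continuous_conj.comp_continuousOn hp.differentiableOn.continuousOn)
    have hcirc : ∀ a : Circle, ∀ z ∈ annulus r, (a : ℂ) • z ∈ annulus r := by
      intro a z hz
      have : ‖((a : ℂ) • z) 0‖ = ‖z 0‖ := by
        rw [Pi.smul_apply, smul_eq_mul, norm_mul, Circle.norm_coe, one_mul]
      exact ⟨by rw [this]; exact hz.1, by rw [this]; exact hz.2⟩
    rw [setIntegral_eq_setIntegral_circleAverage hcirc hΩ hcont hint] at h1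
    -- Averaging over a circle isolates the `n`-th Laurent coefficient, with weight `|w|²ⁿ`;
    -- integrating then produces the moment.
    have h2 : ∫ w in annulus r, Real.circleAverage (fun s : ℂ =>
        bergmanKernel (annulus r) (s • w) t * conj ((s • w) 0 ^ n)) 0 1 =
        ∫ w in annulus r, c n * ((‖w 0‖ ^ (2 * n) : ℝ) : ℂ) := by
      refine setIntegral_congr_fun hΩ.measurableSet fun w hw => ?_
      have hρ : 0 < ‖w 0‖ := hr.trans hw.1
      have hρc : (‖w 0‖ : ℂ) ≠ 0 := by exact_mod_cast hρ.ne'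
      simp only [hFz, Pi.smul_apply, smul_eq_mul]
      rw [circleAverage_comp_mul (fun v => F v * conj (v ^ n)), Real.circleAverage_def]
      have h3 : ∫ θ in (0 : ℝ)..2 * Real.pi, F (circleMap 0 ‖w 0‖ θ) *
          conj (circleMap 0 ‖w 0‖ θ ^ n) = (‖w 0‖ : ℂ) ^ n *
          ∫ θ in (0 : ℝ)..2 * Real.pi, F (circleMap 0 ‖w 0‖ θ) * circleMap 0 1 θ ^ (-n) := by
        rw [← intervalIntegral.integral_const_mul]
        refine intervalIntegral.integral_congr fun θ _ => ?_
        have h4 : conj (circleMap 0 1 θ) = (circleMap 0 1 θ)⁻¹ := by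
          rw [circleMap_zero_one, ← Circle.coe_inv_eq_conj, Circle.coe_inv]
        rw [circleMap_zero_eq_mul ‖w 0‖ θ, map_zpow₀, map_mul, h4, Complex.conj_ofReal, mul_zpow,
          inv_zpow', mul_left_comm]
      rw [h3, hc1 _ hw.1 hw.2 n, Complex.real_smul, two_mul n, zpow_add₀ hρ.ne']
      push_cast
      have hpi : (Real.pi : ℂ) ≠ 0 := by exact_mod_cast Real.pi_ne_zero
      field_simp
    rw [h2, integral_const_mul, integral_complex_ofReal] at h1
    change _ = c n * (annulusMoment r n : ℂ) at h1
    -- The identity `t̄ⁿ = c n Nₙ` with nonzero left side also shows that the moment is nonzero, so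
    -- the division is legitimate.
    have ht0 : conj (t 0) ^ n ≠ 0 :=
      zpow_ne_zero _ ((map_ne_zero _).2 (norm_pos_iff.1 (hr.trans ht.1)))
    have hN : (annulusMoment r n : ℂ) ≠ 0 := fun h => ht0 (by rw [h1, h, mul_zero])
    rw [h1, mul_div_cancel_right₀ _ hN]
  have h := hc2 (z 0) hz.1 hz.2
  rw [← hFz] at h
  convert h using 2 with n
  rw [hcn, mul_zpow]
  ring

theorem annulusMoment_nonneg (r : ℝ) (n : ℤ) : 0 ≤ annulusMoment r n :=
  integral_nonneg fun _ => by positivity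

/-- This is the kernel expansion on the diagonal, at the point `√x` of the annulus. -/
theorem summable_zpow_div_annulusMoment (hr : 0 < r) {x : ℝ} (h1 : r ^ 2 < x) (h2 : x < 1) :
    Summable fun n : ℤ => x ^ n / annulusMoment r n := by
  have hx : 0 < x := (by positivity : 0 < r ^ 2).trans h1
  have hz : (fun _ => ((√x : ℝ) : ℂ)) ∈ annulus r := by
    simp only [annulus, Set.mem_ofPred_eq, Complex.norm_real,
      Real.norm_of_nonneg (Real.sqrt_nonneg x)]
    exact ⟨Real.lt_sqrt_of_sq_lt h1, by rw [Real.sqrt_lt' one_pos]; simpa using h2⟩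
  have := (hasSum_bergmanKernel_annulus hr hz hz).summable
  rw [← Complex.summable_ofReal]
  refine this.congr fun n => ?_
  rw [Complex.conj_ofReal, ← Complex.ofReal_mul, Real.mul_self_sqrt hx.le]
  push_cast
  rfl

/-- The Bergman kernel of the annulus is bounded in the first variable. -/
theorem exists_norm_bergmanKernel_annulus_le (hr : 0 < r) (hr1 : r < 1) {t : Fin 1 → ℂ}
    (ht : t ∈ annulus r) : ∃ M, ∀ z ∈ annulus r, ‖bergmanKernel (annulus r) z t‖ ≤ M := by
  have ht0 : 0 < ‖t 0‖ := hr.trans ht.1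
  -- Since `|z|ⁿ ≤ 1 + rⁿ` for either sign of `n`, the series at `|t|` and at `r|t|` majorize the
  -- kernel series uniformly in `z`. Both points lie in `(r², 1)`.
  have s1 := summable_zpow_div_annulusMoment hr (x := ‖t 0‖) (by nlinarith [ht.1]) ht.2
  have s2 := summable_zpow_div_annulusMoment hr (x := r * ‖t 0‖) (by nlinarith [ht.1])
    (by nlinarith [ht.2])
  refine ⟨∑' n : ℤ, (‖t 0‖ ^ n / annulusMoment r n + (r * ‖t 0‖) ^ n / annulusMoment r n),
    fun z hz => ?_⟩
  have h := hasSum_bergmanKernel_annulus hr hz ht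
  rw [← h.tsum_eq]
  refine tsum_of_norm_bounded (s1.add s2).hasSum fun n => ?_
  have hN := annulusMoment_nonneg r n
  rw [norm_div, norm_zpow, norm_mul, RCLike.norm_conj, Complex.norm_real,
      Real.norm_of_nonneg hN, ← add_div]
  refine div_le_div_of_nonneg_right ?_ hN
  rw [mul_zpow, mul_zpow]
  have := mul_le_mul_of_nonneg_right (zpow_le_one_add_zpow hr hz.1.le hz.2.le n)
    (zpow_pos ht0 n).le
  linarith

theorem annulusMoment_eq (hr : 0 < r) (hr1 : r < 1) (n : ℤ) :
    annulusMoment r n = 2 * Real.pi * ∫ x in r..1, x ^ (2 * n + 1) := by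
  have hmp := volume_preserving_funUnique (Fin 1) ℂ
  have h1 : annulusMoment r n = ∫ w : ℂ, (Set.Ioo r 1).indicator (fun x => x ^ (2 * n)) ‖w‖ := by
    rw [annulusMoment, ← integral_indicator (isOpen_annulus r).measurableSet,
      ← hmp.integral_comp (MeasurableEquiv.measurableEmbedding _)]
    refine integral_congr_ae (Eventually.of_forall fun z => ?_)
    rfl
  rw [h1, integral_fun_norm_addHaar volume (fun x => (Set.Ioo r 1).indicator (fun x => x ^ (2 * n)) x)]
  have h2 : ∫ y in Set.Ioi (0 : ℝ), y ^ (Module.finrank ℝ ℂ - 1) •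
      (Set.Ioo r 1).indicator (fun x => x ^ (2 * n)) y = ∫ x in r..1, x ^ (2 * n + 1) := by
    rw [intervalIntegral.integral_of_le hr1.le, integral_Ioc_eq_integral_Ioo,
      ← integral_indicator measurableSet_Ioo, ← integral_indicator measurableSet_Ioi]
    refine integral_congr_ae (Eventually.of_forall fun y => ?_)
    simp only [Complex.finrank_real_complex, Set.indicator_apply, Set.mem_Ioi, Set.mem_Ioo]
    by_cases hy : r < y ∧ y < 1
    · have hy0 : 0 < y := hr.trans hy.1
      simp only [hy, hy0, and_self, if_true, smul_eq_mul, Nat.add_one_sub_one]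
      rw [zpow_add_one₀ hy0.ne', mul_comm, pow_one]
    · simp [hy]
  rw [h2, Complex.finrank_real_complex]
  have h3 : volume.real (Metric.ball (0 : ℂ) 1) = Real.pi := by
    simp [Measure.real, Complex.volume_ball]
  rw [h3]
  simp [mul_assoc]

/-- The exceptional exponent, where the radial integrand is `1/x` and a logarithm appears. -/
theorem annulusMoment_neg_one (hr : 0 < r) (hr1 : r < 1) :
    annulusMoment r (-1) = 2 * Real.pi * (- Real.log r) := by
  rw [annulusMoment_eq hr hr1]
  have : (2 * (-1 : ℤ) + 1) = -1 := by norm_num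
  rw [this]
  simp only [zpow_neg_one]
  rw [integral_inv_of_pos hr one_pos]
  simp

theorem annulusMoment_of_ne (hr : 0 < r) (hr1 : r < 1) {n : ℤ} (hn : n + 1 ≠ 0) :
    annulusMoment r n = Real.pi * (1 - (r ^ 2) ^ (n + 1)) / (n + 1) := by
  rw [annulusMoment_eq hr hr1, integral_zpow]
  · have h1 : (2 * n + 1 + 1) = 2 * (n + 1) := by ring
    have h4 : r ^ (2 * (n + 1)) = (r ^ 2) ^ (n + 1) := by rw [zpow_mul, zpow_ofNat]
    rw [h1, h4, one_zpow]
    have h2 : (n : ℝ) + 1 ≠ 0 := by exact_mod_cast hn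
    have h3 : ((2 * n + 1 : ℤ) : ℝ) + 1 = 2 * (n + 1) := by push_cast; ring
    rw [h3]
    field_simp
  · right
    refine ⟨by omega, ?_⟩
    rw [Set.uIcc_of_le hr1.le]
    exact fun h => absurd h.1 (not_le.2 hr)

end AnnulusKernel

/-! ### A zero of the annulus kernel by Rolle's theorem. -/

section KernelZero

theorem hasSum_of_forall_eq {ι α : Type*} [AddCommMonoid α] [TopologicalSpace α] {f g : ι → α}
    {a : α} (h : HasSum g a) (e : ∀ k, f k = g k) : HasSum f a := funext e ▸ h

variable {r : ℝ}

/-- The Lambert coefficient `q ^ k / (1 - q ^ k)` with `q = r ^ 2`. -/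
noncomputable def lambertCoeff (r : ℝ) (k : ℕ) : ℝ := (r ^ 2) ^ k / (1 - (r ^ 2) ^ k)

/-- At `k = 0` the coefficient is the quotient `1 / 0 = 0`. In the sums below its value there is
immaterial, since the factor `k` or `y ^ k - y⁻¹ ^ k` vanishes. -/
theorem lambertCoeff_nonneg (hr : 0 < r) (hr1 : r < 1) (k : ℕ) : 0 ≤ lambertCoeff r k := by
  have : (r ^ 2) ^ k ≤ 1 := pow_le_one₀ (by positivity) (by nlinarith)
  exact div_nonneg (by positivity) (by linarith)

theorem natCast_mul_lambertCoeff_le (hr : 0 < r) (hr1 : r < 1) (k : ℕ) :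
    k * lambertCoeff r k ≤ k * ((r ^ 2) ^ k / (1 - r ^ 2)) := by
  rcases k.eq_zero_or_pos with rfl | hk
  · simp
  · have h1 : r ^ 2 < 1 := by nlinarith
    have : (r ^ 2) ^ k ≤ r ^ 2 := pow_le_of_le_one (by positivity) h1.le hk.ne'
    unfold lambertCoeff
    gcongr

/-- With `q = r²`, `k = n + 1` and `λ_k` the Lambert coefficient, the terms are `k (-x)^k / (1 -
q^k)` up to the factor `-1 / (πx)`. For `k > 0` one has `1 / (1 - q^k) = 1 + λ_k`, which splits off
the series `∑ k (-x)^k`; for index `-k` one has `-k / (1 - q^(-k)) = k λ_k`; `k = 0` is the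
logarithmic moment. -/
theorem hasSum_zpow_div_annulusMoment_neg (hr : 0 < r) (hr1 : r < 1) {x : ℝ} (hx : r < x)
    (hx1 : x < 1) {P Q : ℝ} (hP : HasSum (fun k : ℕ => k * (-x) ^ k * lambertCoeff r k) P)
    (hQ : HasSum (fun k : ℕ => k * ((-x)⁻¹) ^ k * lambertCoeff r k) Q) :
    HasSum (fun n : ℤ => (-x) ^ n / annulusMoment r n)
      (-(Real.pi * x)⁻¹ * ((2 * (-Real.log r))⁻¹ - x / (1 + x) ^ 2 + P + Q)) := by
  have hx0 : 0 < x := hr.trans hx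
  have hq : r ^ 2 < 1 := by nlinarith
  have hpi := Real.pi_pos
  set L := -Real.log r with hL
  have hL0 : 0 < L := by rw [hL]; exact neg_pos.2 (Real.log_neg hr hr1)
  -- Indexed by `n + 1`, so the exceptional exponent `-1` sits at `k = 0`.
  set g : ℤ → ℝ := fun k => if k = 0 then (2 * L)⁻¹ else k * (-x) ^ k / (1 - (r ^ 2) ^ k)
  have hgeom : HasSum (fun k : ℕ => (k : ℝ) * (-x) ^ k) (-x / (1 - -x) ^ 2) :=
    hasSum_coe_mul_geometric_of_norm_lt_one
      (by rw [norm_neg, Real.norm_of_nonneg hx0.le]; exact hx1)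
  have h1 : HasSum (fun k : ℕ => g k) ((2 * L)⁻¹ + (-x / (1 - -x) ^ 2 + P)) := by
    refine hasSum_of_forall_eq ((hasSum_ite_eq 0 ((2 * L)⁻¹)).add (hgeom.add hP)) fun k => ?_
    rcases k.eq_zero_or_pos with rfl | hk
    · simp [g, lambertCoeff]
    · have hk' : (k : ℤ) ≠ 0 := by exact_mod_cast hk.ne'
      have h3 : (r ^ 2) ^ k < 1 := pow_lt_one₀ (by positivity) hq hk.ne'
      have h4 : 1 - (r ^ 2) ^ k ≠ 0 := by linarith
      simp only [g, hk', if_false, hk.ne', zpow_natCast, Int.cast_natCast, lambertCoeff, zero_add]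
      field_simp
      ring
  have h2 : HasSum (fun k : ℕ => g (-((k : ℤ) + 1))) Q := by
    have := (hasSum_nat_add_iff' 1).2 hQ
    simp only [Finset.range_one, Finset.sum_singleton, Nat.cast_zero, zero_mul, sub_zero] at this
    refine hasSum_of_forall_eq this fun k => ?_
    have hk' : -((k : ℤ) + 1) ≠ 0 := by omega
    have h3 : (r ^ 2) ^ (k + 1) < 1 := pow_lt_one₀ (by positivity) hq (by omega)
    have h4 : 1 - (r ^ 2) ^ (k + 1) ≠ 0 := by linarith
    have h5 : (r ^ 2) ^ (k + 1) - 1 ≠ 0 := by linarith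
    have h6 : (r ^ 2) ^ (k + 1) ≠ 0 := by positivity
    have e1 : ∀ y : ℝ, y ^ (-((k : ℤ) + 1)) = (y ^ (k + 1))⁻¹ := fun y => by
      rw [zpow_neg]; norm_cast
    simp only [g, hk', if_false, lambertCoeff, e1, inv_pow]
    have e2 : 1 - ((r ^ 2) ^ (k + 1))⁻¹ = ((r ^ 2) ^ (k + 1) - 1) / (r ^ 2) ^ (k + 1) := by
      field_simp
    rw [e2, div_div_eq_mul_div]
    have e3 : (r ^ 2) ^ (k + 1) - 1 = -(1 - (r ^ 2) ^ (k + 1)) := by ring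
    rw [e3, div_neg]
    push_cast
    ring
  have h3 := (((Equiv.addRight (1 : ℤ)).hasSum_iff (f := g)).2
    (h1.of_nat_of_neg_add_one h2)).mul_left (-(Real.pi * x)⁻¹)
  have e : -(Real.pi * x)⁻¹ * ((2 * L)⁻¹ - x / (1 + x) ^ 2 + P + Q) =
      -(Real.pi * x)⁻¹ * ((2 * L)⁻¹ + (-x / (1 - -x) ^ 2 + P) + Q) := by
    rw [sub_neg_eq_add]; ring
  rw [e]
  refine hasSum_of_forall_eq h3 fun n => ?_
  · simp only [Function.comp_apply, Equiv.coe_addRight, g]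
    split_ifs with hn
    · obtain rfl : n = -1 := by omega
      rw [annulusMoment_neg_one hr hr1, zpow_neg_one, show Real.log r = -L by rw [hL, neg_neg]]
      field_simp
    · rw [annulusMoment_of_ne hr hr1 hn, zpow_add_one₀ (by linarith : -x ≠ 0)]
      push_cast
      rw [div_div_eq_mul_div, mul_div_assoc', mul_comm Real.pi (1 - _), ← div_div]
      field_simp

theorem summable_lambert_majorant (hr : 0 < r) {a : ℝ} (ha : 0 < a) (haq : r ^ 2 < a) :
    Summable fun k : ℕ => (2 * a⁻¹ / (1 - r ^ 2)) * ((k : ℝ) ^ 1 * (a⁻¹ * r ^ 2) ^ k) := by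
  have h : ‖a⁻¹ * r ^ 2‖ < 1 := by
    rw [Real.norm_of_nonneg (by positivity), inv_mul_lt_iff₀ ha, mul_one]
    exact haq
  exact (summable_pow_mul_geometric_of_norm_lt_one 1 h).mul_left _

/-- On `(a, a⁻¹)` both `y` and `y⁻¹` are at most `a⁻¹`, and `λ_k ≤ r²ᵏ / (1 - r²)` for `k > 0`. The
resulting ratio `a⁻¹ r²` is below `1` once `r² < a`, which permits termwise differentiation. -/
theorem norm_lambert_term_le (hr : 0 < r) (hr1 : r < 1) {a : ℝ} (ha : 0 < a) (k : ℕ) {y : ℝ}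
    (hy : y ∈ Set.Ioo a a⁻¹) :
    ‖(-1) ^ k * (k * (y ^ k + (y⁻¹) ^ k) / y) * lambertCoeff r k‖ ≤
      (2 * a⁻¹ / (1 - r ^ 2)) * ((k : ℝ) ^ 1 * (a⁻¹ * r ^ 2) ^ k) := by
  have hy0 : 0 < y := ha.trans hy.1
  have hyi : y⁻¹ ≤ a⁻¹ := inv_anti₀ ha hy.1.le
  rw [norm_mul, norm_mul, norm_pow, norm_neg, norm_one, one_pow, one_mul,
    Real.norm_of_nonneg (by positivity), Real.norm_of_nonneg (lambertCoeff_nonneg hr hr1 k)]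
  calc k * (y ^ k + (y⁻¹) ^ k) / y * lambertCoeff r k
      = (y ^ k + (y⁻¹) ^ k) * y⁻¹ * (k * lambertCoeff r k) := by rw [div_eq_mul_inv]; ring
    _ ≤ ((a⁻¹) ^ k + (a⁻¹) ^ k) * a⁻¹ * (k * ((r ^ 2) ^ k / (1 - r ^ 2))) := by
        refine mul_le_mul ?_ (natCast_mul_lambertCoeff_le hr hr1 k)
          (mul_nonneg k.cast_nonneg (lambertCoeff_nonneg hr hr1 k)) (by positivity)
        have := hy.2.le
        gcongr
    _ = _ := by rw [mul_pow]; ring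

theorem hasDerivAt_lambert_term (c : ℝ) (k : ℕ) {y : ℝ} (hy0 : y ≠ 0) :
    HasDerivAt (fun y : ℝ => (-1) ^ k * (y ^ k - (y⁻¹) ^ k) * c)
      ((-1) ^ k * (k * (y ^ k + (y⁻¹) ^ k) / y) * c) y := by
  have h0 : HasDerivAt (fun y : ℝ => (y⁻¹) ^ k) (k * (y⁻¹) ^ (k - 1) * -(y ^ 2)⁻¹) y :=
    (hasDerivAt_inv hy0).fun_pow k
  have h1 : HasDerivAt (fun y : ℝ => y ^ k - (y⁻¹) ^ k)
    (k * y ^ (k - 1) - k * (y⁻¹) ^ (k - 1) * -(y ^ 2)⁻¹) y := (hasDerivAt_pow k y).fun_sub h0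
  refine ((h1.const_mul ((-1 : ℝ) ^ k)).mul_const c).congr_deriv ?_
  rcases k with _ | k
  · simp
  · have h2 : (k + 1 : ℝ) ≠ 0 := by positivity
    simp only [Nat.add_one_sub_one, Nat.cast_add, Nat.cast_one, inv_pow]
    rw [pow_succ y k]
    have h3 : y ^ k ≠ 0 := pow_ne_zero _ hy0
    congr 2
    field_simp
    ring

theorem hasDerivAt_tsum_lambert (hr : 0 < r) (hr1 : r < 1) {a : ℝ} (haq : r ^ 2 < a) (ha1 : a < 1)
    {y : ℝ} (hy : y ∈ Set.Ioo a a⁻¹) :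
    HasDerivAt (fun y : ℝ => ∑' k : ℕ, (-1) ^ k * (y ^ k - (y⁻¹) ^ k) * lambertCoeff r k)
      (∑' k : ℕ, (-1) ^ k * (k * (y ^ k + (y⁻¹) ^ k) / y) * lambertCoeff r k) y := by
  have ha : 0 < a := (by positivity : (0 : ℝ) < r ^ 2).trans haq
  have hainv : 1 < a⁻¹ := (one_lt_inv₀ ha).2 ha1
  refine hasDerivAt_tsum_of_isPreconnected (t := Set.Ioo a a⁻¹) (y₀ := 1)
    (g := fun k y => (-1) ^ k * (y ^ k - (y⁻¹) ^ k) * lambertCoeff r k)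
    (g' := fun k y => (-1) ^ k * (k * (y ^ k + (y⁻¹) ^ k) / y) * lambertCoeff r k)
    (summable_lambert_majorant hr ha haq) isOpen_Ioo isPreconnected_Ioo
    (fun k y hy => hasDerivAt_lambert_term _ k (ha.trans hy.1).ne')
    (fun k y hy => norm_lambert_term_le hr hr1 ha k hy) ⟨ha1, hainv⟩ ?_ hy
  simp

/-- The Bergman kernel of every annulus has zeros. -/
theorem exists_bergmanKernel_annulus_eq_zero (hr : 0 < r) (hr1 : r < 1) :
    ∃ z₀ ∈ annulus r, (bergmanZeroSet (annulus r) z₀).Nonempty := by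
  set L := -Real.log r with hL
  have hL0 : 0 < L := neg_pos.2 (Real.log_neg hr hr1)
  set G : ℝ → ℝ := fun y => ∑' k : ℕ, (-1) ^ k * (y ^ k - (y⁻¹) ^ k) * lambertCoeff r k
  set G' : ℝ → ℝ := fun y => ∑' k : ℕ, (-1) ^ k * (k * (y ^ k + (y⁻¹) ^ k) / y) * lambertCoeff r k
  -- A primitive chosen so that `x F'(x)` is the bracket in `hasSum_zpow_div_annulusMoment_neg`,
  -- hence vanishes exactly when the kernel sum at `-x` does.
  set F : ℝ → ℝ := fun y => (2 * L)⁻¹ * Real.log y + ((1 + y)⁻¹ - 1) + G y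
  -- `a < r` puts `[r, 1]` inside `(a, a⁻¹)`, and `a > r²` makes the majorant converge.
  obtain ⟨a, haq, har⟩ : ∃ a, r ^ 2 < a ∧ a < r := exists_between (by nlinarith)
  have ha : 0 < a := (by positivity : (0 : ℝ) < r ^ 2).trans haq
  have hmem : ∀ y ∈ Set.Icc r 1, y ∈ Set.Ioo a a⁻¹ := fun y hy =>
    ⟨har.trans_le hy.1, hy.2.trans_lt ((one_lt_inv₀ ha).2 (har.trans hr1))⟩
  have hF : ∀ y ∈ Set.Icc r 1,
      HasDerivAt F ((2 * L)⁻¹ * y⁻¹ + -1 / (1 + y) ^ 2 + G' y) y := by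
    intro y hy
    have hy0 : 0 < y := hr.trans_le hy.1
    have h1 : HasDerivAt (fun y : ℝ => (1 + y)⁻¹ - 1) (-1 / (1 + y) ^ 2) y := by
      simpa using (((hasDerivAt_id y).const_add 1).fun_inv (by simp; linarith)).sub_const 1
    exact (((Real.hasDerivAt_log hy0.ne').const_mul _).add h1).add
      (hasDerivAt_tsum_lambert hr hr1 haq (har.trans hr1) (hmem y hy))
  have hF1 : F 1 = -1 / 2 := by
    simp only [F, G, Real.log_one, inv_one, sub_self, mul_zero, zero_mul, tsum_zero]
    norm_num
  -- At `y = r` each term `(r^k - r^(-k)) λ_k` with `k > 0` collapses to `-r^k`, so `G r` is a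
  -- geometric sum that cancels `(1 + r)⁻¹ - 1`; the logarithmic term alone remains.
  have hFr : F r = -1 / 2 := by
    have hgeom : HasSum (fun k : ℕ => (-r) ^ k) (1 - -r)⁻¹ :=
      hasSum_geometric_of_norm_lt_one (by rw [norm_neg, Real.norm_of_nonneg hr.le]; exact hr1)
    have hG : G r = 1 - (1 - -r)⁻¹ := by
      refine HasSum.tsum_eq ?_
      refine hasSum_of_forall_eq ((hasSum_ite_eq 0 (1 : ℝ)).sub hgeom) fun k => ?_
      rcases k.eq_zero_or_pos with rfl | hk
      · simp
      · have h3 : (r ^ 2) ^ k < 1 := pow_lt_one₀ (by positivity) (by nlinarith) hk.ne'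
        have h4 : 1 - (r ^ 2) ^ k ≠ 0 := by linarith
        simp only [hk.ne', if_false, lambertCoeff, zero_sub]
        rw [neg_pow r k, inv_pow]
        have h5 : r ^ k ≠ 0 := by positivity
        have h6 : (r ^ 2) ^ k = r ^ k * r ^ k := by ring
        rw [h6] at h4 ⊢
        generalize r ^ k = y at h4 h5 ⊢
        have h7 : y - y⁻¹ = -(1 - y * y) * y⁻¹ := by field_simp; ring
        calc (-1) ^ k * (y - y⁻¹) * (y * y / (1 - y * y))
            = -((-1) ^ k * (y * (y * y⁻¹)) * ((1 - y * y) / (1 - y * y))) := by rw [h7]; ring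
          _ = _ := by rw [div_self h4, mul_inv_cancel₀ h5]; ring
    have hlog : (2 * L)⁻¹ * Real.log r = -1 / 2 := by
      rw [show Real.log r = -L by rw [hL, neg_neg]]
      field_simp
    simp only [F, hG, hlog, sub_neg_eq_add]
    ring
  obtain ⟨x, hx, hx0⟩ := exists_hasDerivAt_eq_zero hr1
    (fun y hy => (hF y hy).continuousAt.continuousWithinAt) (hFr.trans hF1.symm)
    (fun y hy => hF y ⟨hy.1.le, hy.2.le⟩)
  have hxpos : 0 < x := hr.trans hx.1
  have hs := Summable.of_norm_bounded (summable_lambert_majorant hr ha haq)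
    fun k => norm_lambert_term_le hr hr1 ha k (hmem x ⟨hx.1.le, hx.2.le⟩)
  have hsx : Summable fun k : ℕ => k * (x ^ k + (x⁻¹) ^ k) * lambertCoeff r k := by
    refine (hs.norm.mul_left x).congr fun k => ?_
    rw [norm_mul, norm_mul, norm_pow, norm_neg, norm_one, one_pow, one_mul,
      Real.norm_of_nonneg (by positivity), Real.norm_of_nonneg (lambertCoeff_nonneg hr hr1 k)]
    field_simp
  have hP : Summable fun k : ℕ => k * (-x) ^ k * lambertCoeff r k := by
    refine Summable.of_norm_bounded hsx fun k => ?_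
    rw [norm_mul, norm_mul, norm_pow, norm_neg, Real.norm_of_nonneg hxpos.le,
      Real.norm_of_nonneg (Nat.cast_nonneg k), Real.norm_of_nonneg (lambertCoeff_nonneg hr hr1 k)]
    have := lambertCoeff_nonneg hr hr1 k
    gcongr
    exact le_add_of_nonneg_right (by positivity)
  have hQ : Summable fun k : ℕ => k * ((-x)⁻¹) ^ k * lambertCoeff r k := by
    refine Summable.of_norm_bounded hsx fun k => ?_
    rw [norm_mul, norm_mul, norm_pow, norm_inv, norm_neg, Real.norm_of_nonneg hxpos.le,
      Real.norm_of_nonneg (Nat.cast_nonneg k), Real.norm_of_nonneg (lambertCoeff_nonneg hr hr1 k)]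
    have := lambertCoeff_nonneg hr hr1 k
    gcongr
    exact le_add_of_nonneg_left (by positivity)
  have hG' : x * G' x = (∑' k : ℕ, k * (-x) ^ k * lambertCoeff r k) +
      ∑' k : ℕ, k * ((-x)⁻¹) ^ k * lambertCoeff r k := by
    rw [← hP.tsum_add hQ, ← tsum_mul_left]
    refine tsum_congr fun k => ?_
    rw [inv_neg, neg_pow x, neg_pow x⁻¹]
    field_simp
  have hsum := hasSum_zpow_div_annulusMoment_neg hr hr1 hx.1 hx.2 hP.hasSum hQ.hasSum
  have hzero : (2 * (-Real.log r))⁻¹ - x / (1 + x) ^ 2 + (∑' k : ℕ, k * (-x) ^ k * lambertCoeff r k) +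
      ∑' k : ℕ, k * ((-x)⁻¹) ^ k * lambertCoeff r k = 0 := by
    rw [add_assoc, ← hG', ← hL]
    calc _ = x * ((2 * L)⁻¹ * x⁻¹ + -1 / (1 + x) ^ 2 + G' x) := by field_simp; ring
      _ = 0 := by rw [hx0, mul_zero]
  rw [hzero, mul_zero] at hsum
  have hsq : r < √x ∧ √x < 1 := ⟨Real.lt_sqrt_of_sq_lt (by nlinarith [hx.1]), by
    rw [Real.sqrt_lt' one_pos]; simpa using hx.2⟩
  have hz : (fun _ => ((√x : ℝ) : ℂ)) ∈ annulus r := by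
    simpa only [annulus, Set.mem_ofPred_eq, Complex.norm_real,
      Real.norm_of_nonneg (Real.sqrt_nonneg x)] using hsq
  have hz' : (fun _ => (-(√x : ℝ) : ℂ)) ∈ annulus r := by
    simpa only [annulus, Set.mem_ofPred_eq, norm_neg, Complex.norm_real,
      Real.norm_of_nonneg (Real.sqrt_nonneg x)] using hsq
  -- `z₀ = √x` and `z = -√x`, so that `z z̄₀ = -x`.
  refine ⟨_, hz, _, hz', ?_⟩
  refine (hasSum_bergmanKernel_annulus hr hz' hz).unique ?_
  have h := Complex.hasSum_ofReal.2 hsum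
  rw [Complex.ofReal_zero] at h
  refine hasSum_of_forall_eq h fun n => ?_
  rw [Complex.conj_ofReal, neg_mul, ← Complex.ofReal_mul, Real.mul_self_sqrt hxpos.le]
  push_cast
  rfl

end KernelZero

/-! ### Isolated zeros and removable singularities of `L²` holomorphic functions. -/

section Removable

theorem fin_one_const_apply (z : Fin 1 → ℂ) : (fun _ => z 0) = z := by
  ext i; rw [Subsingleton.elim i 0]

theorem differentiable_fin_one_const : Differentiable ℂ (fun (w : ℂ) (_ : Fin 1) => w) :=
  differentiable_pi.2 fun _ => differentiable_id

theorem continuous_fin_one_const : Continuous (fun (w : ℂ) (_ : Fin 1) => w) :=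
  continuous_pi fun _ => continuous_id

theorem tendsto_apply_zero_punctured (p : Fin 1 → ℂ) :
    Tendsto (fun z : Fin 1 → ℂ => z 0) (𝓝[≠] p) (𝓝[≠] (p 0)) := by
  refine tendsto_nhdsWithin_of_tendsto_nhds_of_eventually_within _
    ((continuous_apply 0).continuousAt.tendsto.mono_left nhdsWithin_le_nhds) ?_
  filter_upwards [self_mem_nhdsWithin] with z hz h
  exact hz (by rw [Set.mem_singleton_iff, ← fin_one_const_apply z, ← fin_one_const_apply p, h])

variable {Ω A : Set (Fin 1 → ℂ)}

/-- The zeros of a holomorphic function of one variable are isolated. -/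
theorem eventually_ne_zero_of_isPreconnected (hΩ : IsOpen Ω) (hc : IsPreconnected Ω)
    {f : (Fin 1 → ℂ) → ℂ} (hf : DifferentiableOn ℂ f Ω) {z₀ : Fin 1 → ℂ} (hz₀ : z₀ ∈ Ω)
    (h0 : f z₀ ≠ 0) {p : Fin 1 → ℂ} (hp : p ∈ Ω) : ∀ᶠ z in 𝓝[≠] p, f z ≠ 0 := by
  set U : Set ℂ := (fun (w : ℂ) (_ : Fin 1) => w) ⁻¹' Ω
  have hU : IsOpen U := hΩ.preimage continuous_fin_one_const
  have hUim : (fun z : Fin 1 → ℂ => z 0) '' Ω = U := by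
    ext w
    refine ⟨?_, fun hw => ⟨_, hw, rfl⟩⟩
    rintro ⟨z, hz, rfl⟩
    simpa only [U, Set.mem_preimage, fin_one_const_apply] using hz
  have hUc : IsPreconnected U := hUim ▸ hc.image _ (continuous_apply 0).continuousOn
  have hF : DifferentiableOn ℂ (fun w : ℂ => f fun _ => w) U :=
    hf.comp differentiable_fin_one_const.differentiableOn fun _ hw => hw
  have key : ∀ᶠ w in 𝓝[≠] (p 0), f (fun _ => w) ≠ 0 := by
    by_contra hcon
    have hmem : ∀ z ∈ Ω, z 0 ∈ U := fun z hz => hUim ▸ Set.mem_image_of_mem _ hz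
    have h1 := (hF.analyticOnNhd hU).eqOn_zero_of_preconnected_of_frequently_eq_zero hUc
      (hmem p hp) (by simpa only [Filter.Frequently] using hcon) (hmem z₀ hz₀)
    simp only [fin_one_const_apply] at h1
    exact h0 h1
  filter_upwards [(tendsto_apply_zero_punctured p).eventually key] with z hz
  simpa only [fin_one_const_apply] using hz

theorem isOpen_diff_of_isolated (hΩ : IsOpen Ω) (hA : ∀ p ∈ Ω, ∀ᶠ z in 𝓝[≠] p, z ∉ A) :
    IsOpen (Ω \ A) := by
  refine isOpen_iff_mem_nhds.2 fun p hp => ?_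
  filter_upwards [hΩ.mem_nhds hp.1, eventually_nhdsWithin_iff.1 (hA p hp.1)] with z hz hz'
  by_cases h : z = p
  · exact h ▸ hp
  · exact ⟨hz, hz' h⟩

theorem diff_ae_eq_of_isolated (hΩ : IsOpen Ω) (hA : ∀ p ∈ Ω, ∀ᶠ z in 𝓝[≠] p, z ∉ A) :
    (Ω \ A : Set (Fin 1 → ℂ)) =ᵐ[volume] Ω := by
  have h1 : Aᶜ ∈ codiscreteWithin Ω := by
    rw [mem_codiscreteWithin_iff_forall_mem_nhdsNE]
    intro p hp
    filter_upwards [hA p hp] with z hz using Or.inl hz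
  have h2 := ae_restrict_le_codiscreteWithin (μ := volume) hΩ.measurableSet h1
  rw [mem_ae_iff, compl_compl, Measure.restrict_apply' hΩ.measurableSet] at h2
  rw [← Set.sdiff_inter_self_eq_sdiff]
  exact sdiff_null_ae_eq_self h2

theorem volume_real_ball_fin_one {ρ : ℝ} (hρ : 0 < ρ) :
    volume.real (Metric.ball (0 : Fin 1 → ℂ) ρ) =
      ρ ^ 2 * volume.real (Metric.ball (0 : Fin 1 → ℂ) 1) := by
  rw [measureReal_def, Measure.addHaar_ball_of_pos _ _ hρ, ENNReal.toReal_mul, measureReal_def,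
    ENNReal.toReal_ofReal (by positivity)]
  simp [Module.finrank_pi_fintype, Complex.finrank_real_complex]

/-- The ball of radius `|w - a|` about `w` misses `a`, so the sub-mean-value inequality bounds `(|f
w| |w - a|)²` by a constant times the `L²` mass on a shrinking ball, which tends to `0`. The value
of `f` at `a` is arbitrary; subtracting a constant is harmless. -/
theorem isLittleO_inv_of_memBergmanSpace {D : Set (Fin 1 → ℂ)} {f : (Fin 1 → ℂ) → ℂ}
    (hf : MemBergmanSpace D f) {a : ℂ} {R : ℝ} (hR : 0 < R)
    (hsub : ∀ w ∈ Metric.ball a R, w ≠ a → (fun _ => w) ∈ D) :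
    (fun w : ℂ => f (fun _ => w) - f (fun _ => a)) =o[𝓝[≠] a] fun w => (w - a)⁻¹ := by
  set c := volume.real (Metric.ball (0 : Fin 1 → ℂ) 1)
  have hc : 0 < c := volume_real_ball_pos one_pos
  have hdist : Tendsto (fun w : ℂ => ‖w - a‖) (𝓝[≠] a) (𝓝 0) := by
    have : ContinuousAt (fun w : ℂ => ‖w - a‖) a := by fun_prop
    simpa using this.tendsto.mono_left (nhdsWithin_le_nhds (s := {a}ᶜ))
  have hint : Integrable (fun z => ‖f z‖ ^ 2) (volume.restrict D) :=
    (memLp_two_iff_integrable_sq_norm hf.memLp.1).1 hf.memLp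
  have hlim : Tendsto (fun w : ℂ => ∫ z in Metric.ball (fun _ : Fin 1 => w) ‖w - a‖,
      ‖f z‖ ^ 2 ∂(volume.restrict D)) (𝓝[≠] a) (𝓝 0) := by
    refine hint.tendsto_setIntegral_nhds_zero ?_
    have h1 : Tendsto (fun w : ℂ => ENNReal.ofReal (‖w - a‖ ^ 2) *
        volume (Metric.ball (0 : Fin 1 → ℂ) 1)) (𝓝[≠] a) (𝓝 0) := by
      have := ENNReal.Tendsto.mul_const (b := volume (Metric.ball (0 : Fin 1 → ℂ) 1))
        (ENNReal.tendsto_ofReal (hdist.pow 2)) (Or.inr measure_ball_lt_top.ne)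
      simpa using this
    refine tendsto_of_tendsto_of_tendsto_of_le_of_le' tendsto_const_nhds h1
      (Eventually.of_forall fun _ => zero_le) ?_
    filter_upwards [self_mem_nhdsWithin] with w hw
    have hw' : 0 < ‖w - a‖ := norm_pos_iff.2 (sub_ne_zero.2 hw)
    refine (Measure.restrict_apply_le _ _).trans ?_
    rw [Measure.addHaar_ball_of_pos _ _ hw']
    simp [Module.finrank_pi_fintype, Complex.finrank_real_complex]
  have hbd : ∀ᶠ w in 𝓝[≠] a, (‖f fun _ => w‖ * ‖w - a‖) ^ 2 ≤
      (∫ z in Metric.ball (fun _ : Fin 1 => w) ‖w - a‖, ‖f z‖ ^ 2 ∂(volume.restrict D)) / c := by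
    filter_upwards [self_mem_nhdsWithin,
      hdist.eventually (gt_mem_nhds (half_pos hR))] with w hw hwR
    have hw' : 0 < ‖w - a‖ := norm_pos_iff.2 (sub_ne_zero.2 hw)
    have hballD : Metric.ball (fun _ : Fin 1 => w) ‖w - a‖ ⊆ D := by
      intro z hz
      have hz0 : ‖z 0 - w‖ < ‖w - a‖ := by
        have := (dist_pi_lt_iff hw').1 hz 0
        rwa [dist_eq_norm] at this
      rw [← fin_one_const_apply z]
      refine hsub _ ?_ fun h => ?_
      · rw [Metric.mem_ball, dist_eq_norm]
        calc ‖z 0 - a‖ ≤ ‖z 0 - w‖ + ‖w - a‖ := norm_sub_le_norm_sub_add_norm_sub _ _ _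
          _ < R := by linarith
      · rw [h, norm_sub_rev] at hz0
        exact lt_irrefl _ hz0
    have := sq_norm_mul_volume_ball_le (hf.differentiableOn.mono hballD)
      (hf.memLp.mono_measure (Measure.restrict_mono hballD le_rfl))
    rw [volume_real_ball_fin_one hw'] at this
    rw [le_div_iff₀ hc, Measure.restrict_restrict_of_subset hballD]
    calc _ = ‖f fun _ => w‖ ^ 2 * (‖w - a‖ ^ 2 * c) := by ring
      _ ≤ _ := this
  have hsq : Tendsto (fun w : ℂ => (‖f fun _ => w‖ * ‖w - a‖) ^ 2) (𝓝[≠] a) (𝓝 0) :=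
    tendsto_of_tendsto_of_tendsto_of_le_of_le' tendsto_const_nhds
      (by simpa using hlim.div_const c) (Eventually.of_forall fun _ => by positivity) hbd
  have hsmall : Tendsto (fun w : ℂ => ‖f fun _ => w‖ * ‖w - a‖) (𝓝[≠] a) (𝓝 0) := by
    have := (Real.continuous_sqrt.tendsto 0).comp hsq
    rw [Real.sqrt_zero] at this
    refine this.congr fun w => ?_
    exact Real.sqrt_sq (by positivity)
  have hconst : Tendsto (fun w : ℂ => ‖f fun _ => a‖ * ‖w - a‖) (𝓝[≠] a) (𝓝 0) := by
    simpa using hdist.const_mul ‖f fun _ => a‖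
  have haux : ∀ g : ℂ → ℂ, Tendsto (fun w => ‖g w‖ * ‖w - a‖) (𝓝[≠] a) (𝓝 0) →
      g =o[𝓝[≠] a] fun w => (w - a)⁻¹ := by
    intro g hg
    refine (Asymptotics.isLittleO_iff_tendsto' ?_).2 ?_
    · filter_upwards [self_mem_nhdsWithin] with w hw h
      exact absurd (inv_eq_zero.1 h) (sub_ne_zero.2 hw)
    · refine tendsto_zero_iff_norm_tendsto_zero.2 (hg.congr fun w => ?_)
      rw [div_inv_eq_mul, norm_mul]
  exact (haux _ hsmall).sub (haux (fun _ => f fun _ => a) hconst)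

/-- A square integrable holomorphic function extends holomorphically across isolated points. -/
theorem MemBergmanSpace.exists_extension (hΩ : IsOpen Ω)
    (hA : ∀ p ∈ Ω, ∀ᶠ z in 𝓝[≠] p, z ∉ A) {f : (Fin 1 → ℂ) → ℂ}
    (hf : MemBergmanSpace (Ω \ A) f) :
    ∃ g, MemBergmanSpace Ω g ∧ Set.EqOn g f (Ω \ A) := by
  classical
  have hD := isOpen_diff_of_isolated hΩ hA
  set F : ℂ → ℂ := fun w => f fun _ => w
  set g : (Fin 1 → ℂ) → ℂ := fun z => if z ∈ A then limUnder (𝓝[≠] (z 0)) F else f z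
  have hgf : Set.EqOn g f (Ω \ A) := fun z hz => if_neg hz.2
  refine ⟨g, ⟨fun p hp => ?_, ?_⟩, hgf⟩
  · refine DifferentiableAt.differentiableWithinAt ?_
    by_cases hpA : p ∈ A
    · obtain ⟨R, hR, hball⟩ := Metric.eventually_nhds_iff_ball.1
        ((hΩ.eventually_mem hp).and (eventually_nhdsWithin_iff.1 (hA p hp)))
      have hsub : ∀ w ∈ Metric.ball (p 0) R, w ≠ p 0 → (fun _ => w) ∈ Ω \ A := by
        intro w hw hne
        have hw' : (fun _ => w) ∈ Metric.ball p R := by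
          rw [← fin_one_const_apply p, Metric.mem_ball, dist_pi_lt_iff hR]
          exact fun _ => hw
        exact ⟨(hball _ hw').1, (hball _ hw').2 fun h => hne (congrFun h 0)⟩
      have hF : DifferentiableOn ℂ F (Metric.ball (p 0) R \ {p 0}) :=
        hf.differentiableOn.comp differentiable_fin_one_const.differentiableOn
          fun w hw => hsub w hw.1 hw.2
      have hO := isLittleO_inv_of_memBergmanSpace hf hR hsub
      have hext := Complex.differentiableOn_update_limUnder_of_isLittleO
        (Metric.ball_mem_nhds _ hR) hF hO
      have hext' := (hext.differentiableAt (Metric.ball_mem_nhds _ hR)).comp p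
        (differentiableAt_apply (𝕜 := ℂ) 0 p)
      refine hext'.congr_of_eventuallyEq ?_
      filter_upwards [Metric.ball_mem_nhds p hR] with z hz
      by_cases hzp : z = p
      · subst hzp
        simp [g, hpA]
      · have hz0 : z 0 ≠ p 0 := fun h => hzp (by
          rw [← fin_one_const_apply z, ← fin_one_const_apply p, h])
        rw [Function.comp_apply, Function.update_of_ne hz0]
        simp only [g, F, fin_one_const_apply]
        exact if_neg ((hball z hz).2 hzp)
    · refine (hf.differentiableOn.differentiableAt (hD.mem_nhds ⟨hp, hpA⟩)).congr_of_eventuallyEq ?_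
      filter_upwards [hD.mem_nhds ⟨hp, hpA⟩] with z hz using hgf hz
  · rw [← Measure.restrict_congr_set (diff_ae_eq_of_isolated hΩ hA)]
    exact hf.memLp.ae_eq ((ae_restrict_iff' hD.measurableSet).2 (ae_of_all _ fun z hz => (hgf hz).symm))

end Removable

/-! ### Kernel and connectedness after removing isolated points. -/

section Isolated

variable {Ω A : Set (Fin 1 → ℂ)}

theorem IsBergmanKernel.diff_of_isolated (hΩ : IsOpen Ω)
    (hA : ∀ p ∈ Ω, ∀ᶠ z in 𝓝[≠] p, z ∉ A) {k : (Fin 1 → ℂ) → (Fin 1 → ℂ) → ℂ}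
    (hk : IsBergmanKernel Ω k) : IsBergmanKernel (Ω \ A) k where
  mem t ht := ⟨(hk.mem t ht.1).differentiableOn.mono Set.sdiff_subset,
    (hk.mem t ht.1).memLp.mono_measure (Measure.restrict_mono Set.sdiff_subset le_rfl)⟩
  reproducing t ht f hf := by
    obtain ⟨g, hg, hgf⟩ := hf.exists_extension hΩ hA
    have hD := isOpen_diff_of_isolated hΩ hA
    rw [← hgf ht, hk.reproducing t ht.1 g hg,
      ← Measure.restrict_congr_set (diff_ae_eq_of_isolated hΩ hA)]
    exact setIntegral_congr_fun hD.measurableSet fun z hz => by simp only [hgf hz]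

theorem bergmanKernel_diff_eq (hΩ : IsOpen Ω) (hA : ∀ p ∈ Ω, ∀ᶠ z in 𝓝[≠] p, z ∉ A)
    {z t : Fin 1 → ℂ} (hz : z ∈ Ω \ A) (ht : t ∈ Ω \ A) :
    bergmanKernel (Ω \ A) z t = bergmanKernel Ω z t :=
  bergmanKernel_eq ((isBergmanKernel_bergmanKernel hΩ).diff_of_isolated hΩ hA) hz ht

/-- A continuous two-valued function on the punctured set is bounded and holomorphic, hence extends
to `Ω`; the extension still takes two values by density, so it is constant. -/
theorem isPreconnected_diff_of_isolated (hΩ : IsOpen Ω) (hvol : volume Ω ≠ ⊤)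
    (hc : IsPreconnected Ω) (hA : ∀ p ∈ Ω, ∀ᶠ z in 𝓝[≠] p, z ∉ A) :
    IsPreconnected (Ω \ A) := by
  have hD := isOpen_diff_of_isolated hΩ hA
  refine isPreconnected_of_forall_constant fun b hb x hx y hy => ?_
  set φ : Bool → ℂ := fun b => if b then 1 else 0
  have hφ : ∀ b, φ b ∈ ({0, 1} : Set ℂ) := by rintro (_ | _) <;> simp [φ]
  have hf : MemBergmanSpace (Ω \ A) (φ ∘ b) := by
    refine MemBergmanSpace.of_bounded hD
      (measure_ne_top_of_subset Set.sdiff_subset hvol) (fun z hz => ?_) (C := 1) fun z _ => ?_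
    · have h1 : ∀ᶠ w in 𝓝 z, b w = b z :=
        (hb.continuousAt (hD.mem_nhds hz)).eventually (isOpen_discrete {b z} |>.mem_nhds rfl)
      refine DifferentiableAt.differentiableWithinAt ?_
      refine (differentiableAt_const (φ (b z))).congr_of_eventuallyEq ?_
      filter_upwards [h1] with w hw
      simp [hw]
    · rcases hφ (b z) with h | h <;> simp_all
  obtain ⟨g, hg, hgf⟩ := hf.exists_extension hΩ hA
  have hgc : ContinuousOn g Ω := hg.differentiableOn.continuousOn
  have hmaps : Set.MapsTo g Ω {0, 1} := by
    intro z hz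
    have hcl : IsClosed ({0, 1} : Set ℂ) := (Set.toFinite _).isClosed
    refine hcl.mem_of_tendsto (b := 𝓝[≠] z)
      ((hgc.continuousAt (hΩ.mem_nhds hz)).tendsto.mono_left nhdsWithin_le_nhds) ?_
    filter_upwards [hA z hz, nhdsWithin_le_nhds (hΩ.mem_nhds hz)] with w hw hwΩ
    rw [hgf ⟨hwΩ, hw⟩]
    exact hφ _
  obtain ⟨c, -, hcg⟩ := hc.eqOn_const_of_mapsTo (Set.toFinite _).isDiscrete hgc hmaps ⟨0, by simp⟩
  have h1 : φ (b x) = φ (b y) :=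
    (hgf hx).symm.trans ((hcg hx.1).trans ((hcg hy.1).symm.trans (hgf hy)))
  revert h1
  cases b x <;> cases b y <;> simp [φ]

theorem isConnected_annulus {r : ℝ} (hr : 0 < r) (hr1 : r < 1) : IsConnected (annulus r) := by
  have : annulus r = (fun (p : ℝ × ℝ) (_ : Fin 1) => (p.1 : ℂ) * Complex.exp (p.2 * Complex.I)) ''
      (Set.Ioo r 1 ×ˢ Set.univ) := by
    ext z
    constructor
    · intro hz
      refine ⟨(‖z 0‖, (z 0).arg), ⟨hz, trivial⟩, ?_⟩
      simp only [Complex.norm_mul_exp_arg_mul_I, fin_one_const_apply]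
    · rintro ⟨⟨s, θ⟩, ⟨hs, -⟩, rfl⟩
      have : 0 < s := hr.trans hs.1
      simpa [annulus, Complex.norm_exp_ofReal_mul_I, abs_of_pos this] using hs
  rw [this]
  exact ((isConnected_Ioo hr1).prod isConnected_univ).image _ (by fun_prop)

end Isolated

/-! ### Blow-up of the kernel at peak points. -/

section Peak

/-- The Bergman kernel blows up at a boundary point that admits a peak function. -/
theorem tendsto_bergmanKernel_self_atTop {n : ℕ} {Ω : Set (Fin n → ℂ)} (hΩ : IsOpen Ω)
    (hvol : volume Ω ≠ ⊤) {h : (Fin n → ℂ) → ℂ} (hh : DifferentiableOn ℂ h Ω)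
    (hlt : ∀ z ∈ Ω, ‖h z‖ < 1) {b : Fin n → ℂ}
    (hb : Tendsto (fun z => ‖h z‖) (𝓝[Ω] b) (𝓝 1)) :
    Tendsto (fun z => (bergmanKernel Ω z z).re) (𝓝[Ω] b) atTop := by
  have hint : Tendsto (fun N : ℕ => ∫ z in Ω, ‖h z ^ N‖ ^ 2) atTop (𝓝 0) := by
    have h0 : Tendsto (fun N : ℕ => ∫ z in Ω, ‖h z ^ N‖ ^ 2) atTop (𝓝 (∫ z in Ω, (0 : ℝ))) := by
      refine tendsto_integral_of_dominated_convergence (fun _ => 1) (fun N => ?_) ?_ (fun N => ?_) ?_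
      · exact ((hh.pow N).continuousOn.norm.pow 2).aestronglyMeasurable hΩ.measurableSet
      · have : IsFiniteMeasure (volume.restrict Ω) := ⟨by simpa using hvol.lt_top⟩
        exact integrable_const 1
      · refine (ae_restrict_iff' hΩ.measurableSet).2 (ae_of_all _ fun z hz => ?_)
        rw [Real.norm_of_nonneg (by positivity), norm_pow]
        exact pow_le_one₀ (by positivity) (pow_le_one₀ (norm_nonneg _) (hlt z hz).le)
      · refine (ae_restrict_iff' hΩ.measurableSet).2 (ae_of_all _ fun z hz => ?_)
        simpa [norm_pow] using
          (tendsto_pow_atTop_nhds_zero_of_lt_one (norm_nonneg _) (hlt z hz)).pow 2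
    simpa using h0
  refine tendsto_atTop.2 fun C => ?_
  -- The powers `h^N` have norm tending to `0` but modulus tending to `1` at `b`. With `‖h^N‖² < 1 /
  -- (2(|C| + 1))` and `|h^N z|² > 1/2`, the extremal property gives `K(z, z) > |C| + 1`.
  obtain ⟨N, hN⟩ := (hint.eventually (gt_mem_nhds
    (by positivity : (0 : ℝ) < (2 * (|C| + 1))⁻¹))).exists
  have hmem : MemBergmanSpace Ω fun z => h z ^ N :=
    MemBergmanSpace.of_bounded hΩ hvol (hh.pow N) (C := 1) fun z hz => by
      rw [norm_pow]
      exact pow_le_one₀ (norm_nonneg _) (hlt z hz).le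
  have hlim : Tendsto (fun z => ‖h z ^ N‖ ^ 2) (𝓝[Ω] b) (𝓝 1) := by
    simpa [norm_pow] using (hb.pow N).pow 2
  filter_upwards [hlim.eventually (lt_mem_nhds (by norm_num : (1 / 2 : ℝ) < 1)),
    self_mem_nhdsWithin] with z hz hzΩ
  have h1 := hmem.sq_norm_le hΩ hzΩ
  have h2 := bergmanKernel_self_nonneg hΩ hzΩ
  have h3 : 1 / 2 < (bergmanKernel Ω z z).re * (2 * (|C| + 1))⁻¹ :=
    hz.trans_le (h1.trans (mul_le_mul_of_nonneg_left hN.le h2))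
  rw [← div_eq_mul_inv, div_lt_div_iff₀ two_pos (by positivity)] at h3
  nlinarith [le_abs_self C]

end Peak

/-! ### The punctured annulus: blow-up and incompleteness. -/

section PuncturedAnnulus

variable {r : ℝ} {z₀ : Fin 1 → ℂ}

theorem eventually_notMem_bergmanZeroSet_annulus (hr : 0 < r) (hr1 : r < 1) (hz₀ : z₀ ∈ annulus r)
    {p : Fin 1 → ℂ} (hp : p ∈ annulus r) :
    ∀ᶠ z in 𝓝[≠] p, z ∉ bergmanZeroSet (annulus r) z₀ := by
  have h0 : bergmanKernel (annulus r) z₀ z₀ ≠ 0 := fun h => by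
    have := bergmanKernel_self_pos (isOpen_annulus r) (volume_annulus_ne_top r) hz₀
    simp [h] at this
  filter_upwards [eventually_ne_zero_of_isPreconnected (isOpen_annulus r)
    (isConnected_annulus hr hr1).isPreconnected
    (differentiableOn_bergmanKernel_left (isOpen_annulus r) hz₀) hz₀ h0 hp] with z hz h
  exact hz h.2

theorem self_mem_puncturedAnnulus (hz₀ : z₀ ∈ annulus r) : z₀ ∈ puncturedAnnulus r z₀ :=
  ⟨hz₀, fun h => by
    have := bergmanKernel_self_pos (isOpen_annulus r) (volume_annulus_ne_top r) hz₀
    simp [h.2] at this⟩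

theorem isBoundedDomain_puncturedAnnulus (hr : 0 < r) (hr1 : r < 1) (hz₀ : z₀ ∈ annulus r) :
    IsBoundedDomain (puncturedAnnulus r z₀) where
  isOpen := isOpen_diff_of_isolated (isOpen_annulus r) fun _ =>
    eventually_notMem_bergmanZeroSet_annulus hr hr1 hz₀
  isConnected := ⟨⟨z₀, self_mem_puncturedAnnulus hz₀⟩, isPreconnected_diff_of_isolated
    (isOpen_annulus r) (volume_annulus_ne_top r) (isConnected_annulus hr hr1).isPreconnected
    fun _ => eventually_notMem_bergmanZeroSet_annulus hr hr1 hz₀⟩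
  isBounded := (isBounded_annulus r).subset Set.sdiff_subset

theorem bergmanKernel_puncturedAnnulus (hr : 0 < r) (hr1 : r < 1) (hz₀ : z₀ ∈ annulus r)
    {z t : Fin 1 → ℂ} (hz : z ∈ puncturedAnnulus r z₀) (ht : t ∈ puncturedAnnulus r z₀) :
    bergmanKernel (puncturedAnnulus r z₀) z t = bergmanKernel (annulus r) z t :=
  bergmanKernel_diff_eq (isOpen_annulus r)
    (fun _ => eventually_notMem_bergmanZeroSet_annulus hr hr1 hz₀) hz ht

theorem bergmanKernel_puncturedAnnulus_ne_zero (hr : 0 < r) (hr1 : r < 1) (hz₀ : z₀ ∈ annulus r)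
    {z : Fin 1 → ℂ} (hz : z ∈ puncturedAnnulus r z₀) :
    bergmanKernel (puncturedAnnulus r z₀) z z₀ ≠ 0 := by
  rw [bergmanKernel_puncturedAnnulus hr hr1 hz₀ hz (self_mem_puncturedAnnulus hz₀)]
  exact fun h => hz.2 ⟨hz.1, h⟩

theorem bergmanZeroSet_puncturedAnnulus (hr : 0 < r) (hr1 : r < 1) (hz₀ : z₀ ∈ annulus r) :
    bergmanZeroSet (puncturedAnnulus r z₀) z₀ = ∅ :=
  Set.eq_empty_of_forall_notMem fun _ hz =>
    bergmanKernel_puncturedAnnulus_ne_zero hr hr1 hz₀ hz.1 hz.2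

theorem tendsto_bergmanKernel_annulus_self (hr : 0 < r) {p : Fin 1 → ℂ}
    (hp : ‖p 0‖ = 1 ∨ ‖p 0‖ = r) :
    Tendsto (fun z => (bergmanKernel (annulus r) z z).re) (𝓝[annulus r] p) atTop := by
  have hcont : Continuous fun z : Fin 1 → ℂ => z 0 := continuous_apply 0
  have hdiff : Differentiable ℂ fun z : Fin 1 → ℂ => z 0 := differentiable_apply 0
  rcases hp with hp | hp
  · refine tendsto_bergmanKernel_self_atTop (isOpen_annulus r) (volume_annulus_ne_top r)
      hdiff.differentiableOn (fun z hz => hz.2) ?_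
    rw [← hp]
    exact (hcont.norm.tendsto p).mono_left nhdsWithin_le_nhds
  · have hp0 : p 0 ≠ 0 := norm_pos_iff.1 (hp ▸ hr)
    -- `r / z` serves as peak function on the inner circle, as `z` does on the outer one.
    refine tendsto_bergmanKernel_self_atTop (isOpen_annulus r) (volume_annulus_ne_top r)
      (h := fun z => r / z 0) ?_ (fun z hz => ?_) ?_
    · intro z hz
      have hz0 : z 0 ≠ 0 := norm_pos_iff.1 (hr.trans hz.1)
      have h1 : DifferentiableAt ℂ (fun z : Fin 1 → ℂ => (z 0)⁻¹) z :=
        (differentiableAt_inv hz0).comp z hdiff.differentiableAt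
      simpa only [div_eq_mul_inv] using (h1.const_mul (r : ℂ)).differentiableWithinAt
    · rw [norm_div, Complex.norm_real, Real.norm_of_nonneg hr.le, div_lt_one (hr.trans hz.1)]
      exact hz.1
    · have h1 : ContinuousAt (fun z : Fin 1 → ℂ => ‖(r : ℂ) / z 0‖) p :=
        (continuousAt_const.div hcont.continuousAt hp0).norm
      have h2 : ‖(r : ℂ) / p 0‖ = 1 := by
        rw [norm_div, Complex.norm_real, Real.norm_of_nonneg hr.le, hp, div_self hr.ne']
      rw [← h2]
      exact h1.tendsto.mono_left nhdsWithin_le_nhds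

theorem mem_frontier_puncturedAnnulus (hr : 0 < r) (hr1 : r < 1) (hz₀ : z₀ ∈ annulus r)
    {p : Fin 1 → ℂ} (hp : p ∈ frontier (puncturedAnnulus r z₀)) :
    p ∈ bergmanZeroSet (annulus r) z₀ ∨ ‖p 0‖ = 1 ∨ ‖p 0‖ = r := by
  rw [(isBoundedDomain_puncturedAnnulus hr hr1 hz₀).isOpen.frontier_eq] at hp
  have hcl : p ∈ {z : Fin 1 → ℂ | r ≤ ‖z 0‖ ∧ ‖z 0‖ ≤ 1} := by
    refine closure_minimal (fun z hz => ?_) ?_ hp.1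
    · exact ⟨hz.1.1.le, hz.1.2.le⟩
    · have hc : Continuous fun z : Fin 1 → ℂ => ‖z 0‖ := (continuous_apply 0).norm
      exact (isClosed_le continuous_const hc).inter (isClosed_le hc continuous_const)
  rcases hcl.1.eq_or_lt with h1 | h1
  · exact Or.inr (Or.inr h1.symm)
  rcases hcl.2.eq_or_lt with h2 | h2
  · exact Or.inr (Or.inl h2)
  · refine Or.inl ?_
    by_contra h
    exact hp.2 ⟨⟨h1, h2⟩, h⟩

theorem diastasisBlowsUp_puncturedAnnulus (hr : 0 < r) (hr1 : r < 1) (hz₀ : z₀ ∈ annulus r) :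
    DiastasisBlowsUp (puncturedAnnulus r z₀) z₀ := by
  intro p hp
  rw [bergmanZeroSet_puncturedAnnulus hr hr1 hz₀, Set.sdiff_empty]
  set Ω := annulus r
  have hΩ : IsOpen Ω := isOpen_annulus r
  have hD := self_mem_puncturedAnnulus hz₀
  have hsub : puncturedAnnulus r z₀ ⊆ Ω := Set.sdiff_subset
  have hpos : ∀ {z}, z ∈ Ω → 0 < (bergmanKernel Ω z z).re := fun hz =>
    bergmanKernel_self_pos hΩ (volume_annulus_ne_top r) hz
  refine (Real.tendsto_log_atTop.comp (f := fun z => (bergmanKernel Ω z z).re *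
    (bergmanKernel Ω z₀ z₀).re / ‖bergmanKernel Ω z z₀‖ ^ 2) ?_).congr' ?_
  · rcases mem_frontier_puncturedAnnulus hr hr1 hz₀ hp with hpA | hpb
    · have h1 : ContinuousAt (fun z => (bergmanKernel Ω z z).re) p :=
        (contDiffOn_bergmanKernel_self hΩ).continuousOn.continuousAt (hΩ.mem_nhds hpA.1)
      have h2 : ContinuousAt (fun z => bergmanKernel Ω z z₀) p :=
        (differentiableOn_bergmanKernel_left hΩ hz₀).continuousOn.continuousAt (hΩ.mem_nhds hpA.1)
      have h3 : Tendsto (fun z => ‖bergmanKernel Ω z z₀‖ ^ 2) (𝓝[puncturedAnnulus r z₀] p)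
          (𝓝[>] 0) := by
        refine tendsto_nhdsWithin_of_tendsto_nhds_of_eventually_within _ ?_ ?_
        · have := (h2.norm.pow 2).tendsto
          have h4 : bergmanKernel Ω p z₀ = 0 := hpA.2
          rw [Pi.pow_apply, h4, norm_zero, zero_pow two_ne_zero] at this
          exact this.mono_left nhdsWithin_le_nhds
        · filter_upwards [self_mem_nhdsWithin] with z hz
          have : bergmanKernel Ω z z₀ ≠ 0 := fun h => hz.2 ⟨hz.1, h⟩
          exact pow_pos (norm_pos_iff.2 this) 2
      simp only [div_eq_mul_inv]
      exact Tendsto.pos_mul_atTop (mul_pos (hpos hpA.1) (hpos hz₀))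
        ((h1.tendsto.mono_left nhdsWithin_le_nhds).mul_const _) h3.inv_tendsto_nhdsGT_zero
    · obtain ⟨M, hM⟩ := exists_norm_bergmanKernel_annulus_le hr hr1 hz₀
      have hM0 : 0 < M := (norm_pos_iff.2 fun h => (hpos hz₀).ne' (by
        rw [h, Complex.zero_re])).trans_le (hM z₀ hz₀)
      have h1 := (tendsto_bergmanKernel_annulus_self hr hpb).mono_left (nhdsWithin_mono p hsub)
      refine tendsto_atTop_mono' _ ?_ (h1.atTop_mul_const
        (by have := hpos hz₀; positivity : 0 < (bergmanKernel Ω z₀ z₀).re / M ^ 2))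
      filter_upwards [self_mem_nhdsWithin] with z hz
      have h2 : 0 < ‖bergmanKernel Ω z z₀‖ := norm_pos_iff.2 fun h => hz.2 ⟨hz.1, h⟩
      have h3 := hpos hz₀
      have h4 := hpos (hsub hz)
      rw [← mul_div_assoc]
      have := hM z (hsub hz)
      gcongr
  · filter_upwards [self_mem_nhdsWithin] with z hz
    simp only [Function.comp_apply, bergmanDiastasis,
      bergmanKernel_puncturedAnnulus hr hr1 hz₀ hz hz,
      bergmanKernel_puncturedAnnulus hr hr1 hz₀ hz hD,
      bergmanKernel_puncturedAnnulus hr hr1 hz₀ hD hD]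
    rfl

/-- The metric depends only on the germ of `log K` on the diagonal. -/
theorem bergmanNorm_congr {n : ℕ} {D Ω : Set (Fin n → ℂ)} (hD : IsOpen D) (hΩ : IsOpen Ω)
    (hvol : volume Ω ≠ ⊤) (hsub : D ⊆ Ω)
    (h : ∀ z ∈ D, bergmanKernel D z z = bergmanKernel Ω z z) {z : Fin n → ℂ} (hz : z ∈ D)
    (X : Fin n → ℂ) : bergmanNorm D z X = bergmanNorm Ω z X := by
  rw [bergmanNorm_eq hD (measure_ne_top_of_subset hsub hvol) hz,
    bergmanNorm_eq hΩ hvol (hsub hz)]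
  congr 2
  refine (InnerProductSpace.laplacian_congr_nhds ?_).eq_of_nhds
  have hcont : ContinuousAt (fun s : ℂ => z + s • X) 0 := by fun_prop
  filter_upwards [hcont.eventually_mem (hD.mem_nhds (by simpa using hz))] with s hs
  rw [h _ hs]

/-- A removed zero is an interior point of the annulus, near which the annulus metric is bounded,
and the metric of the punctured domain is its restriction. The direction of the segment is
immaterial, since the zeros are isolated. -/
theorem exists_segment_puncturedAnnulus (hr : 0 < r) (hr1 : r < 1) (hz₀ : z₀ ∈ annulus r)
    (hA : (bergmanZeroSet (annulus r) z₀).Nonempty) :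
    ∃ (p e : Fin 1 → ℂ) (δ C : ℝ), p ∉ puncturedAnnulus r z₀ ∧ 0 < δ ∧
      (∀ s : ℝ, 0 < s → s ≤ δ → p + s • e ∈ puncturedAnnulus r z₀) ∧
      ∀ s : ℝ, 0 < s → s ≤ δ → bergmanNorm (puncturedAnnulus r z₀) (p + s • e) e ≤ C := by
  obtain ⟨p, hp⟩ := hA
  obtain ⟨C, hC⟩ := eventually_bergmanNorm_le (isOpen_annulus r) (volume_annulus_ne_top r) hp.1
    (fun _ => 1)
  have hcont : Tendsto (fun s : ℝ => p + s • (fun _ : Fin 1 => (1 : ℂ))) (𝓝 0) (𝓝 p) := by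
    have : Continuous fun s : ℝ => p + s • (fun _ : Fin 1 => (1 : ℂ)) := by fun_prop
    simpa using this.tendsto 0
  obtain ⟨R, hR, hball⟩ := Metric.eventually_nhds_iff_ball.1 (hcont.eventually
    (((isOpen_annulus r).eventually_mem hp.1).and (hC.and (eventually_nhdsWithin_iff.1
      (eventually_notMem_bergmanZeroSet_annulus hr hr1 hz₀ hp.1)))))
  have hin : ∀ s : ℝ, 0 < s → s ≤ R / 2 → s ∈ Metric.ball (0 : ℝ) R := fun s h1 h2 => by
    rw [mem_ball_zero_iff, Real.norm_of_nonneg h1.le]; linarith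
  have hmem : ∀ s : ℝ, 0 < s → s ≤ R / 2 →
      p + s • (fun _ : Fin 1 => (1 : ℂ)) ∈ puncturedAnnulus r z₀ := fun s h1 h2 =>
    ⟨(hball s (hin s h1 h2)).1, (hball s (hin s h1 h2)).2.2 fun h => h1.ne' (by
      simpa using congrFun h 0)⟩
  refine ⟨p, fun _ => 1, R / 2, C, fun h => h.2 hp, half_pos hR, hmem, fun s h1 h2 => ?_⟩
  rw [bergmanNorm_congr (isBoundedDomain_puncturedAnnulus hr hr1 hz₀).isOpen (isOpen_annulus r)
    (volume_annulus_ne_top r) Set.sdiff_subset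
    (fun z hz => bergmanKernel_puncturedAnnulus hr hr1 hz₀ hz hz) (hmem s h1 h2)]
  exact (hball s (hin s h1 h2)).2.1

end PuncturedAnnulus

/-! ### The unit ball: kernel at the centre and boundary behaviour. -/

section Ball

variable (m : ℕ)

theorem isOpen_euclideanUnitBall : IsOpen (euclideanUnitBall m) :=
  isOpen_lt (by fun_prop) continuous_const

theorem norm_lt_one_of_mem_euclideanUnitBall {m : ℕ} {z : Fin m → ℂ}
    (hz : z ∈ euclideanUnitBall m) : ‖z‖ < 1 := by
  refine (pi_norm_lt_iff one_pos).2 fun i => ?_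
  have h1 : ‖z i‖ ^ 2 ≤ ∑ i, ‖z i‖ ^ 2 :=
    Finset.single_le_sum (f := fun i => ‖z i‖ ^ 2) (fun i _ => by positivity) (Finset.mem_univ i)
  have h2 : ‖z i‖ ^ 2 < 1 ^ 2 := by simpa using h1.trans_lt hz
  exact lt_of_pow_lt_pow_left₀ 2 zero_le_one h2

theorem isBounded_euclideanUnitBall : Bornology.IsBounded (euclideanUnitBall m) :=
  (Metric.isBounded_ball (x := (0 : Fin m → ℂ)) (r := 1)).subset fun _ hz =>
    mem_ball_zero_iff.2 (norm_lt_one_of_mem_euclideanUnitBall hz)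

theorem volume_euclideanUnitBall_ne_top : volume (euclideanUnitBall m) ≠ ⊤ :=
  (isBounded_euclideanUnitBall m).measure_lt_top.ne

theorem zero_mem_euclideanUnitBall : (0 : Fin m → ℂ) ∈ euclideanUnitBall m := by
  simp [euclideanUnitBall]

theorem balanced_euclideanUnitBall (𝕜 : Type*) [NormedField 𝕜] [NormedSpace 𝕜 ℂ] :
    Balanced 𝕜 (euclideanUnitBall m) := by
  rintro a ha _ ⟨z, hz, rfl⟩
  have hz' : ∑ i, ‖z i‖ ^ 2 < 1 := hz
  refine lt_of_le_of_lt (Finset.sum_le_sum fun i _ => ?_) hz'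
  simp only [Pi.smul_apply, norm_smul]
  gcongr
  exact mul_le_of_le_one_left (norm_nonneg _) ha

theorem isConnected_euclideanUnitBall : IsConnected (euclideanUnitBall m) :=
  ((balanced_euclideanUnitBall m ℝ).starConvex.isPathConnected
    (zero_mem_euclideanUnitBall m)).isConnected

theorem volume_real_euclideanUnitBall_pos : 0 < volume.real (euclideanUnitBall m) :=
  ENNReal.toReal_pos ((isOpen_euclideanUnitBall m).measure_pos volume
    ⟨0, zero_mem_euclideanUnitBall m⟩).ne' (volume_euclideanUnitBall_ne_top m)

variable {m}

/-- Reproducing the constant `1` gives `∫ K(·, w) = 1` after conjugation, and the mean value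
property evaluates this integral as `vol B · K(0, w)`. -/
theorem bergmanKernel_euclideanUnitBall_zero_left {w : Fin m → ℂ} (hw : w ∈ euclideanUnitBall m) :
    bergmanKernel (euclideanUnitBall m) 0 w = (volume.real (euclideanUnitBall m) : ℂ)⁻¹ := by
  set B := euclideanUnitBall m
  have hB : IsOpen B := isOpen_euclideanUnitBall m
  have hvol : volume B ≠ ⊤ := volume_euclideanUnitBall_ne_top m
  have hfin : IsFiniteMeasure (volume.restrict B) := ⟨by simpa using hvol.lt_top⟩
  have hk := isBergmanKernel_bergmanKernel hB
  have hmem := hk.mem w hw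
  have h1 := setIntegral_eq_of_balanced (balanced_euclideanUnitBall m ℂ) hB
    hmem.differentiableOn (hmem.memLp.integrable one_le_two)
  have h2 := hk.reproducing w hw (fun _ => 1) (MemBergmanSpace.of_bounded hB hvol
    (differentiableOn_const _) (C := 1) fun z _ => by simp)
  simp only [one_mul, integral_conj] at h2
  rw [h1] at h2
  have h3 := congrArg conj h2
  rw [Complex.conj_conj, map_one] at h3
  exact eq_inv_of_mul_eq_one_right h3.symm

theorem bergmanKernel_euclideanUnitBall_zero_right {w : Fin m → ℂ} (hw : w ∈ euclideanUnitBall m) :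
    bergmanKernel (euclideanUnitBall m) w 0 = (volume.real (euclideanUnitBall m) : ℂ)⁻¹ := by
  rw [bergmanKernel_conj (isOpen_euclideanUnitBall m) hw (zero_mem_euclideanUnitBall m),
    bergmanKernel_euclideanUnitBall_zero_left hw, map_inv₀, Complex.conj_ofReal]

/-- The peak function at `b` is `z ↦ ⟨z, b⟩`, of modulus below `1` in the ball by Cauchy-Schwarz. -/
theorem tendsto_bergmanKernel_euclideanUnitBall {b : Fin m → ℂ} (hb : ∑ i, ‖b i‖ ^ 2 = 1) :
    Tendsto (fun z => (bergmanKernel (euclideanUnitBall m) z z).re)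
      (𝓝[euclideanUnitBall m] b) atTop := by
  refine tendsto_bergmanKernel_self_atTop (isOpen_euclideanUnitBall m)
    (volume_euclideanUnitBall_ne_top m) (h := fun z => ∑ i, z i * conj (b i))
    (by fun_prop) (fun z hz => ?_) ?_
  · have h1 : ‖∑ i, z i * conj (b i)‖ ≤ ∑ i, ‖z i‖ * ‖b i‖ :=
      (norm_sum_le _ _).trans_eq (by simp)
    have h2 := Finset.sum_mul_sq_le_sq_mul_sq Finset.univ (fun i => ‖z i‖) (fun i => ‖b i‖)
    rw [hb, mul_one] at h2
    have h3 : ‖∑ i, z i * conj (b i)‖ ^ 2 < 1 ^ 2 := by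
      rw [one_pow]
      exact ((pow_le_pow_left₀ (norm_nonneg _) h1 2).trans h2).trans_lt hz
    exact lt_of_pow_lt_pow_left₀ 2 zero_le_one h3
  · have h1 : Continuous fun z : Fin m → ℂ => ‖∑ i, z i * conj (b i)‖ := by fun_prop
    have h2 : ‖∑ i, b i * conj (b i)‖ = 1 := by
      simp only [Complex.mul_conj, Complex.normSq_eq_norm_sq]
      rw [← Complex.ofReal_sum, hb, Complex.ofReal_one, norm_one]
    rw [← h2]
    exact (h1.tendsto b).mono_left nhdsWithin_le_nhds

theorem sum_sq_norm_eq_one_of_mem_closure {b : Fin m → ℂ}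
    (hb : b ∈ closure (euclideanUnitBall m)) (hb' : b ∉ euclideanUnitBall m) :
    ∑ i, ‖b i‖ ^ 2 = 1 := by
  have hcl : IsClosed {z : Fin m → ℂ | ∑ i, ‖z i‖ ^ 2 ≤ 1} :=
    isClosed_le (by fun_prop) continuous_const
  have hsub : euclideanUnitBall m ⊆ {z : Fin m → ℂ | ∑ i, ‖z i‖ ^ 2 ≤ 1} := fun z hz => by
    have h : ∑ i, ‖z i‖ ^ 2 < 1 := hz
    exact h.le
  exact le_antisymm (closure_minimal hsub hcl hb) (not_lt.1 hb')

end Ball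

/-! ### Product domains and the product formula for the kernel. -/

section Product

variable {m : ℕ}

/-- The point of `ℂᵐ⁺¹` with initial part `w` and last coordinate `d`. -/
noncomputable def joinLast (d : Fin 1 → ℂ) (w : Fin m → ℂ) : Fin (m + 1) → ℂ :=
  Fin.snoc (α := fun _ => ℂ) w (d 0)

/-- The splitting of `ℂᵐ⁺¹` into the last coordinate and the initial part. -/
def splitLast (z : Fin (m + 1) → ℂ) : (Fin 1 → ℂ) × (Fin m → ℂ) :=
  (fun _ => z (Fin.last m), fun i => z i.castSucc)

@[simp] theorem splitLast_joinLast (d : Fin 1 → ℂ) (w : Fin m → ℂ) :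
    splitLast (joinLast d w) = (d, w) := by
  simp [splitLast, joinLast, fin_one_const_apply]

@[simp] theorem joinLast_splitLast (z : Fin (m + 1) → ℂ) :
    joinLast (splitLast z).1 (splitLast z).2 = z := by
  ext i
  refine Fin.lastCases ?_ (fun j => ?_) i <;> simp [splitLast, joinLast]

theorem differentiable_splitLast : Differentiable ℂ (splitLast (m := m)) := by
  unfold splitLast
  fun_prop

theorem differentiable_joinLast :
    Differentiable ℂ fun p : (Fin 1 → ℂ) × (Fin m → ℂ) => joinLast p.1 p.2 := by
  refine differentiable_pi.2 fun i => ?_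
  refine Fin.lastCases ?_ (fun j => ?_) i <;> simp only [joinLast, Fin.snoc_last, Fin.snoc_castSucc]
    <;> fun_prop

/-- `splitLast` as an equivalence of measurable spaces. -/
noncomputable def splitLastEquiv (m : ℕ) :
    (Fin (m + 1) → ℂ) ≃ᵐ (Fin 1 → ℂ) × (Fin m → ℂ) where
  toFun := splitLast
  invFun p := joinLast p.1 p.2
  left_inv := joinLast_splitLast
  right_inv p := splitLast_joinLast p.1 p.2
  measurable_toFun := differentiable_splitLast.continuous.measurable
  measurable_invFun := differentiable_joinLast.continuous.measurable

theorem measurePreserving_splitLastEquiv (m : ℕ) :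
    MeasurePreserving (splitLastEquiv m) volume (volume.prod volume) := by
  have h1 := volume_preserving_piFinSuccAbove (fun _ : Fin (m + 1) => ℂ) (Fin.last m)
  have h2 : MeasurePreserving (MeasurableEquiv.funUnique (Fin 1) ℂ).symm volume volume :=
    (volume_preserving_funUnique (Fin 1) ℂ).symm _
  have h3 := (h2.prod (MeasurePreserving.id (volume : Measure (Fin m → ℂ)))).comp h1
  convert h3 using 1
  ext z
  · rfl
  · simp [splitLastEquiv]
    rfl

variable {D : Set (Fin 1 → ℂ)}

theorem ballProd_eq_preimage : ballProd m D = splitLast ⁻¹' (D ×ˢ euclideanUnitBall m) := by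
  ext z
  exact and_comm

theorem joinLast_mem_ballProd {d : Fin 1 → ℂ} {w : Fin m → ℂ} :
    joinLast d w ∈ ballProd m D ↔ d ∈ D ∧ w ∈ euclideanUnitBall m := by
  rw [ballProd_eq_preimage, Set.mem_preimage, splitLast_joinLast, Set.mem_prod]

theorem isOpen_ballProd (hD : IsOpen D) : IsOpen (ballProd m D) :=
  ballProd_eq_preimage (m := m) (D := D) ▸
    (hD.prod (isOpen_euclideanUnitBall m)).preimage differentiable_splitLast.continuous

theorem isBounded_ballProd (hb : Bornology.IsBounded D) : Bornology.IsBounded (ballProd m D) := by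
  obtain ⟨R, hR⟩ := hb.exists_norm_le
  refine isBounded_iff_forall_norm_le.2 ⟨max R 1, fun z hz => ?_⟩
  rw [ballProd_eq_preimage] at hz
  refine (pi_norm_le_iff_of_nonneg (by positivity)).2 fun i => ?_
  refine Fin.lastCases ?_ (fun j => ?_) i
  · exact ((norm_le_pi_norm (splitLast z).1 0).trans (hR _ hz.1)).trans (le_max_left _ _)
  · exact ((norm_le_pi_norm (splitLast z).2 j).trans
      (norm_lt_one_of_mem_euclideanUnitBall hz.2).le).trans (le_max_right _ _)

theorem isBoundedDomain_ballProd (hD : IsBoundedDomain D) : IsBoundedDomain (ballProd m D) where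
  isOpen := isOpen_ballProd hD.isOpen
  isConnected := by
    have h1 : ballProd m D = (fun p : (Fin 1 → ℂ) × (Fin m → ℂ) => joinLast p.1 p.2) ''
        (D ×ˢ euclideanUnitBall m) := by
      rw [ballProd_eq_preimage]
      exact ((splitLastEquiv m).toEquiv.symm.image_eq_preimage_symm _).symm
    rw [h1]
    exact (hD.isConnected.prod (isConnected_euclideanUnitBall m)).image _
      differentiable_joinLast.continuous.continuousOn
  isBounded := isBounded_ballProd hD.isBounded

theorem measurePreserving_restrict_ballProd :
    MeasurePreserving (splitLastEquiv m) (volume.restrict (ballProd m D))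
      ((volume.restrict D).prod (volume.restrict (euclideanUnitBall m))) := by
  rw [Measure.prod_restrict, ballProd_eq_preimage]
  exact (measurePreserving_splitLastEquiv m).restrict_preimage_emb
    (splitLastEquiv m).measurableEmbedding _

theorem memLp_two_mul_prod {α β : Type*} [MeasurableSpace α] [MeasurableSpace β] {μ : Measure α}
    {ν : Measure β} [SFinite ν] [SFinite μ] {f : α → ℂ} {g : β → ℂ} (hf : MemLp f 2 μ)
    (hg : MemLp g 2 ν) : MemLp (fun p : α × β => f p.1 * g p.2) 2 (μ.prod ν) := by
  have hm : AEStronglyMeasurable (fun p : α × β => f p.1 * g p.2) (μ.prod ν) :=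
    hf.1.comp_fst.mul hg.1.comp_snd
  refine (memLp_two_iff_integrable_sq_norm hm).2 ?_
  simp only [norm_mul, mul_pow]
  exact ((memLp_two_iff_integrable_sq_norm hf.1).1 hf).mul_prod
    ((memLp_two_iff_integrable_sq_norm hg.1).1 hg)

/-- The Bergman kernel of a product is the product of the Bergman kernels. -/
theorem isBergmanKernel_ballProd (hD : IsOpen D) : IsBergmanKernel (ballProd m D) fun z t =>
    bergmanKernel D (splitLast z).1 (splitLast t).1 *
      bergmanKernel (euclideanUnitBall m) (splitLast z).2 (splitLast t).2 where
  mem t ht := by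
    rw [ballProd_eq_preimage] at ht
    have hk1 := (isBergmanKernel_bergmanKernel hD).mem _ ht.1
    have hk2 := (isBergmanKernel_bergmanKernel (isOpen_euclideanUnitBall m)).mem _ ht.2
    refine ⟨?_, ?_⟩
    · rw [ballProd_eq_preimage]
      exact (hk1.differentiableOn.comp differentiable_splitLast.fst.differentiableOn
        fun z hz => hz.1).mul (hk2.differentiableOn.comp
          differentiable_splitLast.snd.differentiableOn fun z hz => hz.2)
    · exact (memLp_two_mul_prod hk1.memLp hk2.memLp).comp_measurePreserving
        measurePreserving_restrict_ballProd
  reproducing t ht f hf := by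
    have hB := isOpen_euclideanUnitBall m
    have hk := isBergmanKernel_bergmanKernel hB
    have hkD := isBergmanKernel_bergmanKernel hD
    set B := euclideanUnitBall m
    set μ := (volume.restrict D).prod (volume.restrict B)
    have ht' := ht
    rw [ballProd_eq_preimage] at ht'
    have hmp := measurePreserving_restrict_ballProd (m := m) (D := D)
    have hΩ : IsOpen (ballProd m D) := isOpen_ballProd hD
    have hfmem : MemLp (fun p : (Fin 1 → ℂ) × (Fin m → ℂ) => f (joinLast p.1 p.2)) 2 μ := by
      have := hf.memLp.comp_measurePreserving (hmp.symm _)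
      exact this
    have hfdiff : ∀ {d : Fin 1 → ℂ} {w : Fin m → ℂ}, d ∈ D → w ∈ B →
        DifferentiableAt ℂ (fun p : (Fin 1 → ℂ) × (Fin m → ℂ) => f (joinLast p.1 p.2)) (d, w) :=
      fun {d w} hd hw => DifferentiableAt.comp
        (f := fun p : (Fin 1 → ℂ) × (Fin m → ℂ) => joinLast p.1 p.2) (g := f) (d, w)
        (hf.differentiableOn.differentiableAt (hΩ.mem_nhds (joinLast_mem_ballProd.2 ⟨hd, hw⟩)))
        differentiable_joinLast.differentiableAt
    have hsq := (memLp_two_iff_integrable_sq_norm hfmem.1).1 hfmem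
    have hslice : ∀ᵐ d ∂(volume.restrict D), MemBergmanSpace B fun w => f (joinLast d w) := by
      filter_upwards [hsq.prod_right_ae, ae_restrict_mem hD.measurableSet] with d hd hdD
      have hdiff : DifferentiableOn ℂ (fun w => f (joinLast d w)) B := fun w hw =>
        ((hfdiff hdD hw).comp w (by fun_prop :
          DifferentiableAt ℂ (fun w : Fin m → ℂ => (d, w)) w)).differentiableWithinAt
      exact ⟨hdiff, (memLp_two_iff_integrable_sq_norm
        (hdiff.continuousOn.aestronglyMeasurable hB.measurableSet)).2 hd⟩
    -- Fubini yields good slices only almost everywhere, but here the slice through the given `t` is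
    -- needed. The ball's extremal property bounds `|f(d, ·)|²` at that point by a constant times
    -- the `L²` mass of the slice over `d`, which is integrable in `d`.
    have hlast : MemBergmanSpace D fun d => f (joinLast d (splitLast t).2) := by
      have hdiff : DifferentiableOn ℂ (fun d => f (joinLast d (splitLast t).2)) D := fun d hd =>
        (DifferentiableAt.comp (g := fun p : (Fin 1 → ℂ) × (Fin m → ℂ) => f (joinLast p.1 p.2))
          (f := fun d : Fin 1 → ℂ => (d, (splitLast t).2)) d (hfdiff hd ht'.2)
          (by fun_prop)).differentiableWithinAt
      have hm := hdiff.continuousOn.aestronglyMeasurable (μ := volume) hD.measurableSet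
      refine ⟨hdiff, (memLp_two_iff_integrable_sq_norm hm).2 ?_⟩
      refine (hsq.integral_prod_left.const_mul
        (bergmanKernel B (splitLast t).2 (splitLast t).2).re).mono' (hm.norm.pow 2) ?_
      filter_upwards [hslice] with d hd
      rw [Real.norm_of_nonneg (by positivity)]
      exact hd.sq_norm_le hB ht'.2
    have hint : Integrable (fun p : (Fin 1 → ℂ) × (Fin m → ℂ) => f (joinLast p.1 p.2) *
        conj (bergmanKernel D p.1 (splitLast t).1 * bergmanKernel B p.2 (splitLast t).2)) μ := by
      have := memLp_two_mul_prod (hkD.mem _ ht'.1).memLp (hk.mem _ ht'.2).memLp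
      exact hfmem.integrable_mul this.star
    symm
    calc ∫ z in ballProd m D, f z * conj (bergmanKernel D (splitLast z).1 (splitLast t).1 *
          bergmanKernel B (splitLast z).2 (splitLast t).2)
        = ∫ p, f (joinLast p.1 p.2) * conj (bergmanKernel D p.1 (splitLast t).1 *
          bergmanKernel B p.2 (splitLast t).2) ∂μ := by
          rw [← hmp.integral_comp']
          refine integral_congr_ae (ae_of_all _ fun z => ?_)
          simp [splitLastEquiv]
      _ = ∫ d in D, ∫ w in B, f (joinLast d w) * conj (bergmanKernel D d (splitLast t).1 *
          bergmanKernel B w (splitLast t).2) := integral_prod _ hint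
      _ = ∫ d in D, f (joinLast d (splitLast t).2) * conj (bergmanKernel D d (splitLast t).1) := by
          refine integral_congr_ae ?_
          filter_upwards [hslice] with d hd
          rw [hk.reproducing _ ht'.2 _ hd, ← integral_mul_const]
          refine integral_congr_ae (ae_of_all _ fun w => ?_)
          simp only [map_mul]
          ring
      _ = f (joinLast (splitLast t).1 (splitLast t).2) := (hkD.reproducing _ ht'.1 _ hlast).symm
      _ = f t := by rw [joinLast_splitLast]

theorem bergmanKernel_ballProd (hD : IsOpen D) {z t : Fin (m + 1) → ℂ} (hz : z ∈ ballProd m D)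
    (ht : t ∈ ballProd m D) : bergmanKernel (ballProd m D) z t =
      bergmanKernel D (splitLast z).1 (splitLast t).1 *
        bergmanKernel (euclideanUnitBall m) (splitLast z).2 (splitLast t).2 :=
  bergmanKernel_eq (isBergmanKernel_ballProd hD) hz ht

end Product

/-! ### Diastasis and metric of the product. -/

section ProductMetric

variable {m : ℕ} {D : Set (Fin 1 → ℂ)}

/-- The ball kernel with one argument `0` is `1 / vol B`, so the ball contributes `log (K_B(w, w)
vol B)`. -/
theorem bergmanDiastasis_ballProd (hD : IsOpen D) (hb : Bornology.IsBounded D) {z₀ : Fin 1 → ℂ}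
    (hz₀ : z₀ ∈ D) {z : Fin (m + 1) → ℂ} (hz : z ∈ ballProd m D)
    (h0 : bergmanKernel D (splitLast z).1 z₀ ≠ 0) :
    bergmanDiastasis (ballProd m D) (joinLast z₀ 0) z =
      bergmanDiastasis D z₀ (splitLast z).1 +
        Real.log ((bergmanKernel (euclideanUnitBall m) (splitLast z).2 (splitLast z).2).re *
          volume.real (euclideanUnitBall m)) := by
  have hB := isOpen_euclideanUnitBall m
  have h0B := zero_mem_euclideanUnitBall m
  have hvB := volume_euclideanUnitBall_ne_top m
  have ht : joinLast z₀ (0 : Fin m → ℂ) ∈ ballProd m D := joinLast_mem_ballProd.2 ⟨hz₀, h0B⟩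
  have hz' := hz
  rw [ballProd_eq_preimage] at hz'
  have hV := volume_real_euclideanUnitBall_pos m
  have p1 := bergmanKernel_self_pos hD hb.measure_lt_top.ne hz'.1
  have p2 := bergmanKernel_self_pos hD hb.measure_lt_top.ne hz₀
  have p3 := bergmanKernel_self_pos hB hvB hz'.2
  have p4 : 0 < ‖bergmanKernel D (splitLast z).1 z₀‖ := norm_pos_iff.2 h0
  simp only [bergmanDiastasis]
  rw [bergmanKernel_ballProd hD hz hz, bergmanKernel_ballProd hD ht ht,
    bergmanKernel_ballProd hD hz ht, splitLast_joinLast,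
    ← Real.log_mul (by positivity) (by positivity)]
  simp only [bergmanKernel_euclideanUnitBall_zero_right h0B,
    bergmanKernel_euclideanUnitBall_zero_right hz'.2]
  rw [bergmanKernel_self_eq_ofReal hD hz'.1, bergmanKernel_self_eq_ofReal hB hz'.2,
    bergmanKernel_self_eq_ofReal hD hz₀]
  simp only [← Complex.ofReal_inv, ← Complex.ofReal_mul, Complex.ofReal_re, norm_mul,
    Complex.norm_real, Real.norm_of_nonneg (inv_nonneg.2 hV.le)]
  congr 1
  field_simp

/-- Both summands are nonnegative, by Cauchy-Schwarz and by testing on constants. At a boundary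
point either the `D`-component lies on the boundary of `D`, or the ball component lies on the
sphere, so one summand tends to infinity. -/
theorem diastasisBlowsUp_ballProd (hD : IsOpen D) (hb : Bornology.IsBounded D) {z₀ : Fin 1 → ℂ}
    (hz₀ : z₀ ∈ D) (hA : bergmanZeroSet D z₀ = ∅) (hΦ : DiastasisBlowsUp D z₀) :
    DiastasisBlowsUp (ballProd m D) (joinLast z₀ 0) := by
  intro p hp
  have hB := isOpen_euclideanUnitBall m
  have hvB := volume_euclideanUnitBall_ne_top m
  have hne : ∀ {d}, d ∈ D → bergmanKernel D d z₀ ≠ 0 := fun hd h =>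
    (Set.eq_empty_iff_forall_notMem.1 hA _) ⟨hd, h⟩
  set V := volume.real (euclideanUnitBall m)
  have hnn1 : ∀ {d}, d ∈ D → 0 ≤ bergmanDiastasis D z₀ d := fun {d} hd => by
    refine Real.log_nonneg ((one_le_div (pow_pos (norm_pos_iff.2 (hne hd)) 2)).2 ?_)
    exact sq_norm_bergmanKernel_le hD hd hz₀
  have hnn2 : ∀ {w}, w ∈ euclideanUnitBall m →
      0 ≤ Real.log ((bergmanKernel (euclideanUnitBall m) w w).re * V) := fun hw =>
    Real.log_nonneg (one_le_bergmanKernel_self_mul_volume hB hvB hw)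
  have hform : ∀ z ∈ ballProd m D, bergmanDiastasis (ballProd m D) (joinLast z₀ 0) z =
      bergmanDiastasis D z₀ (splitLast z).1 +
        Real.log ((bergmanKernel (euclideanUnitBall m) (splitLast z).2 (splitLast z).2).re * V) :=
    fun z hz => bergmanDiastasis_ballProd hD hb hz₀ hz (hne (ballProd_eq_preimage.subset hz).1)
  have hsplit := (differentiable_splitLast (m := m)).continuous
  rw [(isOpen_ballProd hD).frontier_eq, ballProd_eq_preimage] at hp
  have hcl := hsplit.closure_preimage_subset _ hp.1
  rw [closure_prod_eq] at hcl
  have hmaps : ∀ z ∈ ballProd m D, (splitLast z).1 ∈ D ∧ (splitLast z).2 ∈ euclideanUnitBall m :=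
    fun z hz => ballProd_eq_preimage.subset hz
  refine Tendsto.mono_left ?_ (nhdsWithin_mono p Set.sdiff_subset)
  by_cases hpD : (splitLast p).1 ∈ D
  · have hpB : (splitLast p).2 ∉ euclideanUnitBall m := fun h => hp.2 ⟨hpD, h⟩
    have h1 := tendsto_bergmanKernel_euclideanUnitBall
      (sum_sq_norm_eq_one_of_mem_closure hcl.2 hpB)
    have h2 : Tendsto (fun z => (splitLast z).2) (𝓝[ballProd m D] p)
        (𝓝[euclideanUnitBall m] (splitLast p).2) :=
      hsplit.snd.continuousWithinAt.tendsto_nhdsWithin fun z hz => (hmaps z hz).2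
    have hV : 0 < V := volume_real_euclideanUnitBall_pos m
    refine tendsto_atTop_mono' _ ?_
      (Real.tendsto_log_atTop.comp ((h1.comp h2).atTop_mul_const hV))
    filter_upwards [self_mem_nhdsWithin] with z hz
    rw [hform z hz]
    exact le_add_of_nonneg_left (hnn1 (hmaps z hz).1)
  · have hpf : (splitLast p).1 ∈ frontier D := by
      rw [hD.frontier_eq]
      exact ⟨hcl.1, hpD⟩
    have h1 := hΦ _ hpf
    rw [hA, Set.sdiff_empty] at h1
    have h2 : Tendsto (fun z => (splitLast z).1) (𝓝[ballProd m D] p) (𝓝[D] (splitLast p).1) :=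
      hsplit.fst.continuousWithinAt.tendsto_nhdsWithin fun z hz => (hmaps z hz).1
    refine tendsto_atTop_mono' _ ?_ (h1.comp h2)
    filter_upwards [self_mem_nhdsWithin] with z hz
    rw [hform z hz]
    exact le_add_of_nonneg_right (hnn2 (hmaps z hz).2)

theorem joinLast_add_smul {𝕜 : Type*} [NormedField 𝕜] [NormedSpace 𝕜 ℂ] (d e : Fin 1 → ℂ) (s : 𝕜) :
    joinLast d (0 : Fin m → ℂ) + s • joinLast e (0 : Fin m → ℂ) = joinLast (d + s • e) 0 := by
  ext i
  refine Fin.lastCases ?_ (fun j => ?_) i <;> simp [joinLast]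

/-- Along the slice through the centre of the ball, `log K` of the product differs from that of `D`
by a constant. -/
theorem bergmanNorm_ballProd (hD : IsOpen D) (hb : Bornology.IsBounded D) {d : Fin 1 → ℂ}
    (hd : d ∈ D) (e : Fin 1 → ℂ) :
    bergmanNorm (ballProd m D) (joinLast d 0) (joinLast e 0) = bergmanNorm D d e := by
  have h0B := zero_mem_euclideanUnitBall m
  have hB := isOpen_euclideanUnitBall m
  have hpos := bergmanKernel_self_pos hB (volume_euclideanUnitBall_ne_top m) h0B
  set c := (bergmanKernel (euclideanUnitBall m) 0 0).re
  have hvD : volume D ≠ ⊤ := hb.measure_lt_top.ne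
  rw [bergmanNorm_eq (isOpen_ballProd hD) (isBounded_ballProd hb).measure_lt_top.ne
    (joinLast_mem_ballProd.2 ⟨hd, h0B⟩), bergmanNorm_eq hD hvD hd]
  have hcont : ContinuousAt (fun s : ℂ => d + s • e) 0 := by fun_prop
  have hmem := hcont.eventually_mem (hD.mem_nhds (by simpa using hd))
  set g : ℂ → ℝ := fun s => Real.log (bergmanKernel D (d + s • e) (d + s • e)).re
  have hg : ContDiffAt ℝ 2 g 0 := by
    have h1 : ContDiffAt ℝ 2 (fun z => Real.log (bergmanKernel D z z).re) (d + (0 : ℂ) • e) :=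
      contDiffAt_log_bergmanKernel_self hD hvD (by simpa using hd)
    exact h1.comp (0 : ℂ) (f := fun s : ℂ => d + s • e) (by fun_prop)
  have hlap : Laplacian.laplacian (fun s : ℂ => Real.log (bergmanKernel (ballProd m D)
      (joinLast d 0 + s • joinLast e 0) (joinLast d 0 + s • joinLast e 0)).re) 0 =
      Laplacian.laplacian ((fun _ : ℂ => Real.log c) + g) 0 := by
    refine (InnerProductSpace.laplacian_congr_nhds ?_).eq_of_nhds
    filter_upwards [hmem] with s hs
    have hs' : joinLast (d + s • e) (0 : Fin m → ℂ) ∈ ballProd m D :=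
      joinLast_mem_ballProd.2 ⟨hs, h0B⟩
    rw [joinLast_add_smul, bergmanKernel_ballProd hD hs' hs', splitLast_joinLast,
      bergmanKernel_self_eq_ofReal hD hs, bergmanKernel_self_eq_ofReal hB h0B,
      ← Complex.ofReal_mul, Complex.ofReal_re,
      Real.log_mul (bergmanKernel_self_pos hD hvD hs).ne' hpos.ne', add_comm]
    rfl
  rw [hlap, ContDiffAt.laplacian_add contDiffAt_const hg, InnerProductSpace.laplacian_const]
  simp

theorem not_bergmanComplete_ballProd_of_segment (hD : IsOpen D) (hb : Bornology.IsBounded D)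
    {p e : Fin 1 → ℂ} (hp : p ∉ D) {δ C : ℝ} (hδ : 0 < δ)
    (hmem : ∀ s : ℝ, 0 < s → s ≤ δ → p + s • e ∈ D)
    (hC : ∀ s : ℝ, 0 < s → s ≤ δ → bergmanNorm D (p + s • e) e ≤ C) :
    ¬ BergmanComplete (ballProd m D) := by
  refine not_bergmanComplete_of_segment (isOpen_ballProd hD) (isBounded_ballProd hb)
    (p := joinLast p 0) (e := joinLast e 0) (fun h => hp (joinLast_mem_ballProd.1 h).1) hδ
    (C := C) (fun s h1 h2 => ?_) fun s h1 h2 => ?_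
  · rw [joinLast_add_smul]
    exact joinLast_mem_ballProd.2 ⟨hmem s h1 h2, zero_mem_euclideanUnitBall m⟩
  · rw [joinLast_add_smul, bergmanNorm_ballProd hD hb (hmem s h1 h2)]
    exact hC s h1 h2

end ProductMetric

/-! ### The main theorem. -/

theorem mainTheorem9 :
    (∀ n : ℕ, 1 ≤ n → ∃ Ω : Set (Fin n → ℂ),
      IsBoundedDomain Ω ∧ ConditionII Ω ∧ ¬ BergmanComplete Ω) ∧
    (∀ r : ℝ, 0 < r → r < 1 →
      (∃ z₀ ∈ annulus r, (bergmanZeroSet (annulus r) z₀).Nonempty) ∧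
      ∀ z₀ ∈ annulus r, (bergmanZeroSet (annulus r) z₀).Nonempty →
        (IsBoundedDomain (puncturedAnnulus r z₀) ∧
          z₀ ∈ puncturedAnnulus r z₀ ∧
          bergmanZeroSet (puncturedAnnulus r z₀) z₀ = ∅ ∧
          DiastasisBlowsUp (puncturedAnnulus r z₀) z₀ ∧
          ¬ BergmanComplete (puncturedAnnulus r z₀)) ∧
        ∀ m : ℕ, 1 ≤ m →
          IsBoundedDomain (ballProd m (puncturedAnnulus r z₀)) ∧
          ConditionII (ballProd m (puncturedAnnulus r z₀)) ∧
          ¬ BergmanComplete (ballProd m (puncturedAnnulus r z₀))) := by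
  have hD : ∀ r : ℝ, 0 < r → r < 1 → ∀ z₀ ∈ annulus r, (bergmanZeroSet (annulus r) z₀).Nonempty →
      (IsBoundedDomain (puncturedAnnulus r z₀) ∧
        z₀ ∈ puncturedAnnulus r z₀ ∧
        bergmanZeroSet (puncturedAnnulus r z₀) z₀ = ∅ ∧
        DiastasisBlowsUp (puncturedAnnulus r z₀) z₀ ∧
        ¬ BergmanComplete (puncturedAnnulus r z₀)) ∧
      ∀ m : ℕ, 1 ≤ m →
        IsBoundedDomain (ballProd m (puncturedAnnulus r z₀)) ∧
        ConditionII (ballProd m (puncturedAnnulus r z₀)) ∧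
        ¬ BergmanComplete (ballProd m (puncturedAnnulus r z₀)) := by
    intro r hr hr1 z₀ hz₀ hA
    have hdom := isBoundedDomain_puncturedAnnulus hr hr1 hz₀
    have hmem := self_mem_puncturedAnnulus hz₀
    have hzero := bergmanZeroSet_puncturedAnnulus hr hr1 hz₀
    have hblow := diastasisBlowsUp_puncturedAnnulus hr hr1 hz₀
    obtain ⟨p, e, δ, C, hp, hδ, hseg, hC⟩ := exists_segment_puncturedAnnulus hr hr1 hz₀ hA
    refine ⟨⟨hdom, hmem, hzero, hblow,
      not_bergmanComplete_of_segment hdom.isOpen hdom.isBounded hp hδ hseg hC⟩, fun m _ => ?_⟩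
    exact ⟨isBoundedDomain_ballProd hdom,
      ⟨joinLast z₀ 0, joinLast_mem_ballProd.2 ⟨hmem, zero_mem_euclideanUnitBall m⟩,
        diastasisBlowsUp_ballProd hdom.isOpen hdom.isBounded hmem hzero hblow⟩,
      not_bergmanComplete_ballProd_of_segment hdom.isOpen hdom.isBounded hp hδ hseg hC⟩
  refine ⟨fun n hn => ?_, fun r hr hr1 =>
    ⟨exists_bergmanKernel_annulus_eq_zero hr hr1, hD r hr hr1⟩⟩
  have h0 : (0 : ℝ) < 1 / 2 := by norm_num
  have h1 : (1 / 2 : ℝ) < 1 := by norm_num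
  obtain ⟨z₀, hz₀, hA⟩ := exists_bergmanKernel_annulus_eq_zero h0 h1
  obtain ⟨⟨hdom, hmem, -, hblow, hcompl⟩, hprod⟩ := hD _ h0 h1 z₀ hz₀ hA
  -- In dimension one the punctured annulus with `r = 1/2` is itself the example; in dimension `m +
  -- 1` with `m ≥ 1` it is the product with the ball of `ℂᵐ`.
  obtain ⟨m, rfl⟩ := Nat.exists_eq_add_of_le' hn
  rcases m.eq_zero_or_pos with rfl | hm
  · exact ⟨_, hdom, ⟨z₀, hmem, hblow⟩, hcompl⟩
  · exact ⟨_, hprod m hm⟩
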